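/- **Setting.** Let $\Lambda=\bigcup_{i=1}^M(p_i+\mathsf A\mathbb Z^d)\subset\mathbb R^d$ be a multilattice ($\mathsf A$ non-singular, $p_1,\dots,p_M$ distinct modulo $\mathsf A\mathbb Z^d$) with lattice-periodic species $z_\ell$. For $u:\Lambda\to\mathbb R^d$ put $\boldsymbol r_{\ell k}(u)=\ell+u(\ell)-k-u(k)$, $r_{\ell k}(u)=|\boldsymbol r_{\ell k}(u)|$, $r_{\ell k}=|\ell-k|$. Fix $\Upsilon>0$ and let $\|Du\|^2=\sum_{\ell\in\Lambda}\sum_{\rho\in\Lambda-\ell}e^{-2\Upsilon|\rho|}|u(\ell+\rho)-u(\ell)|^2$. Call $u$ admissible if $\|Du\|<\infty$ and, for some $\mathfrak m>0$, $r_{\ell k}(u)\ge\mathfrak m$ for all $\ell\ne k$. **Hamiltonian.** For orbitals $1\le a,b\le N_{\rm b}$ let $$\mathcal H(u)^{ab}_{\ell k}=h^{ab}(\boldsymbol r_{\ell k}(u),z_\ell,z_k)+\delta_{\ell k}\sum_{m\ne\ell}t^{ab}(\boldsymbol r_{\ell m}(u),z_\ell,z_m),$$ acting on $\ell^2(\Lambda\times\{1,\dots,N_{\rm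 b}\})$, where $h^{ab}(\cdot,z,z')$ and $t^{ab}(\cdot,z,z')$ are real-valued $C^1$ functions on $\mathbb R^d$ with $|h^{ab}(r)|+|\nabla h^{ab}(r)|\le h_0e^{-\gamma_0|r|}$ and $|t^{ab}(r)|+|\nabla t^{ab}(r)|\le h_0e^{-\gamma_0|r|}$ ($h_0,\gamma_0>0$), $h^{ab}(r,z,z')=h^{ba}(-r,z',z)$ and $t^{ab}=t^{ba}$. **Gap.** Write $\mathcal H^{\rm ref}=\mathcal H(0)$ and let $\varepsilon_1(\xi)\le\dots\le\varepsilon_{MN_{\rm b}}(\xi)$ be the eigenvalues of its Bloch matrices $$[\mathcal H_\xi]^{ab}_{ij}=\sum_{\alpha\in\mathbb Z^d}[\mathcal H^{\rm ref}]^{ab}_{p_i+\mathsf A\alpha,\,p_j}\,e^{-i(p_i-p_j+\mathsf A\alpha)\cdot\xi},\qquad \xi\in\Gamma^*=2\pi\mathsf A^{-\rm T}[-\tfrac12,\tfrac12)^d.$$ Let $1\le N_0<MN_{\rm b}$ and $\varepsilon_{\rm F}\notin\sigma(\mathcal H^{\rm ref})$ with $\varepsilon_{N_0}(\xi)<\varepsilon_{\rm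 F}<\varepsilon_{N_0+1}(\xi)$ for all $\xi\in\Gamma^*$. Set $\mathsf{gap}_-=\min_\xi\varepsilon_{N_0+1}(\xi)-\max_\xi\varepsilon_{N_0}(\xi)$ and $E_*=\frac12(\min_\xi\varepsilon_{N_0+1}(\xi)+\max_\xi\varepsilon_{N_0}(\xi))$. Let $\rho(u)=\chi_{(-\infty,\varepsilon_{\rm F})}(\mathcal H(u))$ be the density matrix and $\mathfrak d(u)=\mathrm{dist}(E_*,\sigma(\mathcal H(u)))$. **Proposition (Locality of the Derivative).** Let $u$ be admissible with separation constant $\mathfrak m$, and suppose that $\mathcal H(u)$ has no spectrum in the closed interval with end points $\varepsilon_{\rm F}$ and $E_*$ (in particular $\varepsilon_{\rm F}\notin\sigma(\mathcal H(u))$; for $\varepsilon_{\rm F}=E_*$ this is the whole condition). Then for all $\ell\ne k$ in $\Lambda$, $1\le a,b\le N_{\rm b}$ and $1\le i\le d$ the partial derivative of $[\rho(u)]_{\ell\ell,ab}$ with respect to $[u(k)]_i$ exists, and for every integer $q\ge1$ $$\left|\frac{\partial[\rho(u)]_{\ell\ell,ab}}{\partial[u(k)]_i}\right|\le\left[\frac{C_q(\mathsf{gap}_-)}{(1+r_{\ell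 k})^q}+C(u)\right]^2e^{-2\eta_-r_{\ell k}},$$ $$\eta_-=c_0\min\{h_0,\gamma_0^d\,\mathsf{gap}_-\},\qquad C_q(g)=c\,q!\,\frac{g^q-1}{g^{q+1}(g-1)}\quad(C_q(1)=c\,q!\,q).$$ Here $c_0>0$ depends only on $d,\mathfrak m,h_0,\gamma_0,N_{\rm b}$; $c>0$ depends only on $d,\mathfrak m,h_0,\gamma_0,N_{\rm b},M$; and, for a given model (that is, given $\mathfrak m$, $\Lambda$, the species, $h$, $t$, $\Upsilon$, $N_0$, $\varepsilon_{\rm F}$), $C(u)>0$ depends on $u$ only through $\|Du\|$ and $\mathfrak d(u)$. With the same $c_0$, the same estimate also holds with $c$ replaced by constants $c'_q>0$ depending only on $d,\mathfrak m,h_0,\gamma_0,N_{\rm b},M,q$, and with $C(u)$ replaced by some $C'(u)\ge0$ that, for a given model, depends on $u$ only through $\|Du\|$ and $\mathfrak d(u)$ and tends to $0$ as $\|Du\|\to0$ with $\mathfrak d(u)$ fixed; in particular $C'(0)=0$, which is the estimate for the homogeneous crystal. -/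

import Mathlib

open Filter Topology
open scoped ENNReal Nat

/-- A homogeneous multilattice: the non-singular matrix `A` of a Bravais lattice `A ℤ^d` in `ℝ^d`,
together with `M` shift vectors, pairwise distinct modulo `A ℤ^d` (so that a unit cell contains
exactly `M` atoms). -/
structure Multilattice (d M : ℕ) where
  A : Matrix (Fin d) (Fin d) ℝ
  det_ne_zero : A.det ≠ 0
  p : Fin M → EuclideanSpace ℝ (Fin d)
  p_distinct : ∀ (i j : Fin M) (α : Fin d → ℤ),
    p i = p j + WithLp.toLp 2 (A.mulVec (fun n => (α n : ℝ))) → i = j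

namespace Multilattice

variable {d M : ℕ}

/-- Labels of the lattice sites: `(i, α)` stands for the site `p i + A α`. -/
abbrev Site (_ : Multilattice d M) : Type := Fin M × (Fin d → ℤ)

/-- The Bravais lattice vector `A α`. -/
noncomputable def vec (L : Multilattice d M) (α : Fin d → ℤ) : EuclideanSpace ℝ (Fin d) :=
  WithLp.toLp 2 (L.A.mulVec (fun n => (α n : ℝ)))

/-- The position in `ℝ^d` of a lattice site. -/
noncomputable def pos (L : Multilattice d M) (ℓ : L.Site) : EuclideanSpace ℝ (Fin d) :=
  L.p ℓ.1 + L.vec ℓ.2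

/-- The multilattice `Λ = ⋃ i, (p i + A ℤ^d)` as a subset of `ℝ^d`. -/
def carrier (L : Multilattice d M) : Set (EuclideanSpace ℝ (Fin d)) :=
  ⋃ i : Fin M, {x | ∃ α : Fin d → ℤ, x = L.p i + L.vec α}

theorem range_pos (L : Multilattice d M) : Set.range L.pos = L.carrier := by
  ext x
  simp only [Set.mem_range, carrier, Set.mem_iUnion, Set.mem_ofPred_eq, pos, Prod.exists]
  exact ⟨fun ⟨i, α, h⟩ => ⟨i, α, h.symm⟩, fun ⟨i, α, h⟩ => ⟨i, α, h.symm⟩⟩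

theorem vec_add (L : Multilattice d M) (α β : Fin d → ℤ) :
    L.vec (α + β) = L.vec α + L.vec β := by
  have h : (fun n => (((α + β) n : ℤ) : ℝ)) = (fun n => (α n : ℝ)) + (fun n => (β n : ℝ)) := by
    funext n; simp
  simp only [vec, h, Matrix.mulVec_add, WithLp.toLp_add]

theorem vec_neg (L : Multilattice d M) (α : Fin d → ℤ) : L.vec (-α) = -L.vec α := by
  have h : (fun n => (((-α) n : ℤ) : ℝ)) = -(fun n => (α n : ℝ)) := by
    funext n; simp
  simp only [vec, h, Matrix.mulVec_neg, WithLp.toLp_neg]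

/-- The labels parametrise the points of `Λ` without repetition. -/
theorem pos_injective (L : Multilattice d M) : Function.Injective L.pos := by
  rintro ⟨i, α⟩ ⟨j, β⟩ h
  simp only [pos] at h
  have h1 : L.p i = L.p j + L.vec (β - α) := by
    rw [sub_eq_add_neg, L.vec_add, L.vec_neg, ← add_assoc, ← h]; abel
  obtain rfl := L.p_distinct i j (β - α) h1
  have h2 : L.vec α = L.vec β := add_left_cancel h
  have h3 : L.A.mulVec (fun n => (α n : ℝ)) = L.A.mulVec (fun n => (β n : ℝ)) := by
    simpa [vec] using h2
  have h4 := Matrix.mulVec_injective_of_isUnit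
    ((Matrix.isUnit_iff_isUnit_det _).2 (isUnit_iff_ne_zero.2 L.det_ne_zero)) h3
  have h5 : α = β := by
    funext n; exact_mod_cast congrFun h4 n
  rw [h5]

/-- The vector `r_{ℓk}(u) = ℓ + u(ℓ) - k - u(k)`. -/
noncomputable def bond (L : Multilattice d M) (u : L.Site → EuclideanSpace ℝ (Fin d))
    (ℓ k : L.Site) : EuclideanSpace ℝ (Fin d) :=
  (L.pos ℓ + u ℓ) - (L.pos k + u k)

/-- The reference distance `r_{ℓk} = |ℓ - k|`. -/
noncomputable def refDist (L : Multilattice d M) (ℓ k : L.Site) : ℝ := ‖L.pos ℓ - L.pos k‖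

/-- `‖Du‖² = ∑_ℓ ∑_ρ e^{-2 Υ |ρ|} |u(ℓ + ρ) - u(ℓ)|²`, where `ρ = k - ℓ` runs over `Λ - ℓ`. -/
noncomputable def strainSq (L : Multilattice d M) (Υ : ℝ)
    (u : L.Site → EuclideanSpace ℝ (Fin d)) : ℝ≥0∞ :=
  ∑' ℓ : L.Site, ∑' k : L.Site,
    ENNReal.ofReal (Real.exp (-2 * Υ * ‖L.pos k - L.pos ℓ‖) * ‖u k - u ℓ‖ ^ 2)

/-- The energy seminorm `‖Du‖`. -/
noncomputable def strainNorm (L : Multilattice d M) (Υ : ℝ)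
    (u : L.Site → EuclideanSpace ℝ (Fin d)) : ℝ :=
  Real.sqrt (L.strainSq Υ u).toReal

/-- Distinct atoms of the deformed configuration have distance at least `m`. -/
def Separated (L : Multilattice d M) (m : ℝ) (u : L.Site → EuclideanSpace ℝ (Fin d)) : Prop :=
  ∀ ℓ k : L.Site, ℓ ≠ k → m ≤ ‖L.bond u ℓ k‖

/-- Admissible displacements. -/
def Adm (L : Multilattice d M) (Υ : ℝ) : Set (L.Site → EuclideanSpace ℝ (Fin d)) :=
  {u | L.strainSq Υ u < ⊤ ∧ ∃ m : ℝ, 0 < m ∧ L.Separated m u}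

/-- The unit cell `Γ* = 2π A^{-T} [-1/2, 1/2)^d` of the reciprocal lattice. -/
noncomputable def reciprocalCell (L : Multilattice d M) : Set (EuclideanSpace ℝ (Fin d)) :=
  {ξ | ∃ x : Fin d → ℝ, (∀ n, x n ∈ Set.Ico (-(1 / 2) : ℝ) (1 / 2)) ∧
    ξ = WithLp.toLp 2 ((2 * Real.pi) • (L.A.transpose⁻¹).mulVec x)}

end Multilattice

/-- `T` is a bounded operator on `ℓ²(ι)` with matrix entries `K i j`. -/
def HasMatrix {ι : Type*} [DecidableEq ι]
    (T : lp (fun _ : ι => ℂ) 2 →L[ℂ] lp (fun _ : ι => ℂ) 2) (K : ι → ι → ℂ) : Prop :=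
  ∀ i j, T (lp.single 2 j (1 : ℂ)) i = K i j

open Classical in
/-- The bounded operator on `ℓ²(ι)` with matrix `K` (zero if there is none). -/
noncomputable def operatorOfMatrix {ι : Type*} [DecidableEq ι] (K : ι → ι → ℂ) :
    lp (fun _ : ι => ℂ) 2 →L[ℂ] lp (fun _ : ι => ℂ) 2 :=
  if h : ∃ T, HasMatrix T K then h.choose else 0

/-- A bounded operator is determined by its matrix. -/
theorem HasMatrix.unique {ι : Type*} [DecidableEq ι]
    {T T' : lp (fun _ : ι => ℂ) 2 →L[ℂ] lp (fun _ : ι => ℂ) 2} {K : ι → ι → ℂ}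
    (h : HasMatrix T K) (h' : HasMatrix T' K) : T = T' := by
  refine lp.ext_continuousLinearMap (by norm_num) fun j => ?_
  ext
  simp [h _ j, h' _ j]

theorem HasMatrix.operatorOfMatrix_eq {ι : Type*} [DecidableEq ι]
    {T : lp (fun _ : ι => ℂ) 2 →L[ℂ] lp (fun _ : ι => ℂ) 2} {K : ι → ι → ℂ}
    (h : HasMatrix T K) : operatorOfMatrix K = T := by
  have hex : ∃ T, HasMatrix T K := ⟨T, h⟩
  rw [operatorOfMatrix, dif_pos hex]
  exact hex.choose_spec.unique h

/-- The real spectrum of a bounded operator on a complex Hilbert space. -/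
def realSpectrum {H : Type*} [NormedAddCommGroup H] [InnerProductSpace ℂ H] [CompleteSpace H]
    (T : H →L[ℂ] H) : Set ℝ :=
  spectrum ℝ T

/-- `χ_{(-∞, ε)}(T)`, through the continuous functional calculus of self-adjoint operators; it is
meaningful when `ε` is not in the spectrum of `T`, because then `χ_{(-∞, ε)}` is continuous on the
spectrum. -/
noncomputable def fermiProjection {H : Type*} [NormedAddCommGroup H] [InnerProductSpace ℂ H]
    [CompleteSpace H] (ε : ℝ) (T : H →L[ℂ] H) : H →L[ℂ] H :=
  cfc (Set.indicator (Set.Iio ε) (fun _ => (1 : ℝ))) T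

/-- Data of a linear tight binding model with `Nb` orbitals per atom on a multilattice: the atomic
species (periodic, hence given for each shift vector) and the functions `h^{ab}(r, z, z')`,
`t^{ab}(r, z, z')` with the symmetries that make the Hamiltonian self-adjoint. -/
structure TBModel (d M Nb : ℕ) (S : Type) extends Multilattice d M where
  species : Fin M → S
  h : Fin Nb → Fin Nb → EuclideanSpace ℝ (Fin d) → S → S → ℝ
  t : Fin Nb → Fin Nb → EuclideanSpace ℝ (Fin d) → S → S → ℝ
  h_symm : ∀ a b r z z', h a b r z z' = h b a (-r) z' z
  t_symm : ∀ a b r z z', t a b r z z' = t b a r z z'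

namespace TBModel

variable {d M Nb : ℕ} {S : Type}

/-- Continuous differentiability and exponential decay of `h^{ab}` and `t^{ab}`. -/
def IsTB (X : TBModel d M Nb S) (h₀ γ₀ : ℝ) : Prop :=
  ∀ (a b : Fin Nb) (z z' : S),
    (ContDiff ℝ 1 (fun r => X.h a b r z z') ∧
      ∀ r, |X.h a b r z z'| + ‖gradient (fun r => X.h a b r z z') r‖
        ≤ h₀ * Real.exp (-γ₀ * ‖r‖)) ∧
    (ContDiff ℝ 1 (fun r => X.t a b r z z') ∧
      ∀ r, |X.t a b r z z'| + ‖gradient (fun r => X.t a b r z z') r‖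
        ≤ h₀ * Real.exp (-γ₀ * ‖r‖))

/-- Orbitals of the whole system: a site together with an orbital index. -/
abbrev Orb (X : TBModel d M Nb S) : Type := X.Site × Fin Nb

/-- The matrix entry `H(u)_{ℓk}^{ab}`, where `x = (ℓ, a)` and `y = (k, b)`. -/
noncomputable def entry (X : TBModel d M Nb S) (u : X.Site → EuclideanSpace ℝ (Fin d))
    (x y : X.Orb) : ℝ :=
  X.h x.2 y.2 (X.bond u x.1 y.1) (X.species x.1.1) (X.species y.1.1) +
    if x.1 = y.1 then
      ∑' m : X.Site, if m = x.1 then 0 else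
        X.t x.2 y.2 (X.bond u x.1 m) (X.species x.1.1) (X.species m.1)
    else 0

/-- The Hamiltonian `H(u)` as a bounded operator on `ℓ²(Λ × {1, …, Nb})`. -/
noncomputable def hamiltonian (X : TBModel d M Nb S)
    (u : X.Site → EuclideanSpace ℝ (Fin d)) :
    lp (fun _ : X.Orb => ℂ) 2 →L[ℂ] lp (fun _ : X.Orb => ℂ) 2 :=
  operatorOfMatrix fun x y => (X.entry u x y : ℂ)

/-- The density matrix `ρ(u) = χ_{(-∞, εF)}(H(u))`. -/
noncomputable def density (X : TBModel d M Nb S) (εF : ℝ)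
    (u : X.Site → EuclideanSpace ℝ (Fin d)) :
    lp (fun _ : X.Orb => ℂ) 2 →L[ℂ] lp (fun _ : X.Orb => ℂ) 2 :=
  fermiProjection εF (X.hamiltonian u)

/-- The entry `[ρ(u)]_{ℓk,ab}`. -/
noncomputable def densityEntry (X : TBModel d M Nb S) (εF : ℝ)
    (u : X.Site → EuclideanSpace ℝ (Fin d)) (ℓ k : X.Site) (a b : Fin Nb) : ℂ :=
  X.density εF u (lp.single 2 (k, b) (1 : ℂ)) (ℓ, a)

/-- The displacement `u` with the `i`-th coordinate of `u(k)` increased by `s`. -/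
noncomputable def shiftCoord (X : TBModel d M Nb S) (u : X.Site → EuclideanSpace ℝ (Fin d))
    (k : X.Site) (i : Fin d) (s : ℝ) : X.Site → EuclideanSpace ℝ (Fin d) :=
  Function.update u k (u k + EuclideanSpace.single i s)

/-- The Bloch matrix `H_ξ` of the reference Hamiltonian; the sites of the unit cell are
represented by the labels `(i, 0)`. -/
noncomputable def bloch (X : TBModel d M Nb S) (ξ : EuclideanSpace ℝ (Fin d)) :
    Matrix (Fin M × Fin Nb) (Fin M × Fin Nb) ℂ :=
  fun x y => ∑' α : Fin d → ℤ, (X.entry 0 ((x.1, α), x.2) ((y.1, 0), y.2) : ℂ) *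
    Complex.exp (-Complex.I * (inner ℝ (X.pos (x.1, α) - X.pos (y.1, 0)) ξ : ℝ))

theorem bond_neg (X : TBModel d M Nb S) (u : X.Site → EuclideanSpace ℝ (Fin d))
    (ℓ k : X.Site) : X.bond u k ℓ = -X.bond u ℓ k := by
  simp [Multilattice.bond]

theorem entry_symm (X : TBModel d M Nb S) (u : X.Site → EuclideanSpace ℝ (Fin d))
    (x y : X.Orb) : X.entry u x y = X.entry u y x := by
  obtain ⟨ℓ, a⟩ := x
  obtain ⟨k, b⟩ := y
  simp only [entry]
  rw [X.h_symm a b, ← X.bond_neg]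
  by_cases hlk : ℓ = k
  · subst hlk
    simp only [X.t_symm a b]
  · rw [if_neg hlk, if_neg (Ne.symm hlk)]

/-- The reference Hamiltonian is invariant under lattice translations. -/
theorem entry_translate (X : TBModel d M Nb S) (β : Fin d → ℤ) (i j : Fin M)
    (α α' : Fin d → ℤ) (a b : Fin Nb) :
    X.entry 0 ((i, α + β), a) ((j, α' + β), b) = X.entry 0 ((i, α), a) ((j, α'), b) := by
  have hb : ∀ (i j : Fin M) (α α' : Fin d → ℤ),
      X.bond 0 (i, α + β) (j, α' + β) = X.bond 0 (i, α) (j, α') := by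
    intro i j α α'
    simp only [Multilattice.bond, Multilattice.pos, Multilattice.vec_add, Pi.zero_apply]
    abel
  let e : X.Site ≃ X.Site := (Equiv.refl (Fin M)).prodCongr (Equiv.addRight β)
  have he : ∀ (i : Fin M) (α : Fin d → ℤ), e (i, α) = (i, α + β) := fun _ _ => rfl
  simp only [entry, hb, Prod.mk.injEq, add_left_inj]
  congr 1
  refine if_congr Iff.rfl ?_ rfl
  rw [← e.tsum_eq]
  refine tsum_congr fun m => ?_
  obtain ⟨n, γ⟩ := m
  simp only [he, hb, Prod.mk.injEq, add_left_inj]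

theorem bloch_isHermitian (X : TBModel d M Nb S) (ξ : EuclideanSpace ℝ (Fin d)) :
    (X.bloch ξ).IsHermitian := by
  ext ⟨i, a⟩ ⟨j, b⟩
  simp only [Matrix.conjTranspose_apply, bloch, RCLike.star_def]
  rw [Complex.conj_tsum, ← (Equiv.neg (Fin d → ℤ)).tsum_eq]
  refine tsum_congr fun α => ?_
  have h1 : X.entry 0 ((j, -α), b) ((i, 0), a) = X.entry 0 ((i, α), a) ((j, 0), b) := by
    rw [X.entry_symm, ← X.entry_translate α]
    simp
  have h2 : X.pos (j, -α) - X.pos (i, 0) = -(X.pos (i, α) - X.pos (j, 0)) := by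
    have h0 : X.vec (0 : Fin d → ℤ) = 0 := by
      have := X.vec_add 0 0
      simpa using this
    simp only [Multilattice.pos, Multilattice.vec_neg, h0]
    abel
  simp only [Equiv.neg_apply, h1, h2, map_mul, Complex.conj_ofReal, ← Complex.exp_conj, map_neg,
    Complex.conj_I, inner_neg_left, Complex.ofReal_neg]
  ring_nf

/-- The energy band `ε_n(ξ)`: the `n`-th smallest eigenvalue of `H_ξ`, counted with multiplicity,
for `1 ≤ n ≤ M Nb`. (`eigenvalues₀` lists the eigenvalues in decreasing order.) -/
noncomputable def band (X : TBModel d M Nb S) (n : ℕ) (ξ : EuclideanSpace ℝ (Fin d)) : ℝ :=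
  if hn : 1 ≤ n ∧ n ≤ Fintype.card (Fin M × Fin Nb) then
    (X.bloch_isHermitian ξ).eigenvalues₀ ⟨Fintype.card (Fin M × Fin Nb) - n, by omega⟩
  else 0

/-- The number of occupied bands is `N₀`, and `εF` separates the valence bands from the conduction
bands. -/
def IsFermiLevel (X : TBModel d M Nb S) (N₀ : ℕ) (εF : ℝ) : Prop :=
  1 ≤ N₀ ∧ N₀ < M * Nb ∧ εF ∉ realSpectrum (X.hamiltonian 0) ∧
    ∀ ξ ∈ X.reciprocalCell, X.band N₀ ξ < εF ∧ εF < X.band (N₀ + 1) ξ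

/-- The top of the valence bands, `max_ξ ε_{N₀}(ξ)`. -/
noncomputable def valenceTop (X : TBModel d M Nb S) (N₀ : ℕ) : ℝ :=
  sSup (X.band N₀ '' X.reciprocalCell)

/-- The bottom of the conduction bands, `min_ξ ε_{N₀+1}(ξ)`. -/
noncomputable def conductionBottom (X : TBModel d M Nb S) (N₀ : ℕ) : ℝ :=
  sInf (X.band (N₀ + 1) '' X.reciprocalCell)

/-- `gap₋ = min_ξ ε_{N₀+1}(ξ) - max_ξ ε_{N₀}(ξ)`. -/
noncomputable def gapMinus (X : TBModel d M Nb S) (N₀ : ℕ) : ℝ :=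
  X.conductionBottom N₀ - X.valenceTop N₀

/-- The midpoint of the band gap. -/
noncomputable def midGap (X : TBModel d M Nb S) (N₀ : ℕ) : ℝ :=
  (X.conductionBottom N₀ + X.valenceTop N₀) / 2

/-- `𝔡(u)`: the distance from the midpoint of the gap to the spectrum of `H(u)`. -/
noncomputable def specDist (X : TBModel d M Nb S) (N₀ : ℕ)
    (u : X.Site → EuclideanSpace ℝ (Fin d)) : ℝ :=
  Metric.infDist (X.midGap N₀) (realSpectrum (X.hamiltonian u))

end TBModel

/-- The prefactor `c q! (g^q - 1) / (g^{q+1} (g - 1)) = c q! ∑_{j=2}^{q+1} g^{-j}`, extended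
continuously to `g = 1`. -/
noncomputable def algPrefactor (c : ℝ) (q : ℕ) (g : ℝ) : ℝ :=
  if g = 1 then c * q ! * q else c * q ! * ((g ^ q - 1) / (g ^ (q + 1) * (g - 1)))

/-- The exponent `η₋ = c₀ min {h₀, γ₀^d g}`. -/
noncomputable def etaMinus (d : ℕ) (c₀ h₀ γ₀ g : ℝ) : ℝ := c₀ * min h₀ (γ₀ ^ d * g)


theorem lintegral_exp_neg_norm_lt_top {d : ℕ} {γ : ℝ} (hγ : 0 < γ) :
    ∫⁻ z : EuclideanSpace ℝ (Fin d), ENNReal.ofReal (Real.exp (-γ * ‖z‖)) < ⊤ := by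
  have hfin := finite_integral_one_add_norm (E := EuclideanSpace ℝ (Fin d))
    (μ := MeasureTheory.volume) (r := (d : ℝ) + 1) (by simp)
  set K : ℝ := ((d + 1)! : ℝ) / γ ^ (d + 1) * Real.exp γ with hK
  have hle : ∀ z : EuclideanSpace ℝ (Fin d), ENNReal.ofReal (Real.exp (-γ * ‖z‖)) ≤
      ENNReal.ofReal K * ENNReal.ofReal ((1 + ‖z‖) ^ (-((d : ℝ) + 1))) := by
    intro z
    rw [← ENNReal.ofReal_mul (by positivity)]
    apply ENNReal.ofReal_le_ofReal
    have h1 : (0 : ℝ) < 1 + ‖z‖ := by positivity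
    have h2 := Real.pow_div_factorial_le_exp (γ * (1 + ‖z‖)) (by positivity) (d + 1)
    have h3 : (1 + ‖z‖) ^ (-((d : ℝ) + 1)) = ((1 + ‖z‖) ^ (d + 1))⁻¹ := by
      rw [Real.rpow_neg h1.le]
      congr 1
      exact_mod_cast Real.rpow_natCast (1 + ‖z‖) (d + 1)
    rw [h3, hK, neg_mul, Real.exp_neg]
    rw [mul_pow, mul_add, mul_one, Real.exp_add] at h2
    rw [div_le_iff₀ (by positivity)] at h2
    rw [← one_div, ← one_div, div_mul_eq_mul_div, div_mul_div_comm,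
      div_le_div_iff₀ (by positivity) (by positivity)]
    nlinarith
  refine lt_of_le_of_lt (MeasureTheory.lintegral_mono hle) ?_
  rw [MeasureTheory.lintegral_const_mul' _ _ ENNReal.ofReal_ne_top]
  exact ENNReal.mul_lt_top ENNReal.ofReal_lt_top hfin

theorem exists_expSum_bound {d : ℕ} {ι : Type*} [Countable ι] {x : ι → EuclideanSpace ℝ (Fin d)}
    {m γ : ℝ} (hm : 0 < m) (hγ : 0 < γ) (hx : ∀ i j, i ≠ j → m ≤ ‖x i - x j‖) :
    ∃ C : ℝ, 0 ≤ C ∧ ∀ y, Summable (fun i => Real.exp (-γ * ‖x i - y‖)) ∧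
      ∑' i, Real.exp (-γ * ‖x i - y‖) ≤ C := by
  set I := ∫⁻ z : EuclideanSpace ℝ (Fin d), ENNReal.ofReal (Real.exp (-γ * ‖z‖))
  have hI : I < ⊤ := lintegral_exp_neg_norm_lt_top hγ
  set V := MeasureTheory.volume (Metric.ball (0 : EuclideanSpace ℝ (Fin d)) (m / 2))
  have hV0 : V ≠ 0 := (Metric.measure_ball_pos _ _ (by positivity)).ne'
  have hVt : V ≠ ⊤ := MeasureTheory.measure_ball_lt_top.ne
  set B := ENNReal.ofReal (Real.exp (γ * (m / 2))) * I / V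
  have hB : B ≠ ⊤ := ENNReal.div_ne_top (ENNReal.mul_ne_top ENNReal.ofReal_ne_top hI.ne) hV0
  have key : ∀ y, ∑' i, ENNReal.ofReal (Real.exp (-γ * ‖x i - y‖)) ≤ B := by
    intro y
    rw [ENNReal.le_div_iff_mul_le (Or.inl hV0) (Or.inl hVt), ← ENNReal.tsum_mul_right]
    have h1 : ∀ i, ENNReal.ofReal (Real.exp (-γ * ‖x i - y‖)) * V ≤
        ∫⁻ z in Metric.ball (x i) (m / 2),
          ENNReal.ofReal (Real.exp (γ * (m / 2))) * ENNReal.ofReal (Real.exp (-γ * ‖z - y‖)) := by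
      intro i
      have hVi : V = MeasureTheory.volume (Metric.ball (x i) (m / 2)) := by
        rw [MeasureTheory.Measure.addHaar_ball_center]
      rw [hVi, ← MeasureTheory.setLIntegral_const]
      refine MeasureTheory.setLIntegral_mono' measurableSet_ball fun z hz => ?_
      rw [← ENNReal.ofReal_mul (by positivity), ← Real.exp_add]
      apply ENNReal.ofReal_le_ofReal
      apply Real.exp_le_exp.2
      have h2 : ‖z - y‖ ≤ ‖z - x i‖ + ‖x i - y‖ := by
        simpa using norm_add_le (z - x i) (x i - y)
      have h3 : ‖z - x i‖ < m / 2 := by simpa [dist_eq_norm] using hz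
      nlinarith
    refine (ENNReal.tsum_le_tsum h1).trans ?_
    rw [← MeasureTheory.lintegral_iUnion (fun i => measurableSet_ball)]
    · refine (MeasureTheory.setLIntegral_le_lintegral _ _).trans ?_
      rw [MeasureTheory.lintegral_const_mul' _ _ ENNReal.ofReal_ne_top]
      rw [MeasureTheory.lintegral_sub_right_eq_self
        (fun z : EuclideanSpace ℝ (Fin d) => ENNReal.ofReal (Real.exp (-γ * ‖z‖))) y]
    · intro i j hij
      apply Metric.ball_disjoint_ball
      rw [dist_eq_norm]
      linarith [hx i j hij]
  refine ⟨B.toReal, ENNReal.toReal_nonneg, fun y => ?_⟩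
  have hs : Summable (fun i => Real.exp (-γ * ‖x i - y‖)) := by
    have := ENNReal.summable_toReal (ne_top_of_le_ne_top hB (key y))
    simpa [ENNReal.toReal_ofReal, Real.exp_nonneg] using this
  refine ⟨hs, ?_⟩
  rw [← ENNReal.ofReal_le_iff_le_toReal hB, ENNReal.ofReal_tsum_of_nonneg
    (fun _ => Real.exp_nonneg _) hs]
  exact key y

/-- The Schur test for symmetric absolute row and column sums. -/
theorem exists_hasMatrix_of_rowSum_le {ι : Type*} [DecidableEq ι] (K : ι → ι → ℂ) (C : ℝ)
    (hsymm : ∀ i j, ‖K i j‖ = ‖K j i‖) (hs : ∀ i, Summable fun j => ‖K i j‖)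
    (hC : ∀ i, ∑' j, ‖K i j‖ ≤ C) : ∃ T, HasMatrix T K := by
  rcases isEmpty_or_nonempty ι with hι | ⟨⟨i₀⟩⟩
  · exact ⟨0, fun i => (IsEmpty.false i).elim⟩
  have hC0 : 0 ≤ C := (tsum_nonneg fun j => norm_nonneg (K i₀ j)).trans (hC i₀)
  have hsum : ∀ (ψ : lp (fun _ : ι => ℂ) 2) i, Summable fun j => ‖K i j‖ * ‖ψ j‖ := fun ψ i =>
    Summable.of_nonneg_of_le (fun j => by positivity)
      (fun j => mul_le_mul_of_nonneg_left (lp.norm_apply_le_norm (by norm_num) ψ j) (norm_nonneg _))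
      ((hs i).mul_right ‖ψ‖)
  have hsum' : ∀ (ψ : lp (fun _ : ι => ℂ) 2) i, Summable fun j => K i j * ψ j := fun ψ i =>
    Summable.of_norm (by simpa using hsum ψ i)
  have hsq : ∀ ψ : lp (fun _ : ι => ℂ) 2, HasSum (fun j => ‖ψ j‖ ^ 2) (‖ψ‖ ^ 2) := fun ψ => by
    simpa using lp.hasSum_norm (p := 2) (by norm_num) ψ
  have hsum2 : ∀ (ψ : lp (fun _ : ι => ℂ) 2) i, Summable fun j => ‖K i j‖ * ‖ψ j‖ ^ 2 :=
    fun ψ i => Summable.of_nonneg_of_le (fun j => by positivity)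
      (fun j => mul_le_mul_of_nonneg_left
        (pow_le_pow_left₀ (norm_nonneg _) (lp.norm_apply_le_norm (by norm_num) ψ j) 2)
        (norm_nonneg _)) ((hs i).mul_right (‖ψ‖ ^ 2))
  have hCS : ∀ (ψ : lp (fun _ : ι => ℂ) 2) i,
      ‖∑' j, K i j * ψ j‖ ^ 2 ≤ C * ∑' j, ‖K i j‖ * ‖ψ j‖ ^ 2 := by
    intro ψ i
    have h1 : ‖∑' j, K i j * ψ j‖ ≤ ∑' j, ‖K i j‖ * ‖ψ j‖ := by
      have := norm_tsum_le_tsum_norm (f := fun j => K i j * ψ j) (by simpa using hsum ψ i)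
      simpa using this
    have h2 : (∑' j, ‖K i j‖ * ‖ψ j‖) ^ 2 ≤ (∑' j, ‖K i j‖) * ∑' j, ‖K i j‖ * ‖ψ j‖ ^ 2 := by
      have hlim : Tendsto (fun s : Finset ι => (∑ j ∈ s, ‖K i j‖ * ‖ψ j‖) ^ 2) atTop
          (𝓝 ((∑' j, ‖K i j‖ * ‖ψ j‖) ^ 2)) := ((hsum ψ i).hasSum).pow 2
      refine le_of_tendsto hlim (Eventually.of_forall fun s => ?_)
      refine (Finset.sum_sq_le_sum_mul_sum_of_sq_le_mul s (fun j _ => norm_nonneg (K i j))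
        (fun j _ => by positivity : ∀ j ∈ s, 0 ≤ ‖K i j‖ * ‖ψ j‖ ^ 2)
        (fun j _ => le_of_eq (by ring))).trans ?_
      exact mul_le_mul ((hs i).sum_le_tsum s fun _ _ => norm_nonneg _)
        ((hsum2 ψ i).sum_le_tsum s fun _ _ => by positivity)
        (Finset.sum_nonneg fun _ _ => by positivity) (tsum_nonneg fun _ => norm_nonneg _)
    calc ‖∑' j, K i j * ψ j‖ ^ 2 ≤ (∑' j, ‖K i j‖ * ‖ψ j‖) ^ 2 :=
          pow_le_pow_left₀ (norm_nonneg _) h1 2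
      _ ≤ _ := h2
      _ ≤ _ := mul_le_mul_of_nonneg_right (hC i) (tsum_nonneg fun _ => by positivity)
  have hfin : ∀ (ψ : lp (fun _ : ι => ℂ) 2) (s : Finset ι),
      ∑ i ∈ s, ‖∑' j, K i j * ψ j‖ ^ 2 ≤ (C * ‖ψ‖) ^ 2 := by
    intro ψ s
    have h1 : ∑ i ∈ s, ∑' j, ‖K i j‖ * ‖ψ j‖ ^ 2 ≤ C * ‖ψ‖ ^ 2 := by
      rw [← Summable.tsum_finsetSum (fun i _ => hsum2 ψ i), ← (hsq ψ).tsum_eq, ← tsum_mul_left]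
      refine Summable.tsum_le_tsum (fun j => ?_) (summable_sum fun i _ => hsum2 ψ i)
        ((hsq ψ).summable.mul_left C)
      rw [← Finset.sum_mul]
      refine mul_le_mul_of_nonneg_right ?_ (by positivity)
      simp_rw [fun i => hsymm i j]
      exact ((hs j).sum_le_tsum s fun _ _ => norm_nonneg _).trans (hC j)
    calc _ ≤ ∑ i ∈ s, C * ∑' j, ‖K i j‖ * ‖ψ j‖ ^ 2 := Finset.sum_le_sum fun i _ => hCS ψ i
      _ = C * ∑ i ∈ s, ∑' j, ‖K i j‖ * ‖ψ j‖ ^ 2 := by rw [Finset.mul_sum]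
      _ ≤ C * (C * ‖ψ‖ ^ 2) := mul_le_mul_of_nonneg_left h1 hC0
      _ = _ := by ring
  have hmem : ∀ ψ : lp (fun _ : ι => ℂ) 2, Memℓp (fun i => ∑' j, K i j * ψ j) 2 := fun ψ =>
    memℓp_gen' (C := (C * ‖ψ‖) ^ 2) (by simpa using hfin ψ)
  let T₀ : lp (fun _ : ι => ℂ) 2 →ₗ[ℂ] lp (fun _ : ι => ℂ) 2 :=
    { toFun := fun ψ => ⟨fun i => ∑' j, K i j * ψ j, hmem ψ⟩
      map_add' := fun ψ χ => by
        ext i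
        simp only [lp.coeFn_add, Pi.add_apply, mul_add]
        exact (hsum' ψ i).tsum_add (hsum' χ i)
      map_smul' := fun c ψ => by
        ext i
        simp only [lp.coeFn_smul, Pi.smul_apply, smul_eq_mul, RingHom.id_apply, ← tsum_mul_left]
        exact tsum_congr fun j => by ring }
  refine ⟨T₀.mkContinuous C fun ψ => ?_, fun i j => ?_⟩
  · refine lp.norm_le_of_forall_sum_le (by norm_num) (by positivity) fun s => ?_
    simpa [T₀] using hfin ψ s
  · change ∑' k, K i k * (lp.single 2 j (1 : ℂ) : lp (fun _ : ι => ℂ) 2) k = K i j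
    rw [tsum_eq_single j (fun k hk => by rw [lp.single_apply_ne _ _ _ hk, mul_zero])]
    simp

theorem HasMatrix.isSelfAdjoint {ι : Type*} [DecidableEq ι]
    {T : lp (fun _ : ι => ℂ) 2 →L[ℂ] lp (fun _ : ι => ℂ) 2} {K : ι → ι → ℂ}
    (h : HasMatrix T K) (hK : ∀ i j, K i j = starRingEnd ℂ (K j i)) : IsSelfAdjoint T := by
  have hentry : ∀ (ψ : lp (fun _ : ι => ℂ) 2) i,
      ψ i = inner ℂ (lp.single 2 i (1 : ℂ) : lp (fun _ : ι => ℂ) 2) ψ := by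
    intro ψ i
    rw [lp.inner_single_left]; simp
  rw [ContinuousLinearMap.isSelfAdjoint_iff']
  refine lp.ext_continuousLinearMap (by norm_num) fun j => ?_
  ext i
  simp only [ContinuousLinearMap.comp_apply, lp.singleContinuousLinearMap_apply]
  rw [hentry, ContinuousLinearMap.adjoint_inner_right, ← inner_conj_symm, ← hentry, h, h, ← hK]

namespace TBModel

theorem exists_hasMatrix_entry {d M Nb : ℕ} {S : Type} (X : TBModel d M Nb S) {h₀ γ₀ m : ℝ}
    (hγ : 0 < γ₀) (hX : X.IsTB h₀ γ₀) (hm : 0 < m)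
    {u : X.Site → EuclideanSpace ℝ (Fin d)} (hu : X.Separated m u) :
    ∃ T, HasMatrix T (fun x y => (X.entry u x y : ℂ)) := by
  obtain ⟨C, hC0, hC⟩ := exists_expSum_bound (x := fun ℓ => X.pos ℓ + u ℓ) hm hγ hu
  have hbond : ∀ ℓ k, ‖X.bond u ℓ k‖ = ‖X.pos k + u k - (X.pos ℓ + u ℓ)‖ := fun ℓ k => by
    rw [← norm_neg, ← X.bond_neg]; rfl
  have hh : ∀ a b r z z', |X.h a b r z z'| ≤ h₀ * Real.exp (-γ₀ * ‖r‖) := fun a b r z z' =>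
    le_trans (le_add_of_nonneg_right (norm_nonneg _)) ((hX a b z z').1.2 r)
  have ht : ∀ a b r z z', |X.t a b r z z'| ≤ h₀ * Real.exp (-γ₀ * ‖r‖) := fun a b r z z' =>
    le_trans (le_add_of_nonneg_right (norm_nonneg _)) ((hX a b z z').2.2 r)
  rcases isEmpty_or_nonempty X.Orb with hO | ⟨⟨x₀⟩⟩
  · exact ⟨0, fun x => (IsEmpty.false x).elim⟩
  have hh0 : 0 ≤ h₀ := by
    have h1 := (abs_nonneg _).trans (hh x₀.2 x₀.2 0 (X.species x₀.1.1) (X.species x₀.1.1))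
    simpa using h1
  let g : X.Site → X.Site → ℝ := fun ℓ k =>
    h₀ * Real.exp (-γ₀ * ‖X.bond u ℓ k‖) + if k = ℓ then h₀ * C else 0
  have hg0 : ∀ ℓ k, 0 ≤ g ℓ k := fun ℓ k => by
    have : (0 : ℝ) ≤ if k = ℓ then h₀ * C else 0 := by split_ifs <;> positivity
    positivity
  have hgs : ∀ ℓ, Summable (g ℓ) := fun ℓ => by
    refine Summable.add ?_ (hasSum_ite_eq ℓ (h₀ * C)).summable
    simp_rw [hbond]
    exact (hC _).1.mul_left h₀
  have hgt : ∀ ℓ, ∑' k, g ℓ k ≤ h₀ * C + h₀ * C := fun ℓ => by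
    have h1 : Summable fun k => h₀ * Real.exp (-γ₀ * ‖X.bond u ℓ k‖) := by
      simp_rw [hbond]
      exact (hC _).1.mul_left h₀
    rw [h1.tsum_add (hasSum_ite_eq ℓ (h₀ * C)).summable, tsum_ite_eq]
    refine add_le_add_left ?_ _
    rw [tsum_mul_left]
    simp_rw [hbond]
    exact mul_le_mul_of_nonneg_left (hC _).2 hh0
  have hle : ∀ x y : X.Orb, ‖(X.entry u x y : ℂ)‖ ≤ g x.1 y.1 * 1 := by
    intro x y
    rw [Complex.norm_real, Real.norm_eq_abs, mul_one]
    refine (abs_add_le _ _).trans (add_le_add (hh _ _ _ _ _) ?_)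
    by_cases hxy : x.1 = y.1
    · rw [if_pos hxy, if_pos hxy.symm]
      have h1 : Summable fun k => h₀ * Real.exp (-γ₀ * ‖X.bond u x.1 k‖) := by
        simp_rw [hbond]
        exact (hC _).1.mul_left h₀
      have h2 := tsum_of_norm_bounded h1.hasSum (f := fun n : X.Site => if n = x.1 then 0 else
        X.t x.2 y.2 (X.bond u x.1 n) (X.species x.1.1) (X.species n.1)) (fun n => by
          split_ifs
          · simp only [norm_zero]; positivity
          · exact ht _ _ _ _ _)
      refine h2.trans ?_
      rw [tsum_mul_left]
      simp_rw [hbond]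
      exact mul_le_mul_of_nonneg_left (hC _).2 hh0
    · rw [if_neg hxy, if_neg (Ne.symm hxy), abs_zero]
  have hG : ∀ ℓ, Summable fun y : X.Orb => g ℓ y.1 * (fun _ : Fin Nb => (1 : ℝ)) y.2 := fun ℓ =>
    (hgs ℓ).mul_of_nonneg (Summable.of_finite) (hg0 ℓ) (fun _ => zero_le_one)
  have hs : ∀ x : X.Orb, Summable fun y => ‖(X.entry u x y : ℂ)‖ := fun x =>
    Summable.of_nonneg_of_le (fun _ => norm_nonneg _) (hle x) (hG x.1)
  refine exists_hasMatrix_of_rowSum_le _ (Nb * (h₀ * C + h₀ * C))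
    (fun x y => by rw [X.entry_symm]) hs fun x => ?_
  refine ((hs x).tsum_le_tsum (hle x) (hG x.1)).trans ?_
  have h3 := (hgs x.1).tsum_mul_tsum (g := fun _ : Fin Nb => (1 : ℝ)) Summable.of_finite (hG x.1)
  rw [← h3]
  simp only [tsum_fintype, Finset.sum_const, Finset.card_univ, Fintype.card_fin, nsmul_eq_mul,
    mul_one]
  rw [mul_comm]
  exact mul_le_mul_of_nonneg_left (hgt _) (Nat.cast_nonneg _)

/-- `H(u)` really is a bounded self-adjoint operator with the matrix `H(u)_{ℓk}^{ab}`. -/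
theorem hamiltonian_spec {d M Nb : ℕ} {S : Type} (X : TBModel d M Nb S) {h₀ γ₀ m : ℝ}
    (hγ : 0 < γ₀) (hX : X.IsTB h₀ γ₀) (hm : 0 < m)
    {u : X.Site → EuclideanSpace ℝ (Fin d)} (hu : X.Separated m u) :
    HasMatrix (X.hamiltonian u) (fun x y => (X.entry u x y : ℂ)) ∧
      IsSelfAdjoint (X.hamiltonian u) := by
  obtain ⟨T, hT⟩ := X.exists_hasMatrix_entry hγ hX hm hu
  have h1 : X.hamiltonian u = T := hT.operatorOfMatrix_eq
  rw [h1]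
  exact ⟨hT, hT.isSelfAdjoint fun x y => by rw [Complex.conj_ofReal, X.entry_symm]⟩

end TBModel

/-! The projection ρ(u) is (2πi)⁻¹ times the integral of the resolvent over a circle that crosses
the real axis at E_* and at E_* − 2R, the latter below the spectrum. Differentiating under the
integral gives (2πi)⁻¹ ∮ (z − H)⁻¹ H' (z − H)⁻¹ dz, and H' only sees bonds with an end at k. An
entry of the ℓℓ block is therefore controlled by two resolvent vectors, both issuing from ℓ and both
evaluated near k. If these decay like e^{-w} with w(ℓ) = 0, the derivative decays like e^{-2w(k)}.
The circle is such that a lower bound for T − E_* with T self-adjoint and bounded by R about E_*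
persists for T − z at all its points z (`norm_sub_smul_le_of_mem_sphere`), so spectral information
is needed at E_* only.

The difficulty is that the rate may involve only the gap of the reference crystal, while H(u) may
have spectrum much closer to E_*. Bloch theory gives the lower bound gap/2 for H(0) − E_*
(`reference_gap`). Finite energy of u implies that all but finitely many sites have only weakly
strained short bonds; the number of exceptions is controlled by ‖Du‖ (`finite_strained`). In the
Combes–Thomas argument the weighted resolvent vector is split by a cutoff around the exceptional
sites. Away from them H(u) is close to H(0), and the gap limits the slope of the weight. Near them
the lower bound 𝔡(u) of H(u) itself is used, which may be tiny; the weight is therefore made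
constant there, so that its commutator contributes only through long bonds and is O(1/L), L being
the width of the cutoff. Flattening costs a fixed loss in w(k) per exceptional site
(`exists_weight`), hence changes the prefactor and not the rate (`norm_resolvent_le_of_strained`).
Displacements of finite energy grow sublinearly (`exists_norm_sub_le`), so deformed distances are at
least half the reference distances up to a constant, and slope 4η in the deformed metric yields
e^{-4ηr}.

Half of this is the asserted exponential. For small ‖Du‖ there are no exceptional sites and the
prefactor is K/gap² with K independent of the model; since η ≥ c₁ gap, the other half supplies (gap
(1+r))^{-2q}, which gives the algebraic term with C' = 0. For larger strains the whole prefactor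
goes into C(u) and C'(u). -/

/-! ### Exponential sums over separated sets, uniformly in the set -/

theorem exists_uniform_expSum_bound (d : ℕ) {m γ : ℝ} (hm : 0 < m) (hγ : 0 < γ) :
    ∃ C : ℝ, 0 < C ∧ ∀ (ι : Type) [Countable ι] (x : ι → EuclideanSpace ℝ (Fin d)),
      (∀ i j, i ≠ j → m ≤ ‖x i - x j‖) → ∀ y, Summable (fun i => Real.exp (-γ * ‖x i - y‖)) ∧
      ∑' i, Real.exp (-γ * ‖x i - y‖) ≤ C := by
  set I := ∫⁻ z : EuclideanSpace ℝ (Fin d), ENNReal.ofReal (Real.exp (-γ * ‖z‖))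
  have hI : I < ⊤ := lintegral_exp_neg_norm_lt_top hγ
  set V := MeasureTheory.volume (Metric.ball (0 : EuclideanSpace ℝ (Fin d)) (m / 2))
  have hV0 : V ≠ 0 := (Metric.measure_ball_pos _ _ (by positivity)).ne'
  have hVt : V ≠ ⊤ := MeasureTheory.measure_ball_lt_top.ne
  set B := ENNReal.ofReal (Real.exp (γ * (m / 2))) * I / V
  have hB : B ≠ ⊤ := ENNReal.div_ne_top (ENNReal.mul_ne_top ENNReal.ofReal_ne_top hI.ne) hV0
  -- The balls of radius m/2 about the points are disjoint, so the sum is at most an integral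
  -- divided by the volume of one ball. Nothing here depends on the point set, which later keeps the
  -- rate independent of M. The summand 1 only makes the constant positive.
  refine ⟨B.toReal + 1, by positivity, fun ι _ x hx y => ?_⟩
  have key : ∀ y, ∑' i, ENNReal.ofReal (Real.exp (-γ * ‖x i - y‖)) ≤ B := by
    intro y
    rw [ENNReal.le_div_iff_mul_le (Or.inl hV0) (Or.inl hVt), ← ENNReal.tsum_mul_right]
    have h1 : ∀ i, ENNReal.ofReal (Real.exp (-γ * ‖x i - y‖)) * V ≤
        ∫⁻ z in Metric.ball (x i) (m / 2),
          ENNReal.ofReal (Real.exp (γ * (m / 2))) * ENNReal.ofReal (Real.exp (-γ * ‖z - y‖)) := by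
      intro i
      have hVi : V = MeasureTheory.volume (Metric.ball (x i) (m / 2)) := by
        rw [MeasureTheory.Measure.addHaar_ball_center]
      rw [hVi, ← MeasureTheory.setLIntegral_const]
      refine MeasureTheory.setLIntegral_mono' measurableSet_ball fun z hz => ?_
      rw [← ENNReal.ofReal_mul (by positivity), ← Real.exp_add]
      apply ENNReal.ofReal_le_ofReal
      apply Real.exp_le_exp.2
      have h2 : ‖z - y‖ ≤ ‖z - x i‖ + ‖x i - y‖ := by
        simpa using norm_add_le (z - x i) (x i - y)
      have h3 : ‖z - x i‖ < m / 2 := by simpa [dist_eq_norm] using hz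
      nlinarith
    refine (ENNReal.tsum_le_tsum h1).trans ?_
    rw [← MeasureTheory.lintegral_iUnion (fun i => measurableSet_ball)]
    · refine (MeasureTheory.setLIntegral_le_lintegral _ _).trans ?_
      rw [MeasureTheory.lintegral_const_mul' _ _ ENNReal.ofReal_ne_top]
      rw [MeasureTheory.lintegral_sub_right_eq_self
        (fun z : EuclideanSpace ℝ (Fin d) => ENNReal.ofReal (Real.exp (-γ * ‖z‖))) y]
    · intro i j hij
      apply Metric.ball_disjoint_ball
      rw [dist_eq_norm]
      linarith [hx i j hij]
  have hs : Summable (fun i => Real.exp (-γ * ‖x i - y‖)) := by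
    have := ENNReal.summable_toReal (ne_top_of_le_ne_top hB (key y))
    simpa [ENNReal.toReal_ofReal, Real.exp_nonneg] using this
  refine ⟨hs, le_trans ?_ (le_add_of_nonneg_right zero_le_one)⟩
  rw [← ENNReal.ofReal_le_iff_le_toReal hB, ENNReal.ofReal_tsum_of_nonneg
    (fun _ => Real.exp_nonneg _) hs]
  exact key y

/-! ### Operators on ℓ² given by matrices; the Schur test -/

/-- The Hilbert space `ℓ²(ι)`. -/
abbrev EllTwo (ι : Type*) : Type _ := lp (fun _ : ι => ℂ) 2

theorem EllTwo.hasSum_normSq {ι : Type*} (ψ : EllTwo ι) :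
    HasSum (fun j => ‖ψ j‖ ^ 2) (‖ψ‖ ^ 2) := by
  simpa using lp.hasSum_norm (p := 2) (by norm_num) ψ

section EllTwo

variable {ι : Type*} [DecidableEq ι]

theorem EllTwo.norm_single_one (i : ι) : ‖(lp.single 2 i (1 : ℂ) : EllTwo ι)‖ = 1 := by
  rw [lp.norm_single (by norm_num)]; simp

theorem EllTwo.apply_eq_inner (ψ : EllTwo ι) (i : ι) :
    ψ i = inner ℂ (lp.single 2 i (1 : ℂ) : EllTwo ι) ψ := by
  rw [lp.inner_single_left]; simp

theorem HasMatrix.hasSum_apply {T : EllTwo ι →L[ℂ] EllTwo ι} {K : ι → ι → ℂ}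
    (h : HasMatrix T K) (ψ : EllTwo ι) (i : ι) : HasSum (fun j => K i j * ψ j) (T ψ i) := by
  have h1 := lp.hasSum_single (p := 2) (by norm_num) ψ
  have h2 := h1.mapL ((innerSL ℂ (lp.single 2 i (1 : ℂ) : EllTwo ι)).comp T)
  simp only [ContinuousLinearMap.comp_apply, innerSL_apply_apply, ← EllTwo.apply_eq_inner] at h2
  suffices h4 : (fun j => K i j * ψ j) = fun j => T (lp.single 2 j (ψ j)) i by
    rw [h4]; exact h2
  funext j
  have h3 : (lp.single 2 j (ψ j) : EllTwo ι) = ψ j • lp.single 2 j (1 : ℂ) := by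
    rw [← lp.single_smul]; simp
  rw [h3, map_smul, lp.coeFn_smul, Pi.smul_apply, h i j, smul_eq_mul, mul_comm]

/-- The Schur test with a symmetric majorant. -/
theorem HasMatrix.norm_apply_le {T : EllTwo ι →L[ℂ] EllTwo ι} {K : ι → ι → ℂ}
    (h : HasMatrix T K) {g : ι → ι → ℝ} {C : ℝ} (hK : ∀ i j, ‖K i j‖ ≤ g i j)
    (hsymm : ∀ i j, g i j = g j i) (hs : ∀ i, Summable (g i)) (hC : ∀ i, ∑' j, g i j ≤ C)
    (ψ : EllTwo ι) : ‖T ψ‖ ≤ C * ‖ψ‖ := by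
  rcases isEmpty_or_nonempty ι with hι | ⟨⟨i₀⟩⟩
  · have h2 : ψ = 0 := by ext i; exact (IsEmpty.false i).elim
    simp [h2]
  have hg : ∀ i j, 0 ≤ g i j := fun i j => (norm_nonneg _).trans (hK i j)
  have hC0 : 0 ≤ C := (tsum_nonneg fun j => hg i₀ j).trans (hC i₀)
  have hle : ∀ j, ‖ψ j‖ ≤ ‖ψ‖ := fun j => lp.norm_apply_le_norm (by norm_num) ψ j
  have hsum : ∀ i, Summable fun j => g i j * ‖ψ j‖ := fun i =>
    Summable.of_nonneg_of_le (fun j => mul_nonneg (hg i j) (norm_nonneg _))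
      (fun j => mul_le_mul_of_nonneg_left (hle j) (hg i j)) ((hs i).mul_right ‖ψ‖)
  have hsum2 : ∀ i, Summable fun j => g i j * ‖ψ j‖ ^ 2 :=
    fun i => Summable.of_nonneg_of_le (fun j => mul_nonneg (hg i j) (by positivity))
      (fun j => mul_le_mul_of_nonneg_left
        (pow_le_pow_left₀ (norm_nonneg _) (hle j) 2) (hg i j)) ((hs i).mul_right (‖ψ‖ ^ 2))
  -- Cauchy–Schwarz with weights g i j uses the row sums; summing over i afterwards uses the column
  -- sums, equal to them by symmetry.
  have hCS : ∀ i, ‖T ψ i‖ ^ 2 ≤ C * ∑' j, g i j * ‖ψ j‖ ^ 2 := by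
    intro i
    have h1 : ‖T ψ i‖ ≤ ∑' j, g i j * ‖ψ j‖ := by
      rw [← (h.hasSum_apply ψ i).tsum_eq]
      refine tsum_of_norm_bounded (hsum i).hasSum fun j => ?_
      rw [norm_mul]
      exact mul_le_mul_of_nonneg_right (hK i j) (norm_nonneg _)
    have h2 : (∑' j, g i j * ‖ψ j‖) ^ 2 ≤ (∑' j, g i j) * ∑' j, g i j * ‖ψ j‖ ^ 2 := by
      have hlim : Tendsto (fun s : Finset ι => (∑ j ∈ s, g i j * ‖ψ j‖) ^ 2) atTop
          (𝓝 ((∑' j, g i j * ‖ψ j‖) ^ 2)) := ((hsum i).hasSum).pow 2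
      refine le_of_tendsto hlim (Eventually.of_forall fun s => ?_)
      refine (Finset.sum_sq_le_sum_mul_sum_of_sq_le_mul s (fun j _ => hg i j)
        (fun j _ => mul_nonneg (hg i j) (by positivity) : ∀ j ∈ s, 0 ≤ g i j * ‖ψ j‖ ^ 2)
        (fun j _ => le_of_eq (by ring))).trans ?_
      exact mul_le_mul ((hs i).sum_le_tsum s fun j _ => hg i j)
        ((hsum2 i).sum_le_tsum s fun j _ => mul_nonneg (hg i j) (by positivity))
        (Finset.sum_nonneg fun j _ => mul_nonneg (hg i j) (by positivity))
        (tsum_nonneg fun j => hg i j)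
    calc ‖T ψ i‖ ^ 2 ≤ (∑' j, g i j * ‖ψ j‖) ^ 2 := pow_le_pow_left₀ (norm_nonneg _) h1 2
      _ ≤ _ := h2
      _ ≤ _ := mul_le_mul_of_nonneg_right (hC i)
        (tsum_nonneg fun j => mul_nonneg (hg i j) (by positivity))
  refine lp.norm_le_of_forall_sum_le (by norm_num) (by positivity) fun s => ?_
  have h1 : ∑ i ∈ s, ∑' j, g i j * ‖ψ j‖ ^ 2 ≤ C * ‖ψ‖ ^ 2 := by
    have hq := EllTwo.hasSum_normSq ψ
    rw [← Summable.tsum_finsetSum (fun i _ => hsum2 i), ← hq.tsum_eq, ← tsum_mul_left]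
    refine Summable.tsum_le_tsum (fun j => ?_) (summable_sum fun i _ => hsum2 i)
      (hq.summable.mul_left C)
    rw [← Finset.sum_mul]
    refine mul_le_mul_of_nonneg_right ?_ (by positivity)
    simp_rw [fun i => hsymm i j]
    exact ((hs j).sum_le_tsum s fun i _ => hg j i).trans (hC j)
  have h2 : ∑ i ∈ s, ‖T ψ i‖ ^ 2 ≤ (C * ‖ψ‖) ^ 2 :=
    calc _ ≤ ∑ i ∈ s, C * ∑' j, g i j * ‖ψ j‖ ^ 2 := Finset.sum_le_sum fun i _ => hCS i
      _ = C * ∑ i ∈ s, ∑' j, g i j * ‖ψ j‖ ^ 2 := by rw [Finset.mul_sum]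
      _ ≤ C * (C * ‖ψ‖ ^ 2) := mul_le_mul_of_nonneg_left h1 hC0
      _ = _ := by ring
  simpa using h2

/-- Multiplication by a bounded real function (zero if the function is unbounded). -/
noncomputable def mulOp (w : ι → ℝ) : EllTwo ι →L[ℂ] EllTwo ι :=
  operatorOfMatrix fun i j => if i = j then (w i : ℂ) else 0

theorem mulOp_hasMatrix {w : ι → ℝ} {C : ℝ} (hw : ∀ i, |w i| ≤ C) :
    HasMatrix (mulOp w) fun i j => if i = j then (w i : ℂ) else 0 := by
  have hnorm : ∀ i j, ‖(if i = j then (w i : ℂ) else 0)‖ = if j = i then |w i| else 0 := by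
    intro i j
    by_cases h : i = j
    · subst h; simp
    · simp [h, Ne.symm h]
  obtain ⟨T, hT⟩ := exists_hasMatrix_of_rowSum_le (fun i j => if i = j then (w i : ℂ) else 0) C
    (fun i j => by
      by_cases h : i = j
      · subst h; rfl
      · simp [h, Ne.symm h])
    (fun i => by simp_rw [hnorm]; exact (hasSum_ite_eq i _).summable)
    (fun i => by simp_rw [hnorm]; rw [tsum_ite_eq]; exact hw i)
  rw [mulOp, hT.operatorOfMatrix_eq]
  exact hT

theorem mulOp_apply {w : ι → ℝ} {C : ℝ} (hw : ∀ i, |w i| ≤ C) (ψ : EllTwo ι) (i : ι) :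
    mulOp w ψ i = w i * ψ i := by
  have h := (mulOp_hasMatrix hw).hasSum_apply ψ i
  refine h.unique ?_
  convert hasSum_ite_eq i ((w i : ℂ) * ψ i) using 1
  funext j
  by_cases hij : i = j
  · subst hij; simp
  · simp [hij, Ne.symm hij]

/-- The rank one operator with matrix entry one at `(i, j)` and zero elsewhere. -/
noncomputable def matrixUnit (i j : ι) : EllTwo ι →L[ℂ] EllTwo ι :=
  (innerSL ℂ (lp.single 2 j (1 : ℂ) : EllTwo ι)).smulRight (lp.single 2 i (1 : ℂ))

theorem matrixUnit_apply (i j : ι) (ψ : EllTwo ι) :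
    matrixUnit i j ψ = ψ j • (lp.single 2 i (1 : ℂ) : EllTwo ι) := by
  rw [matrixUnit, ContinuousLinearMap.smulRight_apply, innerSL_apply_apply,
    ← EllTwo.apply_eq_inner]

theorem norm_matrixUnit (i j : ι) : ‖matrixUnit i j‖ = 1 := by
  rw [matrixUnit, ContinuousLinearMap.norm_smulRight_apply, innerSL_apply_norm,
    EllTwo.norm_single_one, EllTwo.norm_single_one, one_mul]

theorem matrixUnit_entry (i j p q : ι) :
    matrixUnit i j (lp.single 2 q (1 : ℂ)) p = if p = i ∧ q = j then 1 else 0 := by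
  rw [matrixUnit_apply, lp.coeFn_smul, Pi.smul_apply, smul_eq_mul, lp.single_apply,
    lp.single_apply]
  by_cases h1 : q = j <;> by_cases h2 : p = i <;> simp [h1, h2]

end EllTwo

theorem summable_prod_fin {κ : Type*} {n : ℕ} {g : κ → ℝ} (hs : Summable g)
    (hg : ∀ i, 0 ≤ g i) : Summable (fun y : κ × Fin n => g y.1) ∧
      ∑' y : κ × Fin n, g y.1 = n * ∑' k, g k := by
  have hG : Summable fun y : κ × Fin n => g y.1 * (fun _ : Fin n => (1 : ℝ)) y.2 :=
    hs.mul_of_nonneg (Summable.of_finite) hg (fun _ => zero_le_one)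
  have h3 := hs.tsum_mul_tsum (g := fun _ : Fin n => (1 : ℝ)) Summable.of_finite hG
  simp only [mul_one, tsum_fintype, Finset.sum_const, Finset.card_univ, Fintype.card_fin,
    nsmul_eq_mul] at h3 hG
  exact ⟨hG, by rw [← h3, mul_comm]⟩

/-- The Schur test for block matrices. -/
theorem HasMatrix.norm_apply_le_block {κ : Type*} [DecidableEq κ] {n : ℕ}
    {T : EllTwo (κ × Fin n) →L[ℂ] EllTwo (κ × Fin n)} {K : κ × Fin n → κ × Fin n → ℂ}
    (h : HasMatrix T K) {g : κ → κ → ℝ} {C : ℝ} (hK : ∀ i j, ‖K i j‖ ≤ g i.1 j.1)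
    (hg : ∀ i j, 0 ≤ g i j)
    (hsymm : ∀ i j, g i j = g j i) (hs : ∀ i, Summable (g i)) (hC : ∀ i, ∑' j, g i j ≤ C)
    (ψ : EllTwo (κ × Fin n)) : ‖T ψ‖ ≤ n * C * ‖ψ‖ := by
  refine h.norm_apply_le hK (fun i j => hsymm _ _)
    (fun i => (summable_prod_fin (hs i.1) (hg i.1)).1) (fun i => ?_) ψ
  rw [(summable_prod_fin (hs i.1) (hg i.1)).2]
  exact mul_le_mul_of_nonneg_left (hC _) (Nat.cast_nonneg _)

/-! ### Contour integrals of the resolvent and their derivative -/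

section ContourResolvent

variable {𝒜 : Type*} [NormedRing 𝒜] [NormedAlgebra ℂ 𝒜] [CompleteSpace 𝒜]

theorem continuousAt_resolvent_prod {a : 𝒜} {z : ℂ} (h : IsUnit (algebraMap ℂ 𝒜 z - a)) :
    ContinuousAt (fun p : 𝒜 × ℂ => resolvent p.1 p.2) (a, z) := by
  obtain ⟨x, hx⟩ := h
  have h1 : ContinuousAt Ring.inverse (algebraMap ℂ 𝒜 z - a) := by
    rw [← hx]; exact NormedRing.inverse_continuousAt x
  exact ContinuousAt.comp (f := fun p : 𝒜 × ℂ => algebraMap ℂ 𝒜 p.2 - p.1) h1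
    (by fun_prop)

/-- Invertibility of z − b is open jointly in b and z; compactness of K gives one neighbourhood of a
that serves all z. -/
theorem eventually_isUnit_of_isCompact {a : 𝒜} {K : Set ℂ} (hK : IsCompact K)
    (h : ∀ z ∈ K, IsUnit (algebraMap ℂ 𝒜 z - a)) :
    ∀ᶠ b in 𝓝 a, ∀ z ∈ K, IsUnit (algebraMap ℂ 𝒜 z - b) := by
  refine hK.eventually_forall_of_forall_eventually
    (P := fun b z => IsUnit (algebraMap ℂ 𝒜 z - b)) fun z hz => ?_
  have hc : ContinuousAt (fun p : 𝒜 × ℂ => algebraMap ℂ 𝒜 p.2 - p.1) (a, z) := by fun_prop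
  exact hc (Units.isOpen.mem_nhds (h z hz))

theorem resolvent_sub_resolvent {𝒜 : Type*} [NormedRing 𝒜] [NormedAlgebra ℂ 𝒜]
    {a b : 𝒜} {z : ℂ} (ha : IsUnit (algebraMap ℂ 𝒜 z - a))
    (hb : IsUnit (algebraMap ℂ 𝒜 z - b)) :
    resolvent b z - resolvent a z = resolvent b z * (b - a) * resolvent a z := by
  have h1 : (algebraMap ℂ 𝒜 z - a) * resolvent a z = 1 := Ring.mul_inverse_cancel _ ha
  have h2 : resolvent b z * (algebraMap ℂ 𝒜 z - b) = 1 := Ring.inverse_mul_cancel _ hb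
  calc resolvent b z - resolvent a z
      = resolvent b z * ((algebraMap ℂ 𝒜 z - a) * resolvent a z) -
        resolvent b z * (algebraMap ℂ 𝒜 z - b) * resolvent a z := by rw [h1, h2]; simp
    _ = _ := by noncomm_ring

/-- A contour integral of the resolvent may be differentiated under the integral sign. -/
theorem hasDerivAt_circleIntegral_resolvent {A : ℝ → 𝒜} {A' : 𝒜} (hA : HasDerivAt A A' 0)
    {c : ℂ} {R : ℝ} (hR : 0 ≤ R)
    (h : ∀ z ∈ Metric.sphere c R, IsUnit (algebraMap ℂ 𝒜 z - A 0)) :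
    HasDerivAt (fun s => ∮ z in C(c, R), resolvent (A s) z)
      (∮ z in C(c, R), resolvent (A 0) z * A' * resolvent (A 0) z) 0 := by
  have hKc : IsCompact (Metric.sphere c R) := isCompact_sphere c R
  have hcont : ∀ b : 𝒜, (∀ z ∈ Metric.sphere c R, IsUnit (algebraMap ℂ 𝒜 z - b)) →
      ContinuousOn (fun z => resolvent b z) (Metric.sphere c R) := fun b hb z hz =>
    ((continuousAt_resolvent_prod (hb z hz)).comp (f := fun z : ℂ => (b, z))
      (by fun_prop)).continuousWithinAt
  have hev : ∀ᶠ s in 𝓝 (0 : ℝ), ∀ z ∈ Metric.sphere c R, IsUnit (algebraMap ℂ 𝒜 z - A s) :=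
    hA.continuousAt.eventually (eventually_isUnit_of_isCompact hKc h)
  rw [hasDerivAt_iff_tendsto_slope]
  have hlim : Tendsto (fun s => (A s, slope A 0 s)) (𝓝[≠] 0) (𝓝 (A 0, A')) :=
    (hA.continuousAt.tendsto.mono_left nhdsWithin_le_nhds).prodMk_nhds
      (hasDerivAt_iff_tendsto_slope.1 hA)
  -- By the second resolvent identity the difference quotient of the integrand is the resolvent at A
  -- s, times the slope of A, times the resolvent at A 0. Joint continuity on the compact circle
  -- makes its convergence uniform, so the limit passes under the integral.
  have hunif : TendstoUniformlyOn
      (fun s z => resolvent (A s) z * slope A 0 s * resolvent (A 0) z)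
      (fun z => resolvent (A 0) z * A' * resolvent (A 0) z) (𝓝[≠] 0) (Metric.sphere c R) := by
    rw [Metric.tendstoUniformlyOn_iff]
    intro ε hε
    refine hlim.eventually (hKc.eventually_forall_of_forall_eventually (X := 𝒜 × 𝒜)
      (P := fun p z => dist (resolvent (A 0) z * A' * resolvent (A 0) z)
        (resolvent p.1 z * p.2 * resolvent (A 0) z) < ε) fun z hz => ?_)
    have h1 : ContinuousAt (fun p : (𝒜 × 𝒜) × ℂ => resolvent p.1.1 p.2) ((A 0, A'), z) :=
      ContinuousAt.comp (f := fun p : (𝒜 × 𝒜) × ℂ => (p.1.1, p.2))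
        (continuousAt_resolvent_prod (h z hz)) (by fun_prop)
    have h2 : ContinuousAt (fun p : (𝒜 × 𝒜) × ℂ => resolvent (A 0) p.2) ((A 0, A'), z) :=
      ContinuousAt.comp (f := fun p : (𝒜 × 𝒜) × ℂ => (A 0, p.2))
        (continuousAt_resolvent_prod (h z hz)) (by fun_prop)
    have h3 : ContinuousAt (fun p : (𝒜 × 𝒜) × ℂ =>
        dist (resolvent (A 0) p.2 * A' * resolvent (A 0) p.2)
          (resolvent p.1.1 p.2 * p.1.2 * resolvent (A 0) p.2)) ((A 0, A'), z) := by fun_prop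
    exact h3.eventually_lt continuousAt_const (by simpa using hε)
  have hevs : ∀ᶠ s in 𝓝[≠] (0 : ℝ), ∀ z ∈ Metric.sphere c R, IsUnit (algebraMap ℂ 𝒜 z - A s) :=
    hev.filter_mono nhdsWithin_le_nhds
  refine (hunif.tendsto_circleIntegral_of_continuousOn hR ?_).congr' ?_
  · filter_upwards [hevs] with s hs
    exact ((hcont _ hs).mul continuousOn_const).mul (hcont _ h)
  · filter_upwards [hevs] with s hs
    rw [slope_def_module (fun s => ∮ z in C(c, R), resolvent (A s) z), ← circleIntegral.integral_sub
      ((hcont _ hs).circleIntegrable hR) ((hcont _ h).circleIntegrable hR)]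
    have hsm : ∀ f : ℂ → 𝒜, (s - 0)⁻¹ • (∮ z in C(c, R), f z) =
        ∮ z in C(c, R), (s - 0)⁻¹ • f z := by
      intro f
      have := circleIntegral.integral_smul ((((s - 0)⁻¹ : ℝ)) : ℂ) f c R
      simpa only [Complex.coe_smul] using this.symm
    rw [hsm]
    refine circleIntegral.integral_congr hR fun z hz => ?_
    rw [resolvent_sub_resolvent (h z hz) (hs z hz), slope_def_module, mul_smul_comm, smul_mul_assoc]

end ContourResolvent

/-! ### Self-adjoint operators: lower bounds on the circle and the Riesz projection -/

section SelfAdjoint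

variable {H : Type*} [NormedAddCommGroup H] [InnerProductSpace ℂ H] [CompleteSpace H]

/-- On the circle through `E` and `E - 2R`, a self-adjoint operator with `‖T - E‖ ≤ R` satisfies the
lower bound that it satisfies at `E`. -/
theorem norm_sub_smul_le_of_mem_sphere {T : H →L[ℂ] H} (hT : IsSelfAdjoint T) {E R : ℝ}
    (hR : 0 < R) {ψ : H} (hb : ‖T ψ - (E : ℂ) • ψ‖ ≤ R * ‖ψ‖) {z : ℂ}
    (hz : z ∈ Metric.sphere ((E - R : ℝ) : ℂ) R) :
    ‖T ψ - (E : ℂ) • ψ‖ ≤ ‖T ψ - z • ψ‖ := by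
  set v := T ψ - (E : ℂ) • ψ with hv
  set ζ := z - (E : ℂ) with hζ
  have h1 : T ψ - z • ψ = v - ζ • ψ := by rw [hv, hζ, sub_smul]; abel
  have him : (inner ℂ v ψ).im = 0 := by
    have h2 : (starRingEnd ℂ) (inner ℂ (T ψ) ψ) = inner ℂ (T ψ) ψ := by
      rw [inner_conj_symm]
      exact ((ContinuousLinearMap.isSelfAdjoint_iff_isSymmetric.1 hT) ψ ψ).symm
    have h3 := Complex.conj_eq_iff_im.1 h2
    rw [hv, inner_sub_left, Complex.sub_im, h3, inner_smul_left, inner_self_eq_norm_sq_to_K]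
    simp [← Complex.ofReal_pow]
  have hsq : (z.re - (E - R)) ^ 2 + z.im ^ 2 = R ^ 2 := by
    have h4 : ‖z - ((E - R : ℝ) : ℂ)‖ = R := by simpa [dist_eq_norm] using hz
    have h5 := Complex.sq_norm (z - ((E - R : ℝ) : ℂ))
    rw [h4, Complex.normSq_apply] at h5
    simp only [Complex.sub_re, Complex.ofReal_re, Complex.sub_im, Complex.ofReal_im, sub_zero] at h5
    linarith
  have hζre : ζ.re = z.re - E := by simp [hζ]
  have hζim : ζ.im = z.im := by simp [hζ]
  -- This is the equation of the circle, with the origin moved to E; in particular Re ζ ≤ 0. It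
  -- turns ‖v − ζψ‖² into ‖v‖² − 2 Re ζ (⟨v, ψ⟩ + R‖ψ‖²), where ⟨v, ψ⟩ is real by self-adjointness
  -- and the bracket is nonnegative by `hb` and Cauchy–Schwarz.
  have hζn : ‖ζ‖ ^ 2 = -2 * R * ζ.re := by
    rw [Complex.sq_norm, Complex.normSq_apply, hζre, hζim]; linarith
  have hre : ‖v - ζ • ψ‖ ^ 2 = ‖v‖ ^ 2 - 2 * (ζ.re * (inner ℂ v ψ).re) + ‖ζ‖ ^ 2 * ‖ψ‖ ^ 2 := by
    have := norm_sub_sq (𝕜 := ℂ) v (ζ • ψ)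
    rw [this, norm_smul, inner_smul_right]
    simp only [RCLike.re_eq_complex_re, Complex.mul_re, him]
    ring
  have hin : |(inner ℂ v ψ).re| ≤ R * ‖ψ‖ * ‖ψ‖ :=
    (Complex.abs_re_le_norm _).trans ((norm_inner_le_norm v ψ).trans
      (mul_le_mul_of_nonneg_right hb (norm_nonneg _)))
  have hneg : ζ.re ≤ 0 := by
    have : 0 ≤ ‖ζ‖ ^ 2 := by positivity
    nlinarith
  rw [h1]
  refine le_of_sq_le_sq ?_ (norm_nonneg _)
  rw [hre, hζn]
  have h6 := (abs_le.1 hin).1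
  nlinarith [mul_nonneg (neg_nonneg.2 hneg) (by linarith : 0 ≤ (inner ℂ v ψ).re + R * ‖ψ‖ * ‖ψ‖)]

theorem mem_realSpectrum_of_mem_spectrum {T : H →L[ℂ] H} (hT : IsSelfAdjoint T) {z : ℂ}
    (hz : z ∈ spectrum ℂ T) : z.re ∈ realSpectrum T ∧ z = (z.re : ℂ) := by
  have h1 : z = (z.re : ℂ) := hT.mem_spectrum_eq_re hz
  refine ⟨?_, h1⟩
  rw [realSpectrum, ← spectrum.algebraMap_mem_iff ℂ]
  exact h1 ▸ hz

theorem abs_le_norm_of_mem_realSpectrum {T : H →L[ℂ] H} {x : ℝ} (hx : x ∈ realSpectrum T) :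
    |x| ≤ ‖T‖ := by
  rw [realSpectrum, ← spectrum.algebraMap_mem_iff ℂ] at hx
  rcases subsingleton_or_nontrivial H with hs | hs
  · have : Subsingleton (H →L[ℂ] H) := inferInstance
    simp [spectrum.of_subsingleton] at hx
  · simpa using spectrum.norm_le_norm_of_mem hx

theorem isUnit_of_notMem_realSpectrum {T : H →L[ℂ] H} {x : ℝ} (hx : x ∉ realSpectrum T) :
    IsUnit (algebraMap ℂ (H →L[ℂ] H) (x : ℂ) - T) := by
  rw [realSpectrum, ← spectrum.algebraMap_mem_iff ℂ, spectrum.notMem_iff] at hx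
  exact hx

/-- The functional calculus bounds (E − T)⁻¹ by the supremum of 1/|E − x| over the spectrum. Zero
distance, which is also the default value for empty spectrum, is trivial. -/
theorem infDist_realSpectrum_mul_norm_le {T : H →L[ℂ] H} (hT : IsSelfAdjoint T) {E : ℝ}
    (hE : E ∉ realSpectrum T) (ψ : H) :
    Metric.infDist E (realSpectrum T) * ‖ψ‖ ≤ ‖T ψ - (E : ℂ) • ψ‖ := by
  set δ := Metric.infDist E (realSpectrum T) with hδ
  have h0' : 0 ≤ δ := Metric.infDist_nonneg
  rcases h0'.eq_or_lt with h0 | h0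
  · rw [← h0]; simp
  have hne : ∀ x ∈ spectrum ℝ T, E - x ≠ 0 := fun x hx h => hE (by
    rw [sub_eq_zero] at h; exact h ▸ hx)
  have h1 : cfc (fun x : ℝ => (E - x)⁻¹) T = Ring.inverse (cfc (fun x : ℝ => E - x) T) :=
    cfc_inv (fun x : ℝ => E - x) T hne
  have h2 : cfc (fun x : ℝ => E - x) T = algebraMap ℝ _ E - T := by
    rw [cfc_sub (fun _ : ℝ => E) (fun x : ℝ => x) T, cfc_const E T, cfc_id' ℝ T]
  have h3 : IsUnit (algebraMap ℝ (H →L[ℂ] H) E - T) := spectrum.notMem_iff.1 hE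
  have h4 : cfc (fun x : ℝ => (E - x)⁻¹) T * (algebraMap ℝ (H →L[ℂ] H) E - T) = 1 := by
    rw [h1, h2]; exact Ring.inverse_mul_cancel _ h3
  have h5 : ‖cfc (fun x : ℝ => (E - x)⁻¹) T‖ ≤ δ⁻¹ := by
    refine norm_cfc_le (by positivity) fun x hx => ?_
    rw [norm_inv]
    refine inv_anti₀ h0 ?_
    rw [← dist_eq_norm]
    exact Metric.infDist_le_dist_of_mem hx
  have h6 : ψ = cfc (fun x : ℝ => (E - x)⁻¹) T ((E : ℂ) • ψ - T ψ) := by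
    have := congrArg (fun S : H →L[ℂ] H => S ψ) h4
    simpa [Algebra.algebraMap_eq_smul_one] using this.symm
  have h7 : ‖ψ‖ ≤ δ⁻¹ * ‖(E : ℂ) • ψ - T ψ‖ := by
    conv_lhs => rw [h6]
    exact (ContinuousLinearMap.le_opNorm _ _).trans
      (mul_le_mul_of_nonneg_right h5 (norm_nonneg _))
  rw [norm_sub_rev, inv_mul_eq_div, le_div_iff₀ h0] at h7
  linarith

/-- The spectrum is real, and the circle meets the real axis only at E, which is not in the
spectrum, and at E − 2R, which lies below −‖T‖. -/
theorem isUnit_on_sphere {T : H →L[ℂ] H} (hT : IsSelfAdjoint T) {E R : ℝ}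
    (hE : E ∉ realSpectrum T) (hR : ‖T‖ + |E| < 2 * R) {z : ℂ}
    (hz : z ∈ Metric.sphere ((E - R : ℝ) : ℂ) R) : IsUnit (algebraMap ℂ (H →L[ℂ] H) z - T) := by
  rw [← spectrum.notMem_iff]
  intro hzs
  obtain ⟨h1, h2⟩ := mem_realSpectrum_of_mem_spectrum hT hzs
  have h3 := abs_le_norm_of_mem_realSpectrum h1
  rw [h2, Metric.mem_sphere, Complex.dist_of_im_eq (by simp), Real.dist_eq] at hz
  simp only [Complex.ofReal_re] at hz
  have h4 : z.re ≠ E := fun h => hE (h ▸ h1)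
  have h5 := neg_abs_le z.re
  have h6 := le_abs_self E
  rcases abs_cases (z.re - (E - R)) with ⟨h, _⟩ | ⟨h, _⟩
  · exact h4 (by linarith)
  · linarith

/-- The Riesz projection formula for the spectral projection of a self-adjoint operator. -/
theorem fermiProjection_eq_circleIntegral {T : H →L[ℂ] H} (hT : IsSelfAdjoint T) {ε E R : ℝ}
    (hE : Disjoint (Set.uIcc ε E) (realSpectrum T)) (hR : ‖T‖ + |E| < 2 * R) :
    fermiProjection ε T =
      (2 * Real.pi * Complex.I : ℂ)⁻¹ • ∮ z in C(((E - R : ℝ) : ℂ), R), resolvent T z := by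
  set c : ℂ := ((E - R : ℝ) : ℂ)
  have hR0 : 0 < R := by nlinarith [norm_nonneg T, abs_nonneg E]
  have hEs : E ∉ realSpectrum T := Set.disjoint_left.1 hE Set.right_mem_uIcc
  have hmem : ∀ θ : ℝ, circleMap c R θ ∈ Metric.sphere c R := fun θ =>
    circleMap_mem_sphere c hR0.le θ
  have hunit : ∀ z ∈ Metric.sphere c R, IsUnit (algebraMap ℂ (H →L[ℂ] H) z - T) := fun z hz =>
    isUnit_on_sphere hT hEs hR hz
  have hne : ∀ z ∈ Metric.sphere c R, ∀ x ∈ spectrum ℂ T, z - x ≠ 0 := fun z hz x hx h => by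
    rw [sub_eq_zero] at h
    exact spectrum.notMem_iff.2 (hunit z hz) (h ▸ hx)
  have hres : ∀ z ∈ Metric.sphere c R, cfc (fun x : ℂ => (z - x)⁻¹) T = resolvent T z := by
    intro z hz
    rw [cfc_inv (fun x : ℂ => z - x) T (hne z hz),
      cfc_sub (fun _ : ℂ => z) (fun x : ℂ => x) T, cfc_const z T, cfc_id' ℂ T]
    rfl
  have hcont : ContinuousOn (Function.uncurry fun (θ : ℝ) (x : ℂ) =>
      deriv (circleMap c R) θ * (circleMap c R θ - x)⁻¹) (Set.univ ×ˢ spectrum ℂ T) := by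
    simp only [deriv_circleMap]
    refine ContinuousOn.mul (by fun_prop) (ContinuousOn.inv₀ (by fun_prop) ?_)
    rintro ⟨θ, x⟩ ⟨-, hx⟩
    exact hne _ (hmem θ) x hx
  -- The scalar Riesz formula: on the spectrum the indicator is a winding number. A spectral point
  -- lies below ε exactly when it lies below E, because there is no spectrum between them. The
  -- functional calculus commutes with the contour integral and carries this over to T.
  have hscalar : ∀ x ∈ spectrum ℂ T,
      ((Set.indicator (Set.Iio ε) (fun _ => (1 : ℝ)) x.re : ℝ) : ℂ) =
        (2 * Real.pi * Complex.I : ℂ)⁻¹ * ∮ z in C(c, R), (z - x)⁻¹ := by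
    intro x hx
    obtain ⟨h1, h2⟩ := mem_realSpectrum_of_mem_spectrum hT hx
    have h3 := abs_le.1 (abs_le_norm_of_mem_realSpectrum h1)
    have h4 : x.re ∉ Set.uIcc ε E := fun h => Set.disjoint_left.1 hE h h1
    have h5 := le_abs_self E
    have h5' := neg_abs_le E
    have h6 : dist x c = |x.re - (E - R)| := by
      rw [h2, Complex.dist_of_im_eq (by simp [c]), Real.dist_eq]; simp [c]
    rcases lt_or_ge x.re E with hlt | hge
    · have h7 : x.re < ε := by
        by_contra hcon
        exact h4 (Set.mem_uIcc.2 (Or.inl ⟨not_lt.1 hcon, hlt.le⟩))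
      rw [circleIntegral.integral_sub_inv_of_mem_ball, inv_mul_cancel₀ Complex.two_pi_I_ne_zero,
        Set.indicator_of_mem (by exact h7), Complex.ofReal_one]
      rw [Metric.mem_ball, h6, abs_lt]
      constructor <;> linarith
    · have h7 : ¬ x.re < ε := fun hcon => h4 (Set.mem_uIcc.2 (Or.inr ⟨hge, hcon.le⟩))
      have h8 : E < x.re := lt_of_le_of_ne hge fun h => hEs (h ▸ h1)
      rw [Set.indicator_of_notMem (by exact h7), Complex.ofReal_zero]
      have h9 : x ∉ Metric.closedBall c R := by
        rw [Metric.mem_closedBall, h6, not_le]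
        exact lt_of_lt_of_le (by linarith) (le_abs_self _)
      have h10 : ∀ z ∈ Metric.closedBall c R, z - x ≠ 0 := fun z hz h => h9 (by
        rw [sub_eq_zero] at h; exact h ▸ hz)
      rw [Complex.circleIntegral_eq_zero_of_differentiable_on_off_countable hR0.le
        Set.countable_empty, mul_zero]
      · exact ContinuousOn.inv₀ (by fun_prop) h10
      · intro z hz
        exact DifferentiableAt.inv (by fun_prop) (h10 z (Metric.ball_subset_closedBall hz.1))
  rw [fermiProjection, cfc_real_eq_complex _ hT, cfc_congr (fun x hx => hscalar x hx)]
  simp only [circleIntegral, intervalIntegral.integral_of_le Real.two_pi_pos.le, smul_eq_mul,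
    ← MeasureTheory.integral_const_mul, ← MeasureTheory.integral_smul]
  obtain ⟨C, hC⟩ : ∃ C, ∀ θ ∈ Set.Ioc 0 (2 * Real.pi), ∀ x ∈ spectrum ℂ T,
      ‖deriv (circleMap c R) θ * (circleMap c R θ - x)⁻¹‖ ≤ C := by
    have hcpt : IsCompact (Set.Icc 0 (2 * Real.pi) ×ˢ spectrum ℂ T) :=
      isCompact_Icc.prod (spectrum.isCompact T)
    obtain ⟨C, hC⟩ := hcpt.exists_bound_of_continuousOn
      (hcont.mono (Set.prod_mono (Set.subset_univ _) le_rfl))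
    exact ⟨C, fun θ hθ x hx => hC (θ, x) ⟨Set.Ioc_subset_Icc_self hθ, hx⟩⟩
  rw [cfc_integral _ (fun _ => ‖(2 * Real.pi * Complex.I : ℂ)⁻¹‖ * C) T
    (continuousOn_const.mul hcont)
    ((MeasureTheory.ae_restrict_iff' measurableSet_Ioc).2 (Eventually.of_forall fun θ hθ x hx => by
      rw [norm_mul]; exact mul_le_mul_of_nonneg_left (hC θ hθ x hx) (norm_nonneg _)))
    (MeasureTheory.integrable_const _).hasFiniteIntegral]
  refine MeasureTheory.integral_congr_ae (Eventually.of_forall fun θ => ?_)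
  have h1 : ContinuousOn (fun x : ℂ => (circleMap c R θ - x)⁻¹) (spectrum ℂ T) :=
    ContinuousOn.inv₀ (by fun_prop) (hne _ (hmem θ))
  simp only
  rw [cfc_const_mul _ (fun x => deriv (circleMap c R) θ * (circleMap c R θ - x)⁻¹) T
    (continuousOn_const.mul h1), cfc_const_mul _ (fun x => (circleMap c R θ - x)⁻¹) T h1,
    hres _ (hmem θ)]

/-- The derivative of the spectral projection along a differentiable family. -/
theorem hasDerivAt_fermiProjection {A : ℝ → H →L[ℂ] H} {A' : H →L[ℂ] H} (hA : HasDerivAt A A' 0)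
    (hsa : ∀ᶠ s in 𝓝 0, IsSelfAdjoint (A s)) {ε E R : ℝ}
    (hE : Disjoint (Set.uIcc ε E) (realSpectrum (A 0))) (hR : ‖A 0‖ + |E| < 2 * R) :
    HasDerivAt (fun s => fermiProjection ε (A s)) ((2 * Real.pi * Complex.I : ℂ)⁻¹ •
      ∮ z in C(((E - R : ℝ) : ℂ), R), resolvent (A 0) z * A' * resolvent (A 0) z) 0 := by
  have hR0 : 0 < R := by nlinarith [norm_nonneg (A 0), abs_nonneg E]
  have hEs : E ∉ realSpectrum (A 0) := Set.disjoint_left.1 hE Set.right_mem_uIcc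
  have h1 := (hasDerivAt_circleIntegral_resolvent hA hR0.le fun z hz =>
    isUnit_on_sphere hsa.self_of_nhds hEs hR hz).const_smul (2 * Real.pi * Complex.I : ℂ)⁻¹
  refine h1.congr_of_eventuallyEq ?_
  have h2 : ∀ᶠ s in 𝓝 (0 : ℝ), ‖A s‖ + |E| < 2 * R :=
    (hA.continuousAt.norm.add continuousAt_const).eventually_lt continuousAt_const hR
  -- The Riesz formula is needed for all s near 0. Absence of spectrum on the compact interval
  -- between ε and E is stable under small perturbations, even if ε and E differ.
  have h3 : ∀ᶠ s in 𝓝 (0 : ℝ), ∀ z ∈ Complex.ofReal '' Set.uIcc ε E,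
      IsUnit (algebraMap ℂ (H →L[ℂ] H) z - A s) := by
    refine hA.continuousAt.eventually (eventually_isUnit_of_isCompact
      (isCompact_uIcc.image Complex.continuous_ofReal) ?_)
    rintro _ ⟨x, hx, rfl⟩
    exact isUnit_of_notMem_realSpectrum (Set.disjoint_left.1 hE hx)
  filter_upwards [h2, h3, hsa] with s hs2 hs3 hs4
  refine fermiProjection_eq_circleIntegral hs4 (Set.disjoint_left.2 fun x hx hxs => ?_) hs2
  rw [realSpectrum, ← spectrum.algebraMap_mem_iff ℂ] at hxs
  exact spectrum.notMem_iff.2 (hs3 _ ⟨x, hx, rfl⟩) hxs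

end SelfAdjoint

/-! ### Translation invariant operators and their symbols -/

section Fourier

open UnitAddTorus MeasureTheory

attribute [local instance] instMeasureSpaceUnitAddCircle
attribute [local instance] instIsProbabilityMeasureUnitAddCircleVolume
attribute [local instance] instIsAddHaarMeasureUnitAddCircleVolume

variable {d : ℕ}

theorem summable_smul_mFourier {c : (Fin d → ℤ) → ℂ} (hc : Summable fun α => ‖c α‖) :
    Summable fun α => c α • mFourier α := by
  refine Summable.of_norm ?_
  simpa [norm_smul, mFourier_norm] using hc

theorem hasSum_smul_mFourier_apply {c : (Fin d → ℤ) → ℂ} (hc : Summable fun α => ‖c α‖)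
    (t : UnitAddTorus (Fin d)) :
    HasSum (fun α => c α * mFourier α t) ((∑' α, c α • mFourier α) t) := by
  simpa using (summable_smul_mFourier hc).hasSum.mapL (ContinuousMap.evalCLM ℂ t)

/-- Parseval's identity for absolutely convergent Fourier series. -/
theorem hasSum_normSq_of_summable {c : (Fin d → ℤ) → ℂ} (hc : Summable fun α => ‖c α‖) :
    HasSum (fun α => ‖c α‖ ^ 2)
      (∫ t, ‖(∑' α, c α • mFourier α : C(UnitAddTorus (Fin d), ℂ)) t‖ ^ 2) := by
  set F : C(UnitAddTorus (Fin d), ℂ) := ∑' α, c α • mFourier α with hF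
  have h1 : HasSum (fun α => c α • mFourierLp 2 α) (ContinuousMap.toLp 2 volume ℂ F) := by
    simpa using (summable_smul_mFourier hc).hasSum.mapL
      (ContinuousMap.toLp (E := ℂ) 2 (volume : Measure (UnitAddTorus (Fin d))) ℂ)
  have h2 : ∀ n, mFourierCoeff (ContinuousMap.toLp (E := ℂ) 2 volume ℂ F) n = c n := by
    intro n
    rw [← mFourierBasis_repr, mFourierBasis.repr_apply_apply, coe_mFourierBasis]
    have h3 := h1.mapL (innerSL ℂ (mFourierLp 2 n))
    simp only [innerSL_apply_apply, inner_smul_right,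
      orthonormal_iff_ite.1 orthonormal_mFourier] at h3
    refine h3.unique ?_
    suffices h : (fun b => c b * if n = b then 1 else 0) = fun b => if b = n then c n else 0 by
      rw [h]; exact hasSum_ite_eq n (c n)
    funext j
    by_cases h : n = j
    · subst h; simp
    · simp [h, Ne.symm h]
  have h3 := hasSum_sq_mFourierCoeff (ContinuousMap.toLp (E := ℂ) 2 volume ℂ F)
  simp only [h2] at h3
  convert h3 using 1
  refine integral_congr_ae ?_
  filter_upwards [ContinuousMap.coeFn_toLp (p := 2) (𝕜 := ℂ) volume F] with t ht
  rw [ht]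

/-- The Fourier series with coefficients `v (x, ·)`. -/
noncomputable def fourierComponent {J I : Type*} (e : J × (Fin d → ℤ) ≃ I) (v : I → ℂ) (x : J) :
    C(UnitAddTorus (Fin d), ℂ) :=
  ∑' α, v (e (x, α)) • mFourier α

theorem normSq_eq_integral_fourierComponent {J I : Type*} [Fintype J] (e : J × (Fin d → ℤ) ≃ I)
    (χ : EllTwo I) (hχ : ∀ x, Summable fun α => ‖χ (e (x, α))‖) :
    ‖χ‖ ^ 2 = ∫ t, ∑ x, ‖fourierComponent e χ x t‖ ^ 2 := by
  have h1 : HasSum (fun p : J × (Fin d → ℤ) => ‖χ (e p)‖ ^ 2) (‖χ‖ ^ 2) :=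
    e.hasSum_iff.2 (EllTwo.hasSum_normSq χ)
  have h2 := h1.prod_fiberwise fun x => hasSum_normSq_of_summable (hχ x)
  rw [← h2.tsum_eq, tsum_fintype, integral_finsetSum]
  · rfl
  · intro x _
    exact ((ContinuousMap.continuous _).norm.pow 2).integrable_of_hasCompactSupport
      (HasCompactSupport.of_compactSpace _)

theorem fourierComponent_sum_single {J I : Type*} [DecidableEq J] [DecidableEq I]
    (e : J × (Fin d → ℤ) ≃ I) (s : Finset I) (c : I → ℂ) {v : I → ℂ}
    (hv : ∀ p, v p = ∑ i ∈ s, c i * if p = i then 1 else 0) :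
    (∀ x, Summable fun α => ‖v (e (x, α))‖) ∧ ∀ x t, fourierComponent e v x t =
      ∑ i ∈ s, c i * if x = (e.symm i).1 then mFourier (e.symm i).2 t else 0 := by
  have hs1 : ∀ x i, Summable fun α => ‖if e (x, α) = i then (1 : ℂ) else 0‖ := by
    intro x i
    refine summable_of_hasFiniteSupport ((Set.finite_singleton (e.symm i).2).subset ?_)
    intro α hα
    simp only [Function.mem_support, ne_eq, norm_eq_zero, ite_eq_right_iff, one_ne_zero, imp_false,
      not_not] at hα
    rw [← hα]; simp
  have hs1' : ∀ x, Summable fun α => ‖v (e (x, α))‖ := fun x => by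
    simp_rw [hv]
    refine Summable.of_nonneg_of_le (fun _ => norm_nonneg _) (fun α => norm_sum_le _ _)
      (summable_sum fun i _ => ?_)
    simpa only [norm_mul] using (hs1 x i).mul_left _
  refine ⟨hs1', fun x t => (hasSum_smul_mFourier_apply (hs1' x) t).unique ?_⟩
  simp_rw [hv, Finset.sum_mul, mul_assoc]
  refine hasSum_sum fun i _ => HasSum.mul_left _ ?_
  by_cases hx : x = (e.symm i).1
  · rw [if_pos hx]
    suffices h : (fun α => (if e (x, α) = i then (1 : ℂ) else 0) * mFourier α t) =
        fun α => if α = (e.symm i).2 then mFourier (e.symm i).2 t else 0 by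
      rw [h]; exact hasSum_ite_eq _ _
    funext α
    have : e (x, α) = i ↔ α = (e.symm i).2 := by
      rw [← e.eq_symm_apply, hx]
      exact ⟨fun h => by rw [← h], fun h => by rw [h]⟩
    by_cases h : α = (e.symm i).2
    · rw [if_pos (this.2 h), if_pos h, h, one_mul]
    · rw [if_neg (fun h' => h (this.1 h')), if_neg h, zero_mul]
  · rw [if_neg hx]
    convert hasSum_zero using 1
    funext α
    rw [if_neg, zero_mul]
    intro h
    rw [← e.eq_symm_apply] at h
    exact hx (by rw [← h])

/-- Convolution becomes multiplication: a column of the kernel shifted by β has the Fourier series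
of the unshifted column, multiplied by the character of β. -/
theorem fourierComponent_sum_translate {J I : Type*}
    (e : J × (Fin d → ℤ) ≃ I) {K : I → I → ℂ}
    {k : J → J → (Fin d → ℤ) → ℂ} (hk : ∀ x y, Summable fun γ => ‖k x y γ‖)
    (hK : ∀ x y α β, K (e (x, α)) (e (y, β)) = k x y (α - β))
    (s : Finset I) (c : I → ℂ) {v : I → ℂ} (hv : ∀ p, v p = ∑ i ∈ s, c i * K p i) :
    (∀ x, Summable fun α => ‖v (e (x, α))‖) ∧ ∀ x t, fourierComponent e v x t =
      ∑ i ∈ s, c i * (mFourier (e.symm i).2 t *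
        (∑' γ, k x (e.symm i).1 γ • mFourier γ : C(UnitAddTorus (Fin d), ℂ)) t) := by
  have hKi : ∀ x α i, K (e (x, α)) i = k x (e.symm i).1 (α - (e.symm i).2) := by
    intro x α i
    rw [← hK, Prod.mk.eta, e.apply_symm_apply]
  have hs2 : ∀ x i, Summable fun α => ‖K (e (x, α)) i‖ := fun x i => by
    simp_rw [hKi]
    exact (Equiv.subRight (e.symm i).2).summable_iff.2 (hk x (e.symm i).1)
  have hs2' : ∀ x, Summable fun α => ‖v (e (x, α))‖ := fun x => by
    simp_rw [hv]
    refine Summable.of_nonneg_of_le (fun _ => norm_nonneg _) (fun α => norm_sum_le _ _)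
      (summable_sum fun i _ => ?_)
    simpa only [norm_mul] using (hs2 x i).mul_left _
  refine ⟨hs2', fun x t => (hasSum_smul_mFourier_apply (hs2' x) t).unique ?_⟩
  simp_rw [hv, Finset.sum_mul, mul_assoc]
  refine hasSum_sum fun i _ => HasSum.mul_left _ ?_
  have h1 := (hasSum_smul_mFourier_apply (hk x (e.symm i).1) t).mul_left
    (mFourier (e.symm i).2 t)
  rw [← (Equiv.subRight (e.symm i).2).hasSum_iff] at h1
  convert h1 using 1
  funext α
  have h3 : mFourier α t = mFourier (e.symm i).2 t * mFourier (α - (e.symm i).2) t := by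
    rw [← mFourier_add]; congr 2; abel
  simp only [Function.comp_apply, Equiv.subRight_apply]
  rw [hKi, h3]; ring

/-- An operator on `ℓ²(J × ℤ^d)` that commutes with translations is bounded below if its symbol
is bounded below. -/
theorem le_norm_apply_of_symbol {J I : Type*} [Fintype J] [DecidableEq J] [DecidableEq I]
    (e : J × (Fin d → ℤ) ≃ I) {T : EllTwo I →L[ℂ] EllTwo I} {K : I → I → ℂ} (hT : HasMatrix T K)
    {k : J → J → (Fin d → ℤ) → ℂ} (hk : ∀ x y, Summable fun γ => ‖k x y γ‖)
    (hK : ∀ x y α β, K (e (x, α)) (e (y, β)) = k x y (α - β)) {b : ℝ}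
    (hsym : ∀ (t : UnitAddTorus (Fin d)) (v : J → ℂ), b ^ 2 * ∑ x, ‖v x‖ ^ 2 ≤
      ∑ x, ‖∑ y, (∑' γ, k x y γ • mFourier γ : C(UnitAddTorus (Fin d), ℂ)) t * v y‖ ^ 2)
    (ψ : EllTwo I) : b * ‖ψ‖ ≤ ‖T ψ‖ := by
  -- For a finitely supported vector both it and its image have absolutely summable components, so
  -- Parseval reduces the claim to the pointwise bound on the symbol. Density of such vectors gives
  -- the rest.
  have hfin : ∀ (s : Finset I) (c : I → ℂ),
      b * ‖∑ i ∈ s, (lp.single 2 i (c i) : EllTwo I)‖ ≤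
        ‖T (∑ i ∈ s, (lp.single 2 i (c i) : EllTwo I))‖ := by
    intro s c
    set χ : EllTwo I := ∑ i ∈ s, lp.single 2 i (c i) with hχ
    have hχa : ∀ p, χ p = ∑ i ∈ s, c i * if p = i then 1 else 0 := by
      intro p
      rw [hχ, lp.coeFn_sum, Finset.sum_apply]
      refine Finset.sum_congr rfl fun i _ => ?_
      by_cases h : p = i
      · subst h; simp
      · rw [lp.single_apply_ne _ _ _ h]; simp [h]
    have hTa : ∀ p, T χ p = ∑ i ∈ s, c i * K p i := by
      intro p
      rw [hχ, map_sum, lp.coeFn_sum, Finset.sum_apply]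
      refine Finset.sum_congr rfl fun i _ => ?_
      have h3 : (lp.single 2 i (c i) : EllTwo I) = c i • lp.single 2 i (1 : ℂ) := by
        rw [← lp.single_smul]; simp
      rw [h3, map_smul, lp.coeFn_smul, Pi.smul_apply, hT p i, smul_eq_mul]
    obtain ⟨hs1, hGχ⟩ := fourierComponent_sum_single e s c hχa
    obtain ⟨hs2, hGT⟩ := fourierComponent_sum_translate e hk hK s c hTa
    have hrel : ∀ x t, fourierComponent e (T χ) x t =
        ∑ y, (∑' γ, k x y γ • mFourier γ : C(UnitAddTorus (Fin d), ℂ)) t *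
          fourierComponent e χ y t := by
      intro x t
      simp_rw [hGT, hGχ, Finset.mul_sum]
      rw [Finset.sum_comm]
      refine Finset.sum_congr rfl fun i _ => ?_
      rw [Finset.sum_eq_single (e.symm i).1]
      · rw [if_pos rfl]; ring
      · intro y _ hy; rw [if_neg hy]; ring
      · intro h; exact absurd (Finset.mem_univ _) h
    have hint : ∀ F : J → C(UnitAddTorus (Fin d), ℂ), Integrable fun t => ∑ x, ‖F x t‖ ^ 2 := by
      intro F
      refine integrable_finsetSum _ fun x _ => ?_
      exact ((F x).continuous.norm.pow 2).integrable_of_hasCompactSupport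
        (HasCompactSupport.of_compactSpace _)
    refine le_of_sq_le_sq ?_ (norm_nonneg _)
    rw [mul_pow, normSq_eq_integral_fourierComponent e χ hs1,
      normSq_eq_integral_fourierComponent e (T χ) hs2, ← integral_const_mul]
    refine integral_mono ((hint _).const_mul _) (hint _) fun t => ?_
    simp only [hrel]
    exact hsym t fun y => fourierComponent e χ y t
  have hlim := lp.hasSum_single (p := 2) (by norm_num) ψ
  refine le_of_tendsto_of_tendsto' (Tendsto.norm hlim |>.const_mul b)
    ((T.continuous.tendsto ψ).comp hlim).norm fun s => hfin s ψ

end Fourier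

/-! ### Hermitian matrices and majorants of the Hamiltonian -/

/-- A Hermitian matrix whose eigenvalues have distance at least `b` from `E`. -/
theorem Matrix.IsHermitian.le_sum_normSq_mulVec_sub {n : Type*} [Fintype n] [DecidableEq n]
    {A : Matrix n n ℂ} (hA : A.IsHermitian) {E b : ℝ} (hb : 0 ≤ b)
    (h : ∀ i, b ≤ |hA.eigenvalues i - E|) (v : n → ℂ) :
    b ^ 2 * ∑ i, ‖v i‖ ^ 2 ≤ ∑ i, ‖(A.mulVec v) i - E * v i‖ ^ 2 := by
  set w : EuclideanSpace ℂ n := WithLp.toLp 2 v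
  set B := hA.eigenvectorBasis
  have h1 : ∀ i, inner ℂ (B i) (WithLp.toLp 2 (A.mulVec v) - (E : ℂ) • w : EuclideanSpace ℂ n) =
      ((hA.eigenvalues i - E : ℝ) : ℂ) * inner ℂ (B i) w := by
    intro i
    have h2 := (Matrix.isSymmetric_toEuclideanLin_iff.2 hA) (B i) w
    have h3 : Matrix.toEuclideanLin A w = WithLp.toLp 2 (A.mulVec v) := rfl
    have h4 : Matrix.toEuclideanLin A (B i) = (hA.eigenvalues i : ℂ) • B i := by
      ext j
      have := congrFun (hA.mulVec_eigenvectorBasis i) j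
      simpa [Matrix.toLpLin_apply] using this
    rw [h3, h4, inner_smul_left] at h2
    rw [inner_sub_right, inner_smul_right, ← h2]
    simp; ring
  have h5 : ∑ i, ‖(A.mulVec v) i - E * v i‖ ^ 2 =
      ‖(WithLp.toLp 2 (A.mulVec v) - (E : ℂ) • w : EuclideanSpace ℂ n)‖ ^ 2 := by
    rw [EuclideanSpace.norm_sq_eq]; rfl
  have h6 : ∑ i, ‖v i‖ ^ 2 = ‖w‖ ^ 2 := by
    rw [EuclideanSpace.norm_sq_eq]
  rw [h5, h6, ← B.sum_sq_norm_inner_right, ← B.sum_sq_norm_inner_right, Finset.mul_sum]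
  refine Finset.sum_le_sum fun i _ => ?_
  rw [h1, norm_mul, mul_pow, Complex.norm_real, Real.norm_eq_abs]
  exact mul_le_mul_of_nonneg_right (pow_le_pow_left₀ hb (h i) 2) (by positivity)

namespace TBModel

variable {d M Nb : ℕ} {S : Type}

theorem norm_bond (X : TBModel d M Nb S) (u : X.Site → EuclideanSpace ℝ (Fin d)) (ℓ k : X.Site) :
    ‖X.bond u ℓ k‖ = ‖X.pos k + u k - (X.pos ℓ + u ℓ)‖ := by
  rw [← norm_neg, ← X.bond_neg]; rfl

theorem norm_bond_comm (X : TBModel d M Nb S) (u : X.Site → EuclideanSpace ℝ (Fin d))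
    (ℓ k : X.Site) : ‖X.bond u ℓ k‖ = ‖X.bond u k ℓ‖ := by
  rw [X.bond_neg, norm_neg]

/-- The sums over the sites of `e^{-γ r}` are bounded by `C`. -/
def ExpSumBound (X : TBModel d M Nb S) (u : X.Site → EuclideanSpace ℝ (Fin d)) (γ C : ℝ) : Prop :=
  ∀ ℓ : X.Site, Summable (fun k => Real.exp (-γ * ‖X.bond u ℓ k‖)) ∧
    ∑' k, Real.exp (-γ * ‖X.bond u ℓ k‖) ≤ C

theorem exists_expSumBound (d : ℕ) {m γ : ℝ} (hm : 0 < m) (hγ : 0 < γ) :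
    ∃ C : ℝ, 0 < C ∧ ∀ {M Nb : ℕ} {S : Type} (X : TBModel d M Nb S)
      {u : X.Site → EuclideanSpace ℝ (Fin d)}, X.Separated m u → X.ExpSumBound u γ C := by
  obtain ⟨C, hC0, hC⟩ := exists_uniform_expSum_bound d hm hγ
  refine ⟨C, hC0, fun X u hu ℓ => ?_⟩
  simp_rw [norm_bond]
  exact hC _ (fun k => X.pos k + u k) hu _

theorem IsTB.abs_h_le {X : TBModel d M Nb S} {h₀ γ₀ : ℝ} (hX : X.IsTB h₀ γ₀) (a b : Fin Nb)
    (r : EuclideanSpace ℝ (Fin d)) (z z' : S) : |X.h a b r z z'| ≤ h₀ * Real.exp (-γ₀ * ‖r‖) :=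
  le_trans (le_add_of_nonneg_right (norm_nonneg _)) ((hX a b z z').1.2 r)

theorem IsTB.abs_t_le {X : TBModel d M Nb S} {h₀ γ₀ : ℝ} (hX : X.IsTB h₀ γ₀) (a b : Fin Nb)
    (r : EuclideanSpace ℝ (Fin d)) (z z' : S) : |X.t a b r z z'| ≤ h₀ * Real.exp (-γ₀ * ‖r‖) :=
  le_trans (le_add_of_nonneg_right (norm_nonneg _)) ((hX a b z z').2.2 r)

/-- A majorant of the matrix of the Hamiltonian. -/
noncomputable def entryMajorant (X : TBModel d M Nb S) (h₀ γ₀ C : ℝ)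
    (u : X.Site → EuclideanSpace ℝ (Fin d)) (ℓ k : X.Site) : ℝ :=
  h₀ * Real.exp (-γ₀ * ‖X.bond u ℓ k‖) + if k = ℓ then h₀ * C else 0

theorem abs_tsum_t_le (X : TBModel d M Nb S) {h₀ γ₀ C : ℝ} (hh₀ : 0 < h₀) (hX : X.IsTB h₀ γ₀)
    {u : X.Site → EuclideanSpace ℝ (Fin d)} (hC : X.ExpSumBound u γ₀ C) (ℓ : X.Site)
    (a b : Fin Nb) :
    |∑' m : X.Site, if m = ℓ then 0 else
      X.t a b (X.bond u ℓ m) (X.species ℓ.1) (X.species m.1)| ≤ h₀ * C := by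
  have h2 := tsum_of_norm_bounded ((hC ℓ).1.mul_left h₀).hasSum (f := fun n : X.Site =>
    if n = ℓ then 0 else X.t a b (X.bond u ℓ n) (X.species ℓ.1) (X.species n.1)) (fun n => by
      split_ifs
      · simp only [norm_zero]; positivity
      · exact hX.abs_t_le _ _ _ _ _)
  refine h2.trans ?_
  rw [tsum_mul_left]
  exact mul_le_mul_of_nonneg_left (hC ℓ).2 hh₀.le

theorem abs_entry_le (X : TBModel d M Nb S) {h₀ γ₀ C : ℝ} (hh₀ : 0 < h₀) (hX : X.IsTB h₀ γ₀)
    {u : X.Site → EuclideanSpace ℝ (Fin d)} (hC : X.ExpSumBound u γ₀ C) (x y : X.Orb) :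
    |X.entry u x y| ≤ X.entryMajorant h₀ γ₀ C u x.1 y.1 := by
  refine (abs_add_le _ _).trans (add_le_add (hX.abs_h_le _ _ _ _ _) ?_)
  by_cases hxy : x.1 = y.1
  · rw [if_pos hxy, if_pos hxy.symm]
    exact X.abs_tsum_t_le hh₀ hX hC _ _ _
  · rw [if_neg hxy, if_neg (Ne.symm hxy), abs_zero]

theorem entryMajorant_spec (X : TBModel d M Nb S) {h₀ γ₀ C : ℝ} (hh₀ : 0 < h₀) (hC0 : 0 < C)
    {u : X.Site → EuclideanSpace ℝ (Fin d)} (hC : X.ExpSumBound u γ₀ C) :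
    (∀ ℓ k, 0 ≤ X.entryMajorant h₀ γ₀ C u ℓ k) ∧
    (∀ ℓ k, X.entryMajorant h₀ γ₀ C u ℓ k = X.entryMajorant h₀ γ₀ C u k ℓ) ∧
    (∀ ℓ, Summable (X.entryMajorant h₀ γ₀ C u ℓ)) ∧
    ∀ ℓ, ∑' k, X.entryMajorant h₀ γ₀ C u ℓ k ≤ 2 * h₀ * C := by
  refine ⟨fun ℓ k => ?_, fun ℓ k => ?_, fun ℓ => ?_, fun ℓ => ?_⟩
  · have : (0 : ℝ) ≤ if k = ℓ then h₀ * C else 0 := by split_ifs <;> positivity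
    rw [entryMajorant]; positivity
  · rw [entryMajorant, entryMajorant, X.norm_bond_comm]
    congr 1
    exact if_congr eq_comm rfl rfl
  · exact ((hC ℓ).1.mul_left h₀).add (hasSum_ite_eq ℓ (h₀ * C)).summable
  · simp only [entryMajorant]
    rw [((hC ℓ).1.mul_left h₀).tsum_add (hasSum_ite_eq ℓ (h₀ * C)).summable, tsum_ite_eq,
      tsum_mul_left]
    nlinarith [mul_le_mul_of_nonneg_left (hC ℓ).2 hh₀.le]

theorem norm_hamiltonian_le (X : TBModel d M Nb S) {h₀ γ₀ C : ℝ} (hh₀ : 0 < h₀) (hC0 : 0 < C)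
    (hX : X.IsTB h₀ γ₀) {u : X.Site → EuclideanSpace ℝ (Fin d)} (hC : X.ExpSumBound u γ₀ C)
    (hH : HasMatrix (X.hamiltonian u) fun x y => (X.entry u x y : ℂ)) :
    ‖X.hamiltonian u‖ ≤ Nb * (2 * h₀ * C) := by
  obtain ⟨h1, h2, h3, h4⟩ := X.entryMajorant_spec hh₀ hC0 hC
  refine ContinuousLinearMap.opNorm_le_bound _ (by positivity) fun ψ => ?_
  refine hH.norm_apply_le_block (g := X.entryMajorant h₀ γ₀ C u) (fun x y => ?_) h1 h2 h3 h4 ψ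
  rw [Complex.norm_real, Real.norm_eq_abs]
  exact X.abs_entry_le hh₀ hX hC x y

/-! ### Bloch theory of the reference crystal -/

section Bloch

/-- Coefficients of the symbol of the reference Hamiltonian. -/
noncomputable def symbolCoeff (X : TBModel d M Nb S) (x y : Fin M × Fin Nb) (γ : Fin d → ℤ) : ℂ :=
  (X.entry 0 ((x.1, γ), x.2) ((y.1, 0), y.2) : ℂ)

/-- Orbitals as pairs of an orbital of the unit cell and a lattice vector. -/
def orbEquiv (X : TBModel d M Nb S) : (Fin M × Fin Nb) × (Fin d → ℤ) ≃ X.Orb where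
  toFun p := ((p.1.1, p.2), p.1.2)
  invFun q := ((q.1.1, q.2), q.1.2)
  left_inv _ := rfl
  right_inv _ := rfl

theorem entry_orbEquiv (X : TBModel d M Nb S) (x y : Fin M × Fin Nb) (α β : Fin d → ℤ) :
    (X.entry 0 (X.orbEquiv (x, α)) (X.orbEquiv (y, β)) : ℂ) = X.symbolCoeff x y (α - β) := by
  have := X.entry_translate β x.1 y.1 (α - β) 0 x.2 y.2
  rw [sub_add_cancel, zero_add] at this
  rw [symbolCoeff, ← this]
  rfl

variable {X : TBModel d M Nb S} {h₀ γ₀ C : ℝ}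

theorem summable_symbolCoeff (hh₀ : 0 < h₀) (hC0 : 0 < C) (hX : X.IsTB h₀ γ₀)
    (hC : X.ExpSumBound 0 γ₀ C) (y : Fin M × Fin Nb) :
    (∀ x, Summable fun γ => ‖X.symbolCoeff x y γ‖) ∧
      ∑ x, ∑' γ, ‖X.symbolCoeff x y γ‖ ≤ Nb * (2 * h₀ * C) := by
  obtain ⟨h1, h2, h3, h4⟩ := X.entryMajorant_spec hh₀ hC0 hC
  set y' : X.Orb := ((y.1, 0), y.2)
  obtain ⟨h5, h6⟩ := summable_prod_fin (n := Nb) (h3 y'.1) (h1 y'.1)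
  have hle : ∀ p : X.Orb, ‖(X.entry 0 p y' : ℂ)‖ ≤ X.entryMajorant h₀ γ₀ C 0 y'.1 p.1 := by
    intro p
    rw [Complex.norm_real, Real.norm_eq_abs, h2]
    exact X.abs_entry_le hh₀ hX hC p y'
  have hs : Summable fun p : X.Orb => ‖(X.entry 0 p y' : ℂ)‖ :=
    Summable.of_nonneg_of_le (fun _ => norm_nonneg _) hle h5
  have hs' : Summable fun p : (Fin M × Fin Nb) × (Fin d → ℤ) => ‖X.symbolCoeff p.1 y p.2‖ :=
    X.orbEquiv.summable_iff.2 hs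
  refine ⟨fun x => hs'.prod_factor x, ?_⟩
  have h8 := hs'.tsum_prod
  rw [tsum_fintype (fun x => ∑' γ, ‖X.symbolCoeff x y γ‖)] at h8
  rw [← h8]
  have h7 : ∑' p : (Fin M × Fin Nb) × (Fin d → ℤ), ‖X.symbolCoeff p.1 y p.2‖ =
      ∑' p : X.Orb, ‖(X.entry 0 p y' : ℂ)‖ := X.orbEquiv.tsum_eq fun p => ‖(X.entry 0 p y' : ℂ)‖
  rw [h7]
  refine (hs.tsum_le_tsum hle h5).trans ?_
  rw [h6]
  exact mul_le_mul_of_nonneg_left (h4 _) (Nat.cast_nonneg _)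

theorem norm_bloch_le (hs : ∀ x y, Summable fun γ => ‖X.symbolCoeff x y γ‖)
    (ξ : EuclideanSpace ℝ (Fin d)) (x y : Fin M × Fin Nb) :
    ‖X.bloch ξ x y‖ ≤ ∑' γ, ‖X.symbolCoeff x y γ‖ := by
  refine tsum_of_norm_bounded (hs x y).hasSum fun γ => ?_
  rw [norm_mul]
  have : ‖Complex.exp (-Complex.I * (inner ℝ (X.pos (x.1, γ) - X.pos (y.1, 0)) ξ : ℝ))‖ = 1 := by
    rw [neg_mul, mul_comm, ← neg_mul, ← Complex.ofReal_neg, Complex.norm_exp_ofReal_mul_I]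
  rw [this, mul_one]
  rfl

/-- Gershgorin's theorem bounds an eigenvalue by an absolute row sum of the Bloch matrix; Hermitian
symmetry turns it into a column sum, and the phases disappear. The bound does not contain M, which
is needed for the uniformity of c₀. -/
theorem abs_eigenvalues_bloch_le (hh₀ : 0 < h₀) (hC0 : 0 < C) (hX : X.IsTB h₀ γ₀)
    (hC : X.ExpSumBound 0 γ₀ C) (ξ : EuclideanSpace ℝ (Fin d)) (i : Fin M × Fin Nb) :
    |(X.bloch_isHermitian ξ).eigenvalues i| ≤ Nb * (2 * h₀ * C) := by
  set lam := (X.bloch_isHermitian ξ).eigenvalues i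
  set v := (X.bloch_isHermitian ξ).eigenvectorBasis i
  have hs := fun x y => (summable_symbolCoeff hh₀ hC0 hX hC y).1 x
  have hev : Module.End.HasEigenvalue (Matrix.toLin' (X.bloch ξ)) (lam : ℂ) := by
    refine Module.End.hasEigenvalue_of_hasEigenvector (x := (v : Fin M × Fin Nb → ℂ)) ⟨?_, ?_⟩
    · rw [Module.End.mem_eigenspace_iff, Matrix.toLin'_apply]
      exact (X.bloch_isHermitian ξ).mulVec_eigenvectorBasis i
    · intro h0
      have h1 : ‖v‖ = 1 := (X.bloch_isHermitian ξ).eigenvectorBasis.norm_eq_one i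
      have h2 : v = 0 := by ext j; exact congrFun h0 j
      rw [h2, norm_zero] at h1
      exact zero_ne_one h1
  obtain ⟨k, hk⟩ := eigenvalue_mem_ball hev
  rw [mem_closedBall_iff_norm] at hk
  have h3 : ‖(lam : ℂ)‖ ≤ ∑ j, ‖X.bloch ξ k j‖ := by
    have h4 := norm_add_le ((lam : ℂ) - X.bloch ξ k k) (X.bloch ξ k k)
    rw [sub_add_cancel] at h4
    rw [← Finset.sum_erase_add _ _ (Finset.mem_univ k)]
    linarith
  rw [Complex.norm_real, Real.norm_eq_abs] at h3
  refine h3.trans (le_trans ?_ (summable_symbolCoeff hh₀ hC0 hX hC k).2)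
  refine Finset.sum_le_sum fun j _ => ?_
  rw [← (X.bloch_isHermitian ξ).apply k j, norm_star]
  exact norm_bloch_le hs ξ j k

/-- The symbol of the reference Hamiltonian. -/
noncomputable def symbol (X : TBModel d M Nb S) (x y : Fin M × Fin Nb) :
    C(UnitAddTorus (Fin d), ℂ) :=
  ∑' γ, X.symbolCoeff x y γ • UnitAddTorus.mFourier γ

/-- The point of the reciprocal cell with coordinates `x`. -/
noncomputable def wave (X : TBModel d M Nb S) (x : Fin d → ℝ) : EuclideanSpace ℝ (Fin d) :=
  WithLp.toLp 2 ((2 * Real.pi) • (X.A.transpose⁻¹).mulVec x)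

theorem inner_vec_wave (X : TBModel d M Nb S) (α : Fin d → ℤ) (x : Fin d → ℝ) :
    inner ℝ (X.vec α) (X.wave x) = 2 * Real.pi * ∑ n, α n * x n := by
  have h1 : (inner ℝ (X.vec α) (X.wave x) : ℝ) =
      ((2 * Real.pi) • (X.A.transpose⁻¹).mulVec x) ⬝ᵥ X.A.mulVec (fun n => (α n : ℝ)) := by
    rw [Multilattice.vec, wave, EuclideanSpace.inner_toLp_toLp]
    simp
  have h2 : IsUnit X.A.transpose.det := by
    rw [Matrix.det_transpose]; exact isUnit_iff_ne_zero.2 X.det_ne_zero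
  rw [h1, smul_dotProduct, Matrix.dotProduct_mulVec, ← Matrix.mulVec_transpose,
    Matrix.mulVec_mulVec, Matrix.mul_nonsing_inv _ h2, Matrix.one_mulVec, smul_eq_mul,
    dotProduct]
  congr 1
  exact Finset.sum_congr rfl fun n _ => mul_comm _ _

/-- The phase factors relating the symbol and the Bloch matrices. -/
noncomputable def phase (X : TBModel d M Nb S) (x : Fin d → ℝ) (p : Fin M × Fin Nb) : ℂ :=
  Complex.exp ((-inner ℝ (X.p p.1) (X.wave x) : ℝ) * Complex.I)

theorem norm_phase (X : TBModel d M Nb S) (x : Fin d → ℝ) (p : Fin M × Fin Nb) :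
    ‖X.phase x p‖ = 1 := Complex.norm_exp_ofReal_mul_I _

/-- The phases of the Bloch matrix involve p_i − p_j, so it need not be periodic in ξ. Conjugation
by diagonal phases removes them and leaves the symbol, a continuous function on the torus. The minus
sign in e^{-i…} is the reason for evaluating it at −x. -/
theorem bloch_wave (hs : ∀ x y, Summable fun γ => ‖X.symbolCoeff x y γ‖) (x : Fin d → ℝ)
    (p q : Fin M × Fin Nb) : X.bloch (X.wave x) p q * X.phase x q =
      X.phase x p * X.symbol p q (fun n => ((-x n : ℝ) : UnitAddCircle)) := by
  rw [symbol, ← (hasSum_smul_mFourier_apply (hs p q) _).tsum_eq, bloch, ← tsum_mul_left,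
    ← tsum_mul_right]
  refine tsum_congr fun γ => ?_
  have h0 : X.vec (0 : Fin d → ℤ) = 0 := by
    have := X.vec_add 0 0
    simpa using this
  have h1 : (inner ℝ (X.pos (p.1, γ) - X.pos (q.1, 0)) (X.wave x) : ℝ) =
      inner ℝ (X.p p.1) (X.wave x) + 2 * Real.pi * ∑ n, γ n * x n -
        inner ℝ (X.p q.1) (X.wave x) := by
    simp only [Multilattice.pos, h0, add_zero, inner_sub_left, inner_add_left, inner_vec_wave]
  have h2 : UnitAddTorus.mFourier γ (fun n => ((-x n : ℝ) : UnitAddCircle)) =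
      Complex.exp ((-(2 * Real.pi * ∑ n, γ n * x n) : ℝ) * Complex.I) := by
    simp only [UnitAddTorus.mFourier, ContinuousMap.coe_mk, fourier_coe_apply]
    rw [← Complex.exp_sum]
    congr 1
    push_cast
    rw [Finset.mul_sum, ← Finset.sum_neg_distrib, Finset.sum_mul]
    refine Finset.sum_congr rfl fun n _ => ?_
    ring
  rw [h2, phase, phase, h1, mul_assoc, ← Complex.exp_add, mul_left_comm, ← Complex.exp_add,
    symbolCoeff]
  congr 2
  push_cast
  ring

theorem sum_normSq_symbol (hs : ∀ x y, Summable fun γ => ‖X.symbolCoeff x y γ‖) (x : Fin d → ℝ)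
    (E : ℝ) (v : Fin M × Fin Nb → ℂ) :
    ∑ p, ‖∑ q, X.symbol p q (fun n => ((-x n : ℝ) : UnitAddCircle)) * v q - E * v p‖ ^ 2 =
      ∑ p, ‖((X.bloch (X.wave x)).mulVec fun q => X.phase x q * v q) p -
        E * (X.phase x p * v p)‖ ^ 2 := by
  refine Finset.sum_congr rfl fun p _ => ?_
  have h1 : ((X.bloch (X.wave x)).mulVec fun q => X.phase x q * v q) p - E * (X.phase x p * v p) =
      X.phase x p *
        (∑ q, X.symbol p q (fun n => ((-x n : ℝ) : UnitAddCircle)) * v q - E * v p) := by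
    rw [Matrix.mulVec, dotProduct, mul_sub, Finset.mul_sum]
    congr 1
    · refine Finset.sum_congr rfl fun q _ => ?_
      rw [← mul_assoc, bloch_wave hs, mul_assoc]
    · ring
  rw [h1, norm_mul, norm_phase, one_mul]

theorem exists_mem_reciprocalCell (X : TBModel d M Nb S) (t : UnitAddTorus (Fin d)) :
    ∃ x : Fin d → ℝ, X.wave x ∈ X.reciprocalCell ∧
      t = fun n => ((-x n : ℝ) : UnitAddCircle) := by
  refine ⟨fun n => (AddCircle.equivIco (1 : ℝ) (-(1 / 2)) (-t n) : ℝ), ⟨_, fun n => ?_, rfl⟩, ?_⟩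
  · have h := (AddCircle.equivIco (1 : ℝ) (-(1 / 2)) (-t n)).2
    have h2 : (-(1 / 2) : ℝ) + 1 = 1 / 2 := by norm_num
    exact ⟨h.1, h.2.trans_eq h2⟩
  · funext n
    rw [AddCircle.coe_neg, AddCircle.coe_equivIco, neg_neg]

theorem le_symbol_of_le_eigenvalues (hs : ∀ x y, Summable fun γ => ‖X.symbolCoeff x y γ‖)
    {E b : ℝ} (hb : 0 ≤ b) {x : Fin d → ℝ}
    (h : ∀ i, b ≤ |(X.bloch_isHermitian (X.wave x)).eigenvalues i - E|) (v : Fin M × Fin Nb → ℂ) :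
    b ^ 2 * ∑ p, ‖v p‖ ^ 2 ≤
      ∑ p, ‖∑ q, X.symbol p q (fun n => ((-x n : ℝ) : UnitAddCircle)) * v q - E * v p‖ ^ 2 := by
  rw [sum_normSq_symbol hs]
  have := (X.bloch_isHermitian (X.wave x)).le_sum_normSq_mulVec_sub hb h fun q => X.phase x q * v q
  simpa [norm_mul, norm_phase] using this

theorem le_norm_hamiltonian_sub (hH : HasMatrix (X.hamiltonian 0) fun x y => (X.entry 0 x y : ℂ))
    (hs : ∀ x y, Summable fun γ => ‖X.symbolCoeff x y γ‖) {E b : ℝ} (hb : 0 ≤ b)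
    (h : ∀ ξ ∈ X.reciprocalCell, ∀ i, b ≤ |(X.bloch_isHermitian ξ).eigenvalues i - E|)
    (ψ : EllTwo X.Orb) : b * ‖ψ‖ ≤ ‖X.hamiltonian 0 ψ - (E : ℂ) • ψ‖ := by
  set T : EllTwo X.Orb →L[ℂ] EllTwo X.Orb := X.hamiltonian 0 - (E : ℂ) • 1 with hT
  have hTm : HasMatrix T fun x y => (X.entry 0 x y : ℂ) - E * if x = y then 1 else 0 := by
    intro x y
    simp only [hT, _root_.sub_apply, _root_.smul_apply,
      one_apply_eq_self, lp.coeFn_sub, lp.coeFn_smul, Pi.sub_apply, Pi.smul_apply,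
      smul_eq_mul]
    rw [hH x y]
    by_cases hxy : x = y
    · subst hxy; simp
    · rw [lp.single_apply_ne _ _ _ hxy, if_neg hxy]
  -- Fourier coefficients of E times the identity: concentrated at γ = 0, so that the symbol of H(0)
  -- − E is the symbol of H(0) minus E.
  set δ : Fin M × Fin Nb → Fin M × Fin Nb → (Fin d → ℤ) → ℂ := fun x y γ =>
    E * if x = y ∧ γ = 0 then 1 else 0 with hδ
  have hδs : ∀ x y, HasSum (fun γ => δ x y γ • UnitAddTorus.mFourier (d := Fin d) γ)
      (δ x y 0 • UnitAddTorus.mFourier 0) := fun x y =>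
    hasSum_single 0 fun γ hγ => by
      have h0 : δ x y γ = 0 := by simp [hδ, hγ]
      rw [h0]; exact zero_smul ℂ (UnitAddTorus.mFourier (d := Fin d) γ)
  have hδn : ∀ x y, Summable fun γ => ‖δ x y γ‖ := fun x y =>
    (hasSum_single 0 fun γ hγ => by simp [hδ, hγ]).summable
  have key : b * ‖ψ‖ ≤ ‖T ψ‖ := by
    refine le_norm_apply_of_symbol X.orbEquiv hTm
      (k := fun x y γ => X.symbolCoeff x y γ - δ x y γ) (fun x y => ?_) (fun x y α β => ?_)
      (fun t v => ?_) ψ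
    · exact Summable.of_nonneg_of_le (fun _ => norm_nonneg _) (fun γ => norm_sub_le _ _)
        ((hs x y).add (hδn x y))
    · rw [X.entry_orbEquiv, hδ]
      congr 2
      refine if_congr ?_ rfl rfl
      rw [X.orbEquiv.injective.eq_iff, Prod.mk.injEq, sub_eq_zero]
    · obtain ⟨x, hx, rfl⟩ := X.exists_mem_reciprocalCell t
      refine (le_symbol_of_le_eigenvalues hs hb (h _ hx) v).trans (le_of_eq ?_)
      refine Finset.sum_congr rfl fun p _ => ?_
      congr 2
      have h1 : ∀ q, (∑' γ, (X.symbolCoeff p q γ - δ p q γ) • UnitAddTorus.mFourier γ :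
          C(UnitAddTorus (Fin d), ℂ)) = X.symbol p q - δ p q 0 • UnitAddTorus.mFourier 0 := by
        intro q
        have h2 : ∀ γ, (X.symbolCoeff p q γ - δ p q γ) • UnitAddTorus.mFourier (d := Fin d) γ =
            X.symbolCoeff p q γ • UnitAddTorus.mFourier γ - δ p q γ • UnitAddTorus.mFourier γ :=
          fun γ => sub_smul _ _ (UnitAddTorus.mFourier (d := Fin d) γ)
        rw [tsum_congr h2, (summable_smul_mFourier (hs p q)).tsum_sub (hδs p q).summable, (hδs p q).tsum_eq]
        rfl
      simp_rw [h1]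
      simp only [ContinuousMap.sub_apply, ContinuousMap.smul_apply, UnitAddTorus.mFourier_zero,
        ContinuousMap.one_apply, smul_eq_mul, mul_one, sub_mul, Finset.sum_sub_distrib, hδ,
        and_true, mul_ite, mul_zero, ite_mul, zero_mul, Finset.sum_ite_eq, Finset.mem_univ, if_true]
  have h2 : T ψ = X.hamiltonian 0 ψ - (E : ℂ) • ψ := rfl
  rwa [← h2]

/-- A Fermi level has positive distance to all the bands. -/
theorem exists_pos_le_eigenvalues_sub (hs : ∀ x y, Summable fun γ => ‖X.symbolCoeff x y γ‖) {E : ℝ}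
    (h : ∀ ξ ∈ X.reciprocalCell, ∀ i, (X.bloch_isHermitian ξ).eigenvalues i ≠ E) :
    ∃ b : ℝ, 0 < b ∧
      ∀ ξ ∈ X.reciprocalCell, ∀ i, b ≤ |(X.bloch_isHermitian ξ).eigenvalues i - E| := by
  -- Continuity of the individual bands is avoided: ‖(symbol − E)v‖² is minimised over the compact
  -- product of the torus with the unit sphere. The minimum is positive because E is never an
  -- eigenvalue, and at a unit eigenvector the value is (λ − E)².
  set f : UnitAddTorus (Fin d) × EuclideanSpace ℂ (Fin M × Fin Nb) → ℝ := fun w =>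
    ∑ p, ‖∑ q, X.symbol p q w.1 * w.2 q - E * w.2 p‖ ^ 2 with hf
  have hfc : Continuous f := by
    simp only [hf]
    fun_prop
  rcases isEmpty_or_nonempty (Fin M × Fin Nb) with hJ | ⟨⟨i₀⟩⟩
  · exact ⟨1, one_pos, fun ξ _ i => (IsEmpty.false i).elim⟩
  have hK : IsCompact ((Set.univ : Set (UnitAddTorus (Fin d))) ×ˢ
      Metric.sphere (0 : EuclideanSpace ℂ (Fin M × Fin Nb)) 1) :=
    isCompact_univ.prod (isCompact_sphere _ _)
  obtain ⟨⟨t₀, v₀⟩, ⟨-, hv₀⟩, hmin⟩ := hK.exists_isMinOn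
    ⟨(0, EuclideanSpace.single i₀ 1), Set.mem_univ _, by simp⟩ hfc.continuousOn
  have hnorm : ∀ v : EuclideanSpace ℂ (Fin M × Fin Nb), v ∈ Metric.sphere 0 1 →
      ∑ p, ‖v p‖ ^ 2 = 1 := by
    intro v hv
    have : ‖v‖ = 1 := by simpa using hv
    rw [← EuclideanSpace.norm_sq_eq, this, one_pow]
  have hpos : 0 < f (t₀, v₀) := by
    obtain ⟨x, hx, rfl⟩ := X.exists_mem_reciprocalCell t₀
    obtain ⟨i₁, -, hi₁⟩ := Finset.exists_min_image Finset.univ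
      (fun i => |(X.bloch_isHermitian (X.wave x)).eigenvalues i - E|) ⟨i₀, Finset.mem_univ _⟩
    have h1 : 0 < |(X.bloch_isHermitian (X.wave x)).eigenvalues i₁ - E| :=
      abs_pos.2 (sub_ne_zero.2 (h _ hx i₁))
    have h2 := le_symbol_of_le_eigenvalues hs h1.le (fun i => hi₁ i (Finset.mem_univ i)) v₀
    rw [hnorm v₀ hv₀, mul_one] at h2
    exact lt_of_lt_of_le (by positivity) h2
  refine ⟨Real.sqrt (f (t₀, v₀)), Real.sqrt_pos.2 hpos, fun ξ hξ i => ?_⟩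
  obtain ⟨x, -, hx⟩ := hξ
  obtain rfl : ξ = X.wave x := hx
  set B := (X.bloch_isHermitian (X.wave x)).eigenvectorBasis i with hB
  set lam := (X.bloch_isHermitian (X.wave x)).eigenvalues i with hlam
  have hB1 : B ∈ Metric.sphere (0 : EuclideanSpace ℂ (Fin M × Fin Nb)) 1 := by
    rw [mem_sphere_zero_iff_norm]
    exact (X.bloch_isHermitian (X.wave x)).eigenvectorBasis.norm_eq_one i
  set w : EuclideanSpace ℂ (Fin M × Fin Nb) :=
    WithLp.toLp 2 fun p => (X.phase x p)⁻¹ * B p with hw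
  have hne : ∀ p, X.phase x p ≠ 0 := fun p => by
    rw [← norm_ne_zero_iff, norm_phase]; exact one_ne_zero
  have hwB : ∀ p, X.phase x p * w p = B p := fun p => by
    rw [hw]; exact mul_inv_cancel_left₀ (hne p) _
  have hw1 : w ∈ Metric.sphere (0 : EuclideanSpace ℂ (Fin M × Fin Nb)) 1 := by
    have h1 : ‖w‖ ^ 2 = 1 := by
      rw [EuclideanSpace.norm_sq_eq, ← hnorm B hB1]
      refine Finset.sum_congr rfl fun p _ => ?_
      rw [← hwB p, norm_mul _ (w p), norm_phase, one_mul]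
    have h2 : ‖w‖ = 1 := by
      rw [← Real.sqrt_sq (norm_nonneg w), h1, Real.sqrt_one]
    simpa using h2
  refine Real.sqrt_le_iff.2 ⟨abs_nonneg _, ?_⟩
  have h3 : f (t₀, v₀) ≤ f (fun n => ((-x n : ℝ) : UnitAddCircle), w) :=
    hmin (Set.mk_mem_prod (Set.mem_univ _) hw1)
  refine h3.trans (le_of_eq ?_)
  simp only [hf]
  rw [sum_normSq_symbol hs]
  have h4 : (X.bloch (X.wave x)).mulVec B = lam • (B : Fin M × Fin Nb → ℂ) :=
    (X.bloch_isHermitian (X.wave x)).mulVec_eigenvectorBasis i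
  have h5 : (fun q => X.phase x q * w q) = B := funext hwB
  rw [h5, h4]
  simp only [hwB, Pi.smul_apply, Complex.real_smul, ← sub_mul, norm_mul, mul_pow]
  rw [← Finset.mul_sum, hnorm B hB1, mul_one, ← Complex.ofReal_sub, Complex.norm_real,
    Real.norm_eq_abs, hlam]

/-- `eigenvalues₀` is decreasing and the n-th band has index card − n. An index is either at least
card − N₀, hence not above band N₀, or at most card − (N₀ + 1), hence not below band N₀ + 1. -/
theorem eigenvalues_le_band_or (X : TBModel d M Nb S) {N₀ : ℕ} (h1 : 1 ≤ N₀) (h2 : N₀ < M * Nb)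
    (ξ : EuclideanSpace ℝ (Fin d)) (i : Fin M × Fin Nb) :
    (X.bloch_isHermitian ξ).eigenvalues i ≤ X.band N₀ ξ ∨
      X.band (N₀ + 1) ξ ≤ (X.bloch_isHermitian ξ).eigenvalues i := by
  have hcard : Fintype.card (Fin M × Fin Nb) = M * Nb := by simp
  rw [band, band, dif_pos ⟨h1, by omega⟩, dif_pos ⟨by omega, by omega⟩, Matrix.IsHermitian.eigenvalues]
  set j := (Fintype.equivOfCardEq (Fintype.card_fin _)).symm i
  rcases le_or_gt (Fintype.card (Fin M × Fin Nb) - N₀) j.1 with h | h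
  · exact Or.inl ((X.bloch_isHermitian ξ).eigenvalues₀_antitone (by exact h))
  · refine Or.inr ((X.bloch_isHermitian ξ).eigenvalues₀_antitone ?_)
    show j.1 ≤ _
    simp only
    omega

theorem exists_eigenvalues_eq_band (X : TBModel d M Nb S) {n : ℕ} (h1 : 1 ≤ n) (h2 : n ≤ M * Nb)
    (ξ : EuclideanSpace ℝ (Fin d)) :
    ∃ i, X.band n ξ = (X.bloch_isHermitian ξ).eigenvalues i := by
  have hcard : Fintype.card (Fin M × Fin Nb) = M * Nb := by simp
  rw [band, dif_pos ⟨h1, by omega⟩]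
  refine ⟨Fintype.equivOfCardEq (Fintype.card_fin _) ⟨Fintype.card (Fin M × Fin Nb) - n, by omega⟩,
    ?_⟩
  rw [Matrix.IsHermitian.eigenvalues, Equiv.symm_apply_apply]

/-- The reference crystal: the gap is positive, the reference Hamiltonian is bounded below by half
the gap at its centre, and all the quantities are bounded. -/
theorem reference_gap (hh₀ : 0 < h₀) (hC0 : 0 < C) (hX : X.IsTB h₀ γ₀)
    (hC : X.ExpSumBound 0 γ₀ C)
    (hH : HasMatrix (X.hamiltonian 0) fun x y => (X.entry 0 x y : ℂ)) {N₀ : ℕ} {εF : ℝ}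
    (hF : X.IsFermiLevel N₀ εF) :
    0 < X.gapMinus N₀ ∧ X.gapMinus N₀ ≤ 2 * (Nb * (2 * h₀ * C)) ∧
      |X.midGap N₀| ≤ Nb * (2 * h₀ * C) ∧
      ∀ ψ : EllTwo X.Orb, X.gapMinus N₀ / 2 * ‖ψ‖ ≤
        ‖X.hamiltonian 0 ψ - (X.midGap N₀ : ℂ) • ψ‖ := by
  obtain ⟨hN1, hN2, -, hband⟩ := hF
  have hs := fun x y => (summable_symbolCoeff hh₀ hC0 hX hC y).1 x
  have hne : ∀ ξ ∈ X.reciprocalCell, ∀ i, (X.bloch_isHermitian ξ).eigenvalues i ≠ εF := by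
    intro ξ hξ i heq
    obtain ⟨h3, h4⟩ := hband ξ hξ
    rcases X.eigenvalues_le_band_or hN1 hN2 ξ i with h | h <;> linarith
  -- The strict inequalities at each ξ of the half-open cell would not by themselves prevent the
  -- supremum and the infimum from meeting; compactness of the torus supplies a uniform margin b on
  -- both sides of the Fermi level.
  obtain ⟨b, hb0, hb⟩ := exists_pos_le_eigenvalues_sub hs hne
  have hv : ∀ ξ ∈ X.reciprocalCell, X.band N₀ ξ ≤ εF - b := by
    intro ξ hξ
    obtain ⟨i, hi⟩ := X.exists_eigenvalues_eq_band hN1 hN2.le ξ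
    have h5 := hb ξ hξ i
    rw [← hi, abs_of_neg (by linarith [(hband ξ hξ).1])] at h5
    linarith
  have hc : ∀ ξ ∈ X.reciprocalCell, εF + b ≤ X.band (N₀ + 1) ξ := by
    intro ξ hξ
    obtain ⟨i, hi⟩ := X.exists_eigenvalues_eq_band (by omega : 1 ≤ N₀ + 1) (by omega) ξ
    have h5 := hb ξ hξ i
    rw [← hi, abs_of_pos (by linarith [(hband ξ hξ).2])] at h5
    linarith
  have hcell : X.wave 0 ∈ X.reciprocalCell := ⟨0, fun n => by norm_num, rfl⟩
  have hva : BddAbove (X.band N₀ '' X.reciprocalCell) :=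
    ⟨εF - b, by rintro _ ⟨ξ, hξ, rfl⟩; exact hv ξ hξ⟩
  have hcb : BddBelow (X.band (N₀ + 1) '' X.reciprocalCell) :=
    ⟨εF + b, by rintro _ ⟨ξ, hξ, rfl⟩; exact hc ξ hξ⟩
  have hv2 : X.valenceTop N₀ ≤ εF - b :=
    csSup_le ⟨_, _, hcell, rfl⟩ (by rintro _ ⟨ξ, hξ, rfl⟩; exact hv ξ hξ)
  have hc2 : εF + b ≤ X.conductionBottom N₀ :=
    le_csInf ⟨_, _, hcell, rfl⟩ (by rintro _ ⟨ξ, hξ, rfl⟩; exact hc ξ hξ)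
  have hv3 : ∀ ξ ∈ X.reciprocalCell, X.band N₀ ξ ≤ X.valenceTop N₀ := fun ξ hξ =>
    le_csSup hva ⟨ξ, hξ, rfl⟩
  have hc3 : ∀ ξ ∈ X.reciprocalCell, X.conductionBottom N₀ ≤ X.band (N₀ + 1) ξ := fun ξ hξ =>
    csInf_le hcb ⟨ξ, hξ, rfl⟩
  have hbd := abs_eigenvalues_bloch_le hh₀ hC0 hX hC (X.wave 0)
  obtain ⟨i, hi⟩ := X.exists_eigenvalues_eq_band hN1 hN2.le (X.wave 0)
  obtain ⟨j, hj⟩ := X.exists_eigenvalues_eq_band (by omega : 1 ≤ N₀ + 1) (by omega) (X.wave 0)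
  have h6 := abs_le.1 (hbd i)
  have h7 := abs_le.1 (hbd j)
  rw [← hi] at h6
  rw [← hj] at h7
  have h8 := hv3 _ hcell
  have h9 := hc3 _ hcell
  refine ⟨by rw [gapMinus]; linarith, by rw [gapMinus]; linarith, ?_, fun ψ => ?_⟩
  · rw [midGap, abs_le]; constructor <;> linarith
  · refine le_norm_hamiltonian_sub hH hs (by rw [gapMinus]; linarith) (fun ξ hξ i => ?_) ψ
    have h10 := hv3 ξ hξ
    have h11 := hc3 ξ hξ
    rw [gapMinus, midGap, le_abs]
    rcases X.eigenvalues_le_band_or hN1 hN2 ξ i with h | h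
    · right; linarith
    · left; linarith

end Bloch

end TBModel

/-! ### Displacements of finite energy -/

namespace Multilattice

variable {d M : ℕ} {L : Multilattice d M} {Υ : ℝ} {u : L.Site → EuclideanSpace ℝ (Fin d)}

theorem sum_strain_le (hu : L.strainSq Υ u < ⊤) (s : Finset (L.Site × L.Site)) :
    ∑ p ∈ s, Real.exp (-2 * Υ * ‖L.pos p.2 - L.pos p.1‖) * ‖u p.2 - u p.1‖ ^ 2 ≤
      L.strainNorm Υ u ^ 2 := by
  rw [strainNorm, Real.sq_sqrt ENNReal.toReal_nonneg, ← ENNReal.ofReal_le_iff_le_toReal hu.ne,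
    ENNReal.ofReal_sum_of_nonneg fun p _ => by positivity]
  rw [strainSq, ← ENNReal.tsum_prod (f := fun ℓ k : L.Site =>
    ENNReal.ofReal (Real.exp (-2 * Υ * ‖L.pos k - L.pos ℓ‖) * ‖u k - u ℓ‖ ^ 2))]
  exact ENNReal.sum_le_tsum s

theorem norm_sub_le_strainNorm (hu : L.strainSq Υ u < ⊤) (x y : L.Site) :
    ‖u x - u y‖ ≤ L.strainNorm Υ u * Real.exp (Υ * L.refDist x y) := by
  have h := sum_strain_le hu {(y, x)}
  rw [Finset.sum_singleton] at h
  have hD : 0 ≤ L.strainNorm Υ u := Real.sqrt_nonneg _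
  have h2 : Real.exp (-2 * Υ * ‖L.pos x - L.pos y‖) = (Real.exp (Υ * L.refDist x y))⁻¹ ^ 2 := by
    rw [← Real.exp_neg, ← Real.exp_nat_mul, refDist]
    congr 1; push_cast; ring
  rw [h2, ← mul_pow] at h
  have h3 := abs_le_of_sq_le_sq h hD
  rw [inv_mul_eq_div, abs_of_nonneg (by positivity), div_le_iff₀ (Real.exp_pos _)] at h3
  exact h3

/-- Sites that have a strongly strained bond of length at most `r`. -/
def strained (L : Multilattice d M) (u : L.Site → EuclideanSpace ℝ (Fin d)) (r ω : ℝ) :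
    Set L.Site :=
  {y | ∃ x, L.refDist x y ≤ r ∧ ω < ‖u x - u y‖}

theorem finite_strained (hΥ : 0 < Υ) (hu : L.strainSq Υ u < ⊤) {r ω : ℝ} (hω : 0 < ω) :
    (L.strained u r ω).Finite ∧
      ((L.strained u r ω).ncard : ℝ) ≤ L.strainNorm Υ u ^ 2 * Real.exp (2 * Υ * r) / ω ^ 2 := by
  -- One partner is chosen for each strained site. The resulting ordered pairs are distinct, and
  -- each contributes at least e^{-2Υr} ω² to ‖Du‖².
  have key : ∀ t : Finset L.Site, (t : Set L.Site) ⊆ L.strained u r ω →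
      (t.card : ℝ) ≤ L.strainNorm Υ u ^ 2 * Real.exp (2 * Υ * r) / ω ^ 2 := by
    intro t ht
    have hex : ∀ y ∈ t, ∃ x, L.refDist x y ≤ r ∧ ω < ‖u x - u y‖ := fun y hy => ht hy
    choose! f hf using hex
    have hinj : Set.InjOn (fun y : L.Site => (y, f y)) t := fun a _ b _ h =>
      congrArg Prod.fst h
    have h1 := sum_strain_le hu (t.image fun y => (y, f y))
    rw [Finset.sum_image hinj] at h1
    have h2 : ∑ y ∈ t, Real.exp (-2 * Υ * r) * ω ^ 2 ≤ L.strainNorm Υ u ^ 2 := by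
      refine le_trans (Finset.sum_le_sum fun y hy => ?_) h1
      obtain ⟨h3, h4⟩ := hf y hy
      refine mul_le_mul (Real.exp_le_exp.2 ?_) (pow_le_pow_left₀ hω.le h4.le 2) (by positivity)
        (by positivity)
      rw [refDist] at h3
      nlinarith
    rw [Finset.sum_const, nsmul_eq_mul] at h2
    rw [le_div_iff₀ (by positivity)]
    have h5 : Real.exp (-2 * Υ * r) * Real.exp (2 * Υ * r) = 1 := by
      rw [← Real.exp_add, neg_mul, neg_mul, neg_add_cancel, Real.exp_zero]
    calc (t.card : ℝ) * ω ^ 2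
        = t.card * (Real.exp (-2 * Υ * r) * ω ^ 2) * Real.exp (2 * Υ * r) := by
          linear_combination -(t.card : ℝ) * ω ^ 2 * h5
      _ ≤ _ := mul_le_mul_of_nonneg_right h2 (Real.exp_nonneg _)
  have hfin : (L.strained u r ω).Finite := by
    by_contra hinf
    obtain ⟨n, hn⟩ := exists_nat_gt (L.strainNorm Υ u ^ 2 * Real.exp (2 * Υ * r) / ω ^ 2)
    obtain ⟨t, ht1, ht2⟩ := Set.Infinite.exists_subset_card_eq hinf n
    have := key t ht1
    rw [ht2] at this
    linarith
  refine ⟨hfin, ?_⟩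
  rw [Set.ncard_eq_toFinset_card _ hfin]
  exact key _ (by simp)

theorem pos_sub_pos (L : Multilattice d M) (i j : Fin M) (α β : Fin d → ℤ) :
    L.pos (i, α) - L.pos (j, β) = L.p i - L.p j + L.vec (α - β) := by
  rw [pos, pos, sub_eq_add_neg α, L.vec_add, L.vec_neg]; abel

theorem refDist_translate (L : Multilattice d M) (i j : Fin M) (α β γ : Fin d → ℤ) :
    L.refDist (i, α + γ) (j, β + γ) = L.refDist (i, α) (j, β) := by
  rw [refDist, refDist, pos_sub_pos, pos_sub_pos, add_sub_add_right_eq_sub]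

theorem bond_zero (L : Multilattice d M) (x y : L.Site) : L.bond 0 x y = L.pos x - L.pos y := by
  simp [bond]

theorem bond_eq (L : Multilattice d M) (u : L.Site → EuclideanSpace ℝ (Fin d)) (x y : L.Site) :
    L.bond u x y = (L.pos x - L.pos y) + (u x - u y) := by
  rw [bond]; abel

/-- The reference configuration inherits the separation of an admissible configuration. -/
theorem separated_zero (hΥ : 0 < Υ) (hu : L.strainSq Υ u < ⊤) {m : ℝ} (hs : L.Separated m u) :
    L.Separated m 0 := by
  intro x y hxy
  rw [bond_zero]
  by_contra! hlt
  rcases isEmpty_or_nonempty (Fin d) with hd | ⟨⟨n⟩⟩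
  · exact hxy (L.pos_injective (Subsingleton.elim _ _))
  -- A reference pair closer than m has infinitely many lattice translates. To be m-separated after
  -- deformation, each of them must be strained by more than half of the deficit, contrary to
  -- `finite_strained`.
  let f : ℕ → L.Site := fun k => (x.1, x.2 + Pi.single n (k : ℤ))
  let g : ℕ → L.Site := fun k => (y.1, y.2 + Pi.single n (k : ℤ))
  have hginj : Function.Injective g := by
    intro a b hab
    have h1 : y.2 + Pi.single n (a : ℤ) = y.2 + Pi.single n (b : ℤ) := congrArg Prod.snd hab
    have h2 := congrFun (add_left_cancel h1) n
    simpa using h2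
  have hdist : ∀ k, L.refDist (f k) (g k) = L.refDist x y := fun k =>
    L.refDist_translate x.1 y.1 x.2 y.2 (Pi.single n (k : ℤ))
  have hne : ∀ k, f k ≠ g k := by
    intro k h
    have h1 := congrArg (fun p : L.Site => p.1) h
    have h2 := congrArg (fun p : L.Site => p.2) h
    exact hxy (Prod.ext h1 (add_right_cancel h2))
  have hω0 : 0 < (m - ‖L.pos x - L.pos y‖) / 2 := by linarith
  refine Set.infinite_range_of_injective hginj
    ((finite_strained hΥ hu (r := L.refDist x y) hω0).1.subset ?_)
  rintro _ ⟨k, rfl⟩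
  refine ⟨f k, (hdist k).le, ?_⟩
  have h1 := hs _ _ (hne k)
  rw [bond_eq] at h1
  have h2 := norm_add_le (L.pos (f k) - L.pos (g k)) (u (f k) - u (g k))
  have h3 : ‖L.pos (f k) - L.pos (g k)‖ = ‖L.pos x - L.pos y‖ := hdist k
  rw [h3] at h2
  linarith

/-- Each increment v along a lattice line satisfies v ≤ ε + v²/(4ε). The first terms add up to
growth with arbitrarily small slope, and the squares add up to at most ‖Du‖² times the inverse
weight of one step. -/
theorem norm_sub_le_line (hu : L.strainSq Υ u < ⊤) {ε : ℝ} (hε : 0 < ε)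
    (i : Fin M) (α : Fin d → ℤ) (n : Fin d) (N : ℕ) :
    ‖u (i, α + Pi.single n (N : ℤ)) - u (i, α)‖ ≤ ε * N +
      Real.exp (2 * Υ * ‖L.vec (Pi.single n 1)‖) / (4 * ε) * L.strainNorm Υ u ^ 2 := by
  set g : ℕ → L.Site := fun k => (i, α + Pi.single n (k : ℤ)) with hg
  have hginj : Function.Injective g := by
    intro a b hab
    have h1 := congrFun (add_left_cancel (Prod.mk.inj hab).2) n
    simpa using h1
  set a := ‖L.vec (Pi.single n 1)‖
  have hstep : ∀ k, L.pos (g (k + 1)) - L.pos (g k) = L.vec (Pi.single n 1) := by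
    intro k
    rw [hg, pos_sub_pos, sub_self, zero_add, add_sub_add_left_eq_sub, ← Pi.single_sub]
    simp
  have h0 : g 0 = (i, α) := by simp [hg]
  have h1 : ‖u (g N) - u (g 0)‖ ≤ ∑ k ∈ Finset.range N, ‖u (g (k + 1)) - u (g k)‖ := by
    rw [← Finset.sum_range_sub (fun k => u (g k))]
    exact norm_sum_le _ _
  have h2 : ∀ v : ℝ, v ≤ ε + 1 / (4 * ε) * v ^ 2 := by
    intro v
    have : ε + 1 / (4 * ε) * v ^ 2 - v = (2 * ε - v) ^ 2 / (4 * ε) := by field_simp; ring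
    have h3 : 0 ≤ (2 * ε - v) ^ 2 / (4 * ε) := by positivity
    linarith
  have hinj : Set.InjOn (fun k => (g k, g (k + 1))) (Finset.range N) := fun a _ b _ h =>
    hginj (Prod.mk.inj h).1
  have h3 := sum_strain_le hu ((Finset.range N).image fun k => (g k, g (k + 1)))
  rw [Finset.sum_image hinj] at h3
  simp only [hstep] at h3
  rw [← Finset.mul_sum] at h3
  have h4 : ∑ k ∈ Finset.range N, ‖u (g (k + 1)) - u (g k)‖ ^ 2 ≤
      Real.exp (2 * Υ * a) * L.strainNorm Υ u ^ 2 := by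
    have h5 : Real.exp (2 * Υ * a) * Real.exp (-2 * Υ * a) = 1 := by
      rw [← Real.exp_add, neg_mul, neg_mul, add_neg_cancel, Real.exp_zero]
    have h6 := mul_le_mul_of_nonneg_left h3 (Real.exp_nonneg (2 * Υ * a))
    rwa [← mul_assoc, h5, one_mul] at h6
  rw [h0] at h1
  refine h1.trans ((Finset.sum_le_sum fun k _ => h2 _).trans ?_)
  rw [Finset.sum_add_distrib, Finset.sum_const, Finset.card_range, nsmul_eq_mul, ← Finset.mul_sum,
    mul_comm (N : ℝ)]
  refine add_le_add_right ?_ _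
  calc _ ≤ 1 / (4 * ε) * (Real.exp (2 * Υ * a) * L.strainNorm Υ u ^ 2) :=
        mul_le_mul_of_nonneg_left h4 (by positivity)
    _ = _ := by ring

theorem norm_sub_le_update (hu : L.strainSq Υ u < ⊤) {ε : ℝ} (hε : 0 < ε)
    (i : Fin M) (α : Fin d → ℤ) (n : Fin d) (z : ℤ) :
    ‖u (i, Function.update α n z) - u (i, α)‖ ≤ ε * |((z - α n : ℤ) : ℝ)| +
      Real.exp (2 * Υ * ‖L.vec (Pi.single n 1)‖) / (4 * ε) * L.strainNorm Υ u ^ 2 := by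
  rcases le_total (α n) z with h | h
  · obtain ⟨N, hN⟩ := Int.eq_ofNat_of_zero_le (sub_nonneg.2 h)
    have h1 : Function.update α n z = α + Pi.single n (N : ℤ) := by
      funext j
      by_cases hj : j = n
      · subst hj; simp only [Function.update_self, Pi.add_apply, Pi.single_eq_same]; omega
      · simp [hj]
    rw [h1, hN]
    simpa using norm_sub_le_line hu hε i α n N
  · obtain ⟨N, hN⟩ := Int.eq_ofNat_of_zero_le (sub_nonneg.2 h)
    have h1 : α = Function.update α n z + Pi.single n (N : ℤ) := by
      funext j
      by_cases hj : j = n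
      · subst hj; simp only [Function.update_self, Pi.add_apply, Pi.single_eq_same]; omega
      · simp [hj]
    have h2 : |((z - α n : ℤ) : ℝ)| = N := by
      have : z - α n = -(N : ℤ) := by omega
      rw [this]; simp
    have h3 := norm_sub_le_line hu hε i (Function.update α n z) n N
    rw [← h1, norm_sub_rev] at h3
    rwa [h2]

theorem norm_sub_le_coord (hu : L.strainSq Υ u < ⊤) {ε K : ℝ} (hε : 0 < ε)
    (hK : ∀ n : Fin d, Real.exp (2 * Υ * ‖L.vec (Pi.single n 1)‖) / (4 * ε) ≤ K)
    (i : Fin M) (s : Finset (Fin d)) : ∀ α β : Fin d → ℤ, (∀ n ∉ s, α n = β n) →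
      ‖u (i, α) - u (i, β)‖ ≤ ε * ∑ n ∈ s, |((α n - β n : ℤ) : ℝ)| +
        s.card * (K * L.strainNorm Υ u ^ 2) := by
  induction s using Finset.induction_on with
  | empty =>
    intro α β h
    have : α = β := funext fun n => h n (Finset.notMem_empty n)
    simp [this]
  | insert n s hn ih =>
    intro α β h
    set γ := Function.update β n (α n) with hγ
    have h1 := ih α γ (fun j hj => by
      by_cases hjn : j = n
      · subst hjn; simp [hγ]
      · rw [hγ, Function.update_of_ne hjn]
        exact h j (by simp [hjn, hj]))
    have h2 := norm_sub_le_update hu hε i β n (α n)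
    have h3 : ∑ j ∈ s, |((α j - γ j : ℤ) : ℝ)| = ∑ j ∈ s, |((α j - β j : ℤ) : ℝ)| := by
      refine Finset.sum_congr rfl fun j hj => ?_
      rw [hγ, Function.update_of_ne (by rintro rfl; exact hn hj)]
    have h4 := norm_sub_le_norm_sub_add_norm_sub (u (i, α)) (u (i, γ)) (u (i, β))
    have h5 := mul_le_mul_of_nonneg_right (hK n) (sq_nonneg (L.strainNorm Υ u))
    rw [h3] at h1
    rw [Finset.sum_insert hn, Finset.card_insert_of_notMem hn]
    push_cast at *
    linarith

theorem exists_sum_abs_le_norm_vec (L : Multilattice d M) :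
    ∃ K : ℝ, 0 ≤ K ∧ ∀ α : Fin d → ℤ, ∑ n, |(α n : ℝ)| ≤ K * ‖L.vec α‖ := by
  refine ⟨∑ n, ∑ j, |L.A⁻¹ n j|, by positivity, fun α => ?_⟩
  have h1 : ∀ n, (α n : ℝ) = ∑ j, L.A⁻¹ n j * L.vec α j := by
    intro n
    have h2 : (L.A⁻¹).mulVec (L.A.mulVec fun n => (α n : ℝ)) = fun n => (α n : ℝ) := by
      rw [Matrix.mulVec_mulVec, Matrix.nonsing_inv_mul _ (isUnit_iff_ne_zero.2 L.det_ne_zero),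
        Matrix.one_mulVec]
    exact (congrFun h2 n).symm
  rw [Finset.sum_mul]
  refine Finset.sum_le_sum fun n _ => ?_
  rw [h1, Finset.sum_mul]
  refine (Finset.abs_sum_le_sum_abs _ _).trans (Finset.sum_le_sum fun j _ => ?_)
  rw [abs_mul]
  exact mul_le_mul_of_nonneg_left (PiLp.norm_apply_le (L.vec α) j) (abs_nonneg _)

theorem exists_norm_p_sub_le (L : Multilattice d M) :
    ∃ P : ℝ, 0 ≤ P ∧ ∀ i j, ‖L.p i - L.p j‖ ≤ P := by
  obtain ⟨P, hP⟩ := (Set.finite_range fun q : Fin M × Fin M => ‖L.p q.1 - L.p q.2‖).bddAbove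
  exact ⟨max P 0, le_max_right _ _, fun i j =>
    (hP (Set.mem_range_self (i, j))).trans (le_max_left _ _)⟩

theorem exists_exp_norm_vec_le (L : Multilattice d M) (Υ ε : ℝ) :
    ∃ K : ℝ, 0 ≤ K ∧ ∀ n : Fin d, Real.exp (2 * Υ * ‖L.vec (Pi.single n 1)‖) / (4 * ε) ≤ K := by
  obtain ⟨K, hK⟩ := (Set.finite_range fun n : Fin d =>
    Real.exp (2 * Υ * ‖L.vec (Pi.single n 1)‖) / (4 * ε)).bddAbove
  exact ⟨max K 0, le_max_right _ _, fun n => (hK (Set.mem_range_self n)).trans (le_max_left _ _)⟩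

/-- Displacements of finite energy grow sublinearly. -/
theorem exists_norm_sub_le (L : Multilattice d M) (Υ : ℝ) (hΥ : 0 < Υ) :
    ∃ K : ℝ, 0 ≤ K ∧ ∀ u : L.Site → EuclideanSpace ℝ (Fin d), L.strainSq Υ u < ⊤ →
      ∀ x y, ‖u x - u y‖ ≤ L.refDist x y / 2 + 1 / 2 +
        K * (L.strainNorm Υ u + L.strainNorm Υ u ^ 2) := by
  obtain ⟨K₁, hK₁, hK₁'⟩ := L.exists_sum_abs_le_norm_vec
  obtain ⟨P, hP0, hPle⟩ := L.exists_norm_p_sub_le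
  -- This choice makes ε K₁ (r + P) ≤ r/2 + 1/2. The path from x to y follows lattice lines inside
  -- one sublattice, at a cost proportional to D², and then changes the sublattice by a single bond,
  -- at a cost proportional to D = ‖Du‖.
  obtain ⟨ε, hε⟩ : ∃ ε : ℝ, ε = 1 / (2 * (K₁ + 1) * (P + 1)) := ⟨_, rfl⟩
  have hε0 : 0 < ε := by rw [hε]; positivity
  obtain ⟨K₂, hK₂0, hK₂⟩ := L.exists_exp_norm_vec_le Υ ε
  refine ⟨d * K₂ + Real.exp (Υ * P), by positivity, ?_⟩
  rintro u hu ⟨i, α⟩ ⟨j, β⟩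
  have hD : 0 ≤ L.strainNorm Υ u := Real.sqrt_nonneg _
  have h1 := norm_sub_le_coord hu hε0 hK₂ i Finset.univ α β (fun n hn =>
    absurd (Finset.mem_univ n) hn)
  have h2 := norm_sub_le_strainNorm hu (i, β) (j, β)
  have h3 : L.refDist (i, β) (j, β) ≤ P := by
    have h0 : L.vec (0 : Fin d → ℤ) = 0 := by simpa using L.vec_add 0 0
    rw [refDist, pos_sub_pos, sub_self, h0, add_zero]
    exact hPle i j
  have h4 : Real.exp (Υ * L.refDist (i, β) (j, β)) ≤ Real.exp (Υ * P) :=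
    Real.exp_le_exp.2 (mul_le_mul_of_nonneg_left h3 hΥ.le)
  have h5 : ∑ n, |((α n - β n : ℤ) : ℝ)| ≤ K₁ * ‖L.vec (α - β)‖ := hK₁' (α - β)
  have h6 : ‖L.vec (α - β)‖ ≤ L.refDist (i, α) (j, β) + P := by
    have h7 : L.vec (α - β) = (L.pos (i, α) - L.pos (j, β)) - (L.p i - L.p j) := by
      rw [pos_sub_pos]; abel
    rw [h7]
    exact (norm_sub_le _ _).trans (add_le_add_right (hPle i j) _)
  have hr : 0 ≤ L.refDist (i, α) (j, β) := norm_nonneg _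
  have h8 : ε * ∑ n, |((α n - β n : ℤ) : ℝ)| ≤ L.refDist (i, α) (j, β) / 2 + 1 / 2 := by
    have h9 := h5.trans (mul_le_mul_of_nonneg_left h6 hK₁)
    refine (mul_le_mul_of_nonneg_left h9 hε0.le).trans ?_
    rw [hε, one_div, inv_mul_eq_div, div_le_iff₀ (by positivity)]
    generalize L.refDist (i, α) (j, β) = r at hr
    nlinarith [mul_nonneg hK₁ hr, mul_nonneg hK₁ hP0, mul_nonneg hr hP0,
      mul_nonneg (mul_nonneg hK₁ hr) hP0]
  have h10 := norm_sub_le_norm_sub_add_norm_sub (u (i, α)) (u (i, β)) (u (j, β))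
  have h11 := mul_le_mul_of_nonneg_left h4 hD
  simp only [Finset.card_univ, Fintype.card_fin] at h1
  have h12 : 0 ≤ (d : ℝ) * K₂ * L.strainNorm Υ u := by positivity
  have h13 : 0 ≤ Real.exp (Υ * P) * L.strainNorm Υ u ^ 2 := by positivity
  linarith

end Multilattice

/-! ### The derivative of the Hamiltonian with respect to one atom -/

theorem hasDerivAt_comp_line {E : Type*} [NormedAddCommGroup E] [InnerProductSpace ℝ E]
    [CompleteSpace E] {f : E → ℝ} (hf : ContDiff ℝ 1 f) (v e : E) (σ s : ℝ) :
    HasDerivAt (fun s : ℝ => f (v + (s * σ) • e))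
      (inner ℝ (gradient f (v + (s * σ) • e)) (σ • e)) s := by
  have h1 : HasDerivAt (fun s : ℝ => v + (s * σ) • e) (σ • e) s := by
    have := (((hasDerivAt_id s).mul_const σ).smul_const e).const_add v
    simpa using this
  have h2 := ((hf.differentiable one_ne_zero) (v + (s * σ) • e)).hasGradientAt.hasFDerivAt
  have h3 := h2.comp_hasDerivAt s h1
  exact h3

theorem abs_inner_gradient_line_le {E : Type*} [NormedAddCommGroup E] [InnerProductSpace ℝ E]
    [CompleteSpace E] {f : E → ℝ} {h₀ γ : ℝ} (hh : 0 ≤ h₀) (hγ : 0 ≤ γ)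
    (hf : ∀ r, |f r| + ‖gradient f r‖ ≤ h₀ * Real.exp (-γ * ‖r‖)) {v e : E} (he : ‖e‖ = 1)
    {σ s : ℝ} (hσ : |σ| ≤ 1) :
    |inner ℝ (gradient f (v + (s * σ) • e)) (σ • e)| ≤
      |σ| * (h₀ * Real.exp (γ * |s|) * Real.exp (-γ * ‖v‖)) := by
  refine (abs_real_inner_le_norm _ _).trans ?_
  rw [norm_smul, he, mul_one, Real.norm_eq_abs, mul_comm]
  refine mul_le_mul_of_nonneg_left ?_ (abs_nonneg _)
  have h1 : ‖v‖ ≤ ‖v + (s * σ) • e‖ + |s| := by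
    have h2 : v = (v + (s * σ) • e) - (s * σ) • e := by abel
    calc ‖v‖ = ‖(v + (s * σ) • e) - (s * σ) • e‖ := by rw [← h2]
      _ ≤ ‖v + (s * σ) • e‖ + ‖(s * σ) • e‖ := norm_sub_le _ _
      _ ≤ _ := by
        rw [norm_smul, he, mul_one, Real.norm_eq_abs, abs_mul]
        have := mul_le_mul_of_nonneg_left hσ (abs_nonneg s)
        linarith
  refine (le_trans (le_add_of_nonneg_left (abs_nonneg _)) (hf _)).trans ?_
  rw [mul_assoc, ← Real.exp_add]
  refine mul_le_mul_of_nonneg_left (Real.exp_le_exp.2 ?_) hh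
  nlinarith

namespace TBModel

variable {d M Nb : ℕ} {S : Type}

open Classical in
/-- The rate at which the bond from `x` to `y` changes when the atom `k` is displaced. -/
noncomputable def shiftSign (X : TBModel d M Nb S) (k x y : X.Site) : ℝ :=
  (if x = k then 1 else 0) - (if y = k then 1 else 0)

theorem abs_shiftSign_le_one (X : TBModel d M Nb S) (k x y : X.Site) : |X.shiftSign k x y| ≤ 1 := by
  rw [shiftSign]; split_ifs <;> simp

theorem shiftSign_self (X : TBModel d M Nb S) (k x : X.Site) : X.shiftSign k x x = 0 := by
  simp [shiftSign]

theorem shiftSign_eq_zero (X : TBModel d M Nb S) {k x y : X.Site} (hx : x ≠ k) (hy : y ≠ k) :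
    X.shiftSign k x y = 0 := by
  simp [shiftSign, hx, hy]

theorem shiftCoord_apply (X : TBModel d M Nb S) (u : X.Site → EuclideanSpace ℝ (Fin d))
    (k : X.Site) (i : Fin d) (s : ℝ) (x : X.Site) : X.shiftCoord u k i s x =
      u x + (s * if x = k then 1 else 0) • EuclideanSpace.single i (1 : ℝ) := by
  rw [shiftCoord]
  by_cases hx : x = k
  · subst hx
    rw [Function.update_self, if_pos rfl, mul_one]
    congr 1
    ext j
    by_cases hj : j = i
    · subst hj; simp
    · simp [hj]
  · simp [hx]

theorem bond_shiftCoord (X : TBModel d M Nb S) (u : X.Site → EuclideanSpace ℝ (Fin d))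
    (k : X.Site) (i : Fin d) (s : ℝ) (x y : X.Site) : X.bond (X.shiftCoord u k i s) x y =
      X.bond u x y + (s * X.shiftSign k x y) • EuclideanSpace.single i (1 : ℝ) := by
  rw [Multilattice.bond, Multilattice.bond, shiftCoord_apply, shiftCoord_apply, shiftSign,
    mul_sub, sub_smul]
  have : ∀ (z : X.Site), (if z = k then (1 : ℝ) else 0) =
      @ite ℝ (z = k) (Classical.propDecidable _) 1 0 := fun z => by congr
  rw [this, this]
  abel

/-- Moving one atom by s changes a bond by at most |s|. Half of the separation survives, which keeps
the Hamiltonian bounded and self-adjoint throughout a neighbourhood of u. -/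
theorem separated_shiftCoord (X : TBModel d M Nb S) {u : X.Site → EuclideanSpace ℝ (Fin d)}
    {m : ℝ} (hu : X.Separated m u) (k : X.Site) (i : Fin d) {s : ℝ} (hs : |s| ≤ m / 2) :
    X.Separated (m / 2) (X.shiftCoord u k i s) := by
  intro x y hxy
  have h1 := hu x y hxy
  rw [bond_shiftCoord]
  set e := (s * X.shiftSign k x y) • (EuclideanSpace.single i (1 : ℝ) : EuclideanSpace ℝ (Fin d))
  have h2 : ‖e‖ ≤ |s| := by
    rw [norm_smul, PiLp.norm_single, norm_one, mul_one, Real.norm_eq_abs, abs_mul]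
    exact mul_le_of_le_one_right (abs_nonneg _) (X.abs_shiftSign_le_one k x y)
  have h3 : X.bond u x y = (X.bond u x y + e) - e := by abel
  have h4 := norm_sub_le (X.bond u x y + e) e
  rw [← h3] at h4
  linarith

/-- Sums over the bonds that move with the atom `k`. -/
theorem summable_shiftSign (X : TBModel d M Nb S) {u : X.Site → EuclideanSpace ℝ (Fin d)}
    {γ C : ℝ} (hC : X.ExpSumBound u γ C) (k : X.Site) :
    Summable (fun p : X.Orb × X.Orb =>
      |X.shiftSign k p.1.1 p.2.1| * Real.exp (-γ * ‖X.bond u p.1.1 p.2.1‖)) ∧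
    ∑' p : X.Orb × X.Orb,
      |X.shiftSign k p.1.1 p.2.1| * Real.exp (-γ * ‖X.bond u p.1.1 p.2.1‖) ≤
        2 * (Nb * (Nb * C)) := by
  obtain ⟨hb, hb'⟩ := summable_prod_fin (n := Nb) (hC k).1 (fun _ => Real.exp_nonneg _)
  obtain ⟨ha, ha'⟩ := summable_prod_fin (n := Nb) (hasSum_ite_eq k (1 : ℝ)).summable
    (fun x => by split_ifs <;> simp)
  rw [tsum_ite_eq, mul_one] at ha'
  -- A moving bond has an end at k, so the double sum is dominated by the row and the column of k,
  -- that is by a ⊗ b + b ⊗ a; this is why it converges.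
  set a : X.Orb → ℝ := fun x => if x.1 = k then 1 else 0
  set b : X.Orb → ℝ := fun x => Real.exp (-γ * ‖X.bond u k x.1‖)
  have ha0 : ∀ x, 0 ≤ a x := fun x => by simp only [a]; split_ifs <;> simp
  have hb0 : ∀ x, 0 ≤ b x := fun x => Real.exp_nonneg _
  have h1 : Summable fun p : X.Orb × X.Orb => a p.1 * b p.2 := ha.mul_of_nonneg hb ha0 hb0
  have h2 : Summable fun p : X.Orb × X.Orb => b p.1 * a p.2 := hb.mul_of_nonneg ha hb0 ha0
  have h3 := ha.tsum_mul_tsum hb h1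
  have h4 := hb.tsum_mul_tsum ha h2
  have hle : ∀ p : X.Orb × X.Orb,
      |X.shiftSign k p.1.1 p.2.1| * Real.exp (-γ * ‖X.bond u p.1.1 p.2.1‖) ≤
        a p.1 * b p.2 + b p.1 * a p.2 := by
    intro p
    by_cases hp1 : p.1.1 = k
    · have h5 : a p.1 = 1 := if_pos hp1
      have h6 : Real.exp (-γ * ‖X.bond u p.1.1 p.2.1‖) = b p.2 := by rw [hp1]
      rw [h5, h6]
      have := mul_le_mul_of_nonneg_right (X.abs_shiftSign_le_one k p.1.1 p.2.1) (hb0 p.2)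
      have := mul_nonneg (hb0 p.1) (ha0 p.2)
      linarith
    · by_cases hp2 : p.2.1 = k
      · have h5 : a p.2 = 1 := if_pos hp2
        have h6 : Real.exp (-γ * ‖X.bond u p.1.1 p.2.1‖) = b p.1 := by
          rw [X.norm_bond_comm, hp2]
        rw [h5, h6]
        have := mul_le_mul_of_nonneg_right (X.abs_shiftSign_le_one k p.1.1 p.2.1) (hb0 p.1)
        have := mul_nonneg (ha0 p.1) (hb0 p.2)
        linarith
      · rw [X.shiftSign_eq_zero hp1 hp2, abs_zero, zero_mul]
        exact add_nonneg (mul_nonneg (ha0 _) (hb0 _)) (mul_nonneg (hb0 _) (ha0 _))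
  have h5 := Summable.of_nonneg_of_le (fun p => by positivity) hle (h1.add h2)
  refine ⟨h5, (h5.tsum_le_tsum hle (h1.add h2)).trans ?_⟩
  rw [h1.tsum_add h2, ← h3, ← h4, ha', hb']
  have h6 := mul_le_mul_of_nonneg_left (hC k).2 (Nat.cast_nonneg (α := ℝ) Nb)
  have h7 := mul_le_mul_of_nonneg_left h6 (Nat.cast_nonneg (α := ℝ) Nb)
  linarith

/-- The increments of `h^{ab}` under a displacement of the atom `k`, indexed by pairs of orbitals. -/
noncomputable def incrH (X : TBModel d M Nb S) (u : X.Site → EuclideanSpace ℝ (Fin d))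
    (k : X.Site) (i : Fin d) (p : X.Orb × X.Orb) (s : ℝ) : ℝ :=
  X.h p.1.2 p.2.2 (X.bond (X.shiftCoord u k i s) p.1.1 p.2.1) (X.species p.1.1.1)
    (X.species p.2.1.1) -
  X.h p.1.2 p.2.2 (X.bond u p.1.1 p.2.1) (X.species p.1.1.1) (X.species p.2.1.1)

/-- The increments of `t^{ab}` under a displacement of the atom `k`, indexed by pairs of orbitals. -/
noncomputable def incrT (X : TBModel d M Nb S) (u : X.Site → EuclideanSpace ℝ (Fin d))
    (k : X.Site) (i : Fin d) (p : X.Orb × X.Orb) (s : ℝ) : ℝ :=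
  X.t p.1.2 p.2.2 (X.bond (X.shiftCoord u k i s) p.1.1 p.2.1) (X.species p.1.1.1)
    (X.species p.2.1.1) -
  X.t p.1.2 p.2.2 (X.bond u p.1.1 p.2.1) (X.species p.1.1.1) (X.species p.2.1.1)

/-- The increment of the Hamiltonian due to a pair of orbitals. -/
noncomputable def incr (X : TBModel d M Nb S) (u : X.Site → EuclideanSpace ℝ (Fin d))
    (k : X.Site) (i : Fin d) (p : X.Orb × X.Orb) (s : ℝ) : EllTwo X.Orb →L[ℂ] EllTwo X.Orb :=
  -- A pair ((x,a),(n,b)) plays two roles: it is the place of the hopping entry h^{ab}, and it marks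
  -- n as a neighbour in the on-site sum of t^{ab}, whose place is ((x,a),(x,b)). Pairs with n = x,
  -- absent from that sum, do no harm because their bonds do not move.
  (X.incrH u k i p s : ℂ) • matrixUnit p.1 p.2 +
    (X.incrT u k i p s : ℂ) • matrixUnit p.1 (p.1.1, p.2.2)

theorem shiftCoord_zero (X : TBModel d M Nb S) (u : X.Site → EuclideanSpace ℝ (Fin d))
    (k : X.Site) (i : Fin d) : X.shiftCoord u k i 0 = u := by
  funext x
  rw [shiftCoord_apply, zero_mul, zero_smul, add_zero]

theorem exists_hasDerivAt_incr (X : TBModel d M Nb S) {h₀ γ₀ : ℝ} (hh₀ : 0 < h₀) (hγ₀ : 0 < γ₀)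
    (hX : X.IsTB h₀ γ₀) (u : X.Site → EuclideanSpace ℝ (Fin d)) (k : X.Site) (i : Fin d)
    (p : X.Orb × X.Orb) (s : ℝ) : ∃ a b : ℝ,
      HasDerivAt (X.incr u k i p)
        ((a : ℂ) • matrixUnit p.1 p.2 + (b : ℂ) • matrixUnit p.1 (p.1.1, p.2.2)) s ∧
      |a| ≤ |X.shiftSign k p.1.1 p.2.1| *
        (h₀ * Real.exp (γ₀ * |s|) * Real.exp (-γ₀ * ‖X.bond u p.1.1 p.2.1‖)) ∧
      |b| ≤ |X.shiftSign k p.1.1 p.2.1| *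
        (h₀ * Real.exp (γ₀ * |s|) * Real.exp (-γ₀ * ‖X.bond u p.1.1 p.2.1‖)) := by
  have he : ‖(EuclideanSpace.single i (1 : ℝ) : EuclideanSpace ℝ (Fin d))‖ = 1 := by
    rw [PiLp.norm_single, norm_one]
  have hσ := X.abs_shiftSign_le_one k p.1.1 p.2.1
  obtain ⟨⟨h1, h2⟩, h3, h4⟩ := hX p.1.2 p.2.2 (X.species p.1.1.1) (X.species p.2.1.1)
  refine ⟨_, _, ?_, abs_inner_gradient_line_le hh₀.le hγ₀.le h2 (v := X.bond u p.1.1 p.2.1) he hσ,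
    abs_inner_gradient_line_le hh₀.le hγ₀.le h4 (v := X.bond u p.1.1 p.2.1) he hσ⟩
  have h5 := (hasDerivAt_comp_line h1 (X.bond u p.1.1 p.2.1) (EuclideanSpace.single i (1 : ℝ))
    (X.shiftSign k p.1.1 p.2.1) s).sub_const (X.h p.1.2 p.2.2 (X.bond u p.1.1 p.2.1)
      (X.species p.1.1.1) (X.species p.2.1.1))
  have h6 := (hasDerivAt_comp_line h3 (X.bond u p.1.1 p.2.1) (EuclideanSpace.single i (1 : ℝ))
    (X.shiftSign k p.1.1 p.2.1) s).sub_const (X.t p.1.2 p.2.2 (X.bond u p.1.1 p.2.1)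
      (X.species p.1.1.1) (X.species p.2.1.1))
  have h7 := (h5.ofReal_comp.smul_const (matrixUnit p.1 p.2)).add
    (h6.ofReal_comp.smul_const (matrixUnit p.1 (p.1.1, p.2.2)))
  refine h7.congr_of_eventuallyEq (Eventually.of_forall fun s' => ?_)
  simp only [incr, incrH, incrT, bond_shiftCoord, Pi.add_apply]

theorem incr_zero (X : TBModel d M Nb S) (u : X.Site → EuclideanSpace ℝ (Fin d))
    (k : X.Site) (i : Fin d) (p : X.Orb × X.Orb) : X.incr u k i p 0 = 0 := by
  simp [incr, incrH, incrT, shiftCoord_zero]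

theorem norm_smul_matrixUnit_add_le {ι : Type*} [DecidableEq ι] (a b : ℝ) (i j i' j' : ι) :
    ‖(a : ℂ) • matrixUnit i j + (b : ℂ) • matrixUnit i' j'‖ ≤ |a| + |b| := by
  refine (norm_add_le _ _).trans_eq ?_
  rw [norm_smul, norm_smul, norm_matrixUnit, norm_matrixUnit, mul_one, mul_one, Complex.norm_real,
    Complex.norm_real, Real.norm_eq_abs, Real.norm_eq_abs]

/-- The on-site contribution of the environment to the matrix of the Hamiltonian. -/
noncomputable def onsite (X : TBModel d M Nb S) (u : X.Site → EuclideanSpace ℝ (Fin d))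
    (x y : X.Orb) : ℝ :=
  if x.1 = y.1 then ∑' n : X.Site, if n = x.1 then 0 else
    X.t x.2 y.2 (X.bond u x.1 n) (X.species x.1.1) (X.species n.1) else 0

theorem entry_eq (X : TBModel d M Nb S) (u : X.Site → EuclideanSpace ℝ (Fin d)) (x y : X.Orb) :
    X.entry u x y = X.h x.2 y.2 (X.bond u x.1 y.1) (X.species x.1.1) (X.species y.1.1) +
      X.onsite u x y := rfl

theorem summable_onsite (X : TBModel d M Nb S) {h₀ γ₀ C : ℝ} (hX : X.IsTB h₀ γ₀)
    {u : X.Site → EuclideanSpace ℝ (Fin d)} (hC : X.ExpSumBound u γ₀ C) (x y : X.Orb) :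
    Summable fun n : X.Site => if n = x.1 then 0 else
      X.t x.2 y.2 (X.bond u x.1 n) (X.species x.1.1) (X.species n.1) := by
  refine Summable.of_norm_bounded ((hC x.1).1.mul_left h₀) fun n => ?_
  split_ifs
  · have h5 := (abs_nonneg _).trans
      (hX.abs_h_le x.2 x.2 (X.bond u x.1 n) (X.species x.1.1) (X.species x.1.1))
    simpa using h5
  · exact hX.abs_t_le _ _ _ _ _

theorem hasSum_incrT (X : TBModel d M Nb S) {h₀ γ₀ : ℝ} (hX : X.IsTB h₀ γ₀)
    {u : X.Site → EuclideanSpace ℝ (Fin d)} {k : X.Site} {i : Fin d} {s C C' : ℝ}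
    (hC : X.ExpSumBound u γ₀ C) (hC' : X.ExpSumBound (X.shiftCoord u k i s) γ₀ C')
    (x y : X.Orb) : HasSum (fun p : X.Orb × X.Orb =>
      if x.1 = y.1 ∧ p.1 = x ∧ p.2.2 = y.2 then X.incrT u k i p s else 0)
      (X.onsite (X.shiftCoord u k i s) x y - X.onsite u x y) := by
  by_cases hxy : x.1 = y.1
  · have hinj : Function.Injective fun n : X.Site => ((x, (n, y.2)) : X.Orb × X.Orb) := fun n n' h =>
      congrArg (fun p : X.Orb × X.Orb => p.2.1) h
    rw [onsite, onsite, if_pos hxy, if_pos hxy, ← hinj.hasSum_iff (by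
      intro p hp
      refine if_neg ?_
      rintro ⟨_, h6, h7⟩
      exact hp ⟨p.2.1, Prod.ext h6.symm (Prod.ext rfl h7.symm)⟩)]
    refine ((X.summable_onsite hX hC' x y).hasSum.sub
      (X.summable_onsite hX hC x y).hasSum).congr_fun fun n => ?_
    rw [Function.comp_apply, if_pos ⟨hxy, rfl, rfl⟩]
    by_cases hn : n = x.1
    · subst hn
      simp [incrT, bond_shiftCoord, shiftSign_self]
    · rw [if_neg hn, if_neg hn]; rfl
  · simp only [onsite, hxy, false_and, if_false, sub_zero]
    exact hasSum_zero

theorem incr_entry (X : TBModel d M Nb S) (u : X.Site → EuclideanSpace ℝ (Fin d))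
    (k : X.Site) (i : Fin d) (p : X.Orb × X.Orb) (s : ℝ) (x y : X.Orb) :
    X.incr u k i p s (lp.single 2 y (1 : ℂ)) x =
      (((if p = (x, y) then X.incrH u k i p s else 0) +
      (if x.1 = y.1 ∧ p.1 = x ∧ p.2.2 = y.2 then X.incrT u k i p s else 0) : ℝ) : ℂ) := by
  have e1 : (x = p.1 ∧ y = p.2) ↔ p = (x, y) :=
    ⟨fun h => Prod.ext h.1.symm h.2.symm, fun h => by rw [h]; exact ⟨rfl, rfl⟩⟩
  have e2 : (x = p.1 ∧ y = (p.1.1, p.2.2)) ↔ (x.1 = y.1 ∧ p.1 = x ∧ p.2.2 = y.2) := by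
    constructor
    · rintro ⟨h1, h2⟩
      rw [h1, h2]
      exact ⟨rfl, rfl, rfl⟩
    · rintro ⟨h1, h2, h3⟩
      refine ⟨h2.symm, Prod.ext ?_ h3.symm⟩
      rw [h2]; exact h1.symm
  rw [incr, _root_.add_apply, _root_.smul_apply, _root_.smul_apply, lp.coeFn_add, Pi.add_apply,
    lp.coeFn_smul, lp.coeFn_smul, Pi.smul_apply, Pi.smul_apply, matrixUnit_entry,
    matrixUnit_entry, smul_eq_mul, smul_eq_mul, if_congr e1 rfl rfl, if_congr e2 rfl rfl,
    Complex.ofReal_add]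
  congr 1 <;> split_ifs <;> simp

/-- The entries of the increment of the Hamiltonian. -/
theorem hasMatrix_add_incr (X : TBModel d M Nb S) {h₀ γ₀ : ℝ} (hX : X.IsTB h₀ γ₀)
    {u : X.Site → EuclideanSpace ℝ (Fin d)} {k : X.Site} {i : Fin d} {s C C' : ℝ}
    (hC : X.ExpSumBound u γ₀ C) (hC' : X.ExpSumBound (X.shiftCoord u k i s) γ₀ C')
    (hH : HasMatrix (X.hamiltonian u) fun x y => (X.entry u x y : ℂ))
    {F : EllTwo X.Orb →L[ℂ] EllTwo X.Orb} (hF : HasSum (fun p => X.incr u k i p s) F) :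
    HasMatrix (X.hamiltonian u + F) fun x y => (X.entry (X.shiftCoord u k i s) x y : ℂ) := by
  intro x y
  have h1 := hF.mapL ((innerSL ℂ (lp.single 2 x (1 : ℂ) : EllTwo X.Orb)).comp
    (ContinuousLinearMap.apply ℂ (EllTwo X.Orb) (lp.single 2 y (1 : ℂ) : EllTwo X.Orb)))
  simp only [ContinuousLinearMap.comp_apply, innerSL_apply_apply, ContinuousLinearMap.apply_apply,
    ← EllTwo.apply_eq_inner] at h1
  have h3 : HasSum (fun p : X.Orb × X.Orb =>
      if p = (x, y) then X.incrH u k i p s else 0) (X.incrH u k i (x, y) s) := by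
    have := hasSum_single (f := fun p : X.Orb × X.Orb =>
      if p = (x, y) then X.incrH u k i p s else 0) (x, y) (fun p hp => if_neg hp)
    simpa using this
  have h4 := (h3.add (X.hasSum_incrT hX hC hC' x y)).mapL Complex.ofRealCLM
  have h5 := h1.unique (h4.congr_fun fun p => X.incr_entry u k i p s x y)
  rw [_root_.add_apply, lp.coeFn_add, Pi.add_apply, h5, hH x y, Complex.ofRealCLM_apply,
    ← Complex.ofReal_add]
  congr 1
  rw [entry_eq, entry_eq, incrH]
  ring

/-- The Hamiltonian is differentiable with respect to the position of an atom. -/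
theorem exists_hasDerivAt_hamiltonian (X : TBModel d M Nb S) {h₀ γ₀ m C C' : ℝ} (hh₀ : 0 < h₀)
    (hγ₀ : 0 < γ₀) (hm : 0 < m) (hX : X.IsTB h₀ γ₀)
    {u : X.Site → EuclideanSpace ℝ (Fin d)} (hu : X.Separated m u) (hC : X.ExpSumBound u γ₀ C)
    (hC' : ∀ v : X.Site → EuclideanSpace ℝ (Fin d), X.Separated (m / 2) v →
      X.ExpSumBound v γ₀ C') (k : X.Site) (i : Fin d) :
    ∃ (H' : EllTwo X.Orb →L[ℂ] EllTwo X.Orb) (α β : X.Orb × X.Orb → ℝ),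
      HasDerivAt (fun s => X.hamiltonian (X.shiftCoord u k i s)) H' 0 ∧
      HasSum (fun p => (α p : ℂ) • matrixUnit p.1 p.2 +
        (β p : ℂ) • matrixUnit p.1 (p.1.1, p.2.2)) H' ∧
      (∀ p, |α p| ≤ h₀ * (|X.shiftSign k p.1.1 p.2.1| *
        Real.exp (-γ₀ * ‖X.bond u p.1.1 p.2.1‖))) ∧
      ∀ p, |β p| ≤ h₀ * (|X.shiftSign k p.1.1 p.2.1| *
        Real.exp (-γ₀ * ‖X.bond u p.1.1 p.2.1‖)) := by
  choose α β hd hα hβ using fun p s => X.exists_hasDerivAt_incr hh₀ hγ₀ hX u k i p s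
  -- For |s| < 1 the gradient bounds lose at most a factor e^{γ₀}. This summable majorant in
  -- operator norm allows the series of increments to be differentiated term by term.
  have hsum := (X.summable_shiftSign hC k).1.mul_left (2 * h₀ * Real.exp γ₀)
  have hbound : ∀ p, ∀ s ∈ Metric.ball (0 : ℝ) 1,
      ‖(α p s : ℂ) • matrixUnit p.1 p.2 + (β p s : ℂ) • matrixUnit p.1 (p.1.1, p.2.2)‖ ≤
        2 * h₀ * Real.exp γ₀ * (|X.shiftSign k p.1.1 p.2.1| *
          Real.exp (-γ₀ * ‖X.bond u p.1.1 p.2.1‖)) := by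
    intro p s hs
    refine (norm_smul_matrixUnit_add_le _ _ _ _ _ _).trans ((add_le_add (hα p s) (hβ p s)).trans ?_)
    have h1 : Real.exp (γ₀ * |s|) ≤ Real.exp γ₀ := by
      rw [Metric.mem_ball, Real.dist_eq, sub_zero] at hs
      exact Real.exp_le_exp.2 (mul_le_of_le_one_right hγ₀.le hs.le)
    have h2 : 0 ≤ |X.shiftSign k p.1.1 p.2.1| * h₀ *
        Real.exp (-γ₀ * ‖X.bond u p.1.1 p.2.1‖) := by positivity
    nlinarith
  have h0 : (0 : ℝ) ∈ Metric.ball (0 : ℝ) 1 := Metric.mem_ball_self one_pos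
  have hconn := (convex_ball (0 : ℝ) 1).isPreconnected
  have hs0 : Summable fun p => X.incr u k i p 0 := by
    simp_rw [incr_zero]; exact summable_zero
  have hs : ∀ s ∈ Metric.ball (0 : ℝ) 1, Summable fun p => X.incr u k i p s := fun s hs =>
    summable_of_summable_hasDerivAt_of_isPreconnected hsum Metric.isOpen_ball hconn
      (fun p s _ => hd p s) hbound h0 hs0 hs
  have hderiv := hasDerivAt_tsum_of_isPreconnected hsum Metric.isOpen_ball hconn
    (fun p s _ => hd p s) hbound h0 hs0 h0
  have hz : ∀ p : X.Orb × X.Orb, |X.shiftSign k p.1.1 p.2.1| *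
      (h₀ * Real.exp (γ₀ * |0|) * Real.exp (-γ₀ * ‖X.bond u p.1.1 p.2.1‖)) =
      h₀ * (|X.shiftSign k p.1.1 p.2.1| * Real.exp (-γ₀ * ‖X.bond u p.1.1 p.2.1‖)) := fun p => by
    rw [abs_zero, mul_zero, Real.exp_zero]; ring
  refine ⟨_, fun p => α p 0, fun p => β p 0, ?_,
    (Summable.of_norm_bounded hsum fun p => hbound p 0 h0).hasSum,
    fun p => (hα p 0).trans_eq (hz p), fun p => (hβ p 0).trans_eq (hz p)⟩
  refine (hderiv.const_add (X.hamiltonian u)).congr_of_eventuallyEq ?_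
  filter_upwards [Metric.ball_mem_nhds (0 : ℝ) one_pos,
    Metric.closedBall_mem_nhds (0 : ℝ) (half_pos hm)] with s hs1 hs2
  rw [Metric.mem_closedBall, Real.dist_eq, sub_zero] at hs2
  have hsep := X.separated_shiftCoord hu k i hs2
  -- The Hamiltonian of the shifted configuration is identified with H(u) plus the series of
  -- increments by comparing matrices.
  refine (hamiltonian_spec X hγ₀ hX (half_pos hm) hsep).1.unique ?_
  exact X.hasMatrix_add_incr hX hC (hC' _ hsep) (hamiltonian_spec X hγ₀ hX hm hu).1 (hs s hs1).hasSum

/-- One end of a moving bond is k, and the weights of its ends differ by at most η times its length.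
The first form serves the hopping entries, the second the on-site ones, where both indices are at x.
-/
theorem weight_le_of_shiftSign_ne_zero (X : TBModel d M Nb S)
    {u : X.Site → EuclideanSpace ℝ (Fin d)} {w : X.Site → ℝ} {η : ℝ} (hη : 0 ≤ η)
    (hw : ∀ x y, |w x - w y| ≤ η * ‖X.bond u x y‖) {k x y : X.Site}
    (h : X.shiftSign k x y ≠ 0) :
    2 * w k ≤ w x + w y + 2 * η * ‖X.bond u x y‖ ∧ 2 * w k ≤ 2 * w x + 2 * η * ‖X.bond u x y‖ := by
  have h2 := abs_le.1 (hw x y)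
  have h3 : 0 ≤ η * ‖X.bond u x y‖ := by positivity
  by_cases hx : x = k
  · subst hx
    constructor <;> linarith
  · by_cases hy : y = k
    · subst hy
      constructor <;> linarith
    · exact absurd (X.shiftSign_eq_zero hx hy) h

/-- Matrix elements of the derivative of the Hamiltonian between exponentially decaying states. -/
theorem norm_inner_deriv_le (X : TBModel d M Nb S) {h₀ γ₀ C η κ : ℝ} (hh₀ : 0 < h₀)
    {u : X.Site → EuclideanSpace ℝ (Fin d)} (hC : X.ExpSumBound u (γ₀ / 2) C) {k : X.Site}
    {H' : EllTwo X.Orb →L[ℂ] EllTwo X.Orb} {α β : X.Orb × X.Orb → ℝ}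
    (hH' : HasSum (fun p => (α p : ℂ) • matrixUnit p.1 p.2 +
        (β p : ℂ) • matrixUnit p.1 (p.1.1, p.2.2)) H')
    (hα : ∀ p, |α p| ≤ h₀ * (|X.shiftSign k p.1.1 p.2.1| *
        Real.exp (-γ₀ * ‖X.bond u p.1.1 p.2.1‖)))
    (hβ : ∀ p, |β p| ≤ h₀ * (|X.shiftSign k p.1.1 p.2.1| *
        Real.exp (-γ₀ * ‖X.bond u p.1.1 p.2.1‖)))
    {w : X.Site → ℝ} (hη : 0 ≤ η) (hηγ : 4 * η ≤ γ₀)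
    (hw : ∀ x y, |w x - w y| ≤ η * ‖X.bond u x y‖) (hκ : 0 ≤ κ) {χ χ' : EllTwo X.Orb}
    (hχ : ∀ x, ‖χ x‖ ≤ κ * Real.exp (-w x.1)) (hχ' : ∀ x, ‖χ' x‖ ≤ κ * Real.exp (-w x.1)) :
    ‖(inner ℂ χ' (H' χ) : ℂ)‖ ≤
      κ ^ 2 * (4 * h₀ * (Nb * (Nb * C))) * Real.exp (-2 * w k) := by
  obtain ⟨hs, hs'⟩ := X.summable_shiftSign hC k
  have h1 := hH'.mapL ((innerSL ℂ χ').comp (ContinuousLinearMap.apply ℂ (EllTwo X.Orb) χ))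
  simp only [ContinuousLinearMap.comp_apply, innerSL_apply_apply,
    ContinuousLinearMap.apply_apply] at h1
  rw [← h1.tsum_eq]
  have hin : ∀ x y : X.Orb, ‖(inner ℂ χ' (matrixUnit x y χ) : ℂ)‖ = ‖χ' x‖ * ‖χ y‖ := by
    intro x y
    rw [matrixUnit_apply, inner_smul_right, ← inner_conj_symm, ← EllTwo.apply_eq_inner, norm_mul,
      RCLike.norm_conj, mul_comm]
  have hterm : ∀ (a : ℝ) (p : X.Orb × X.Orb) (y : X.Orb), (y = p.2 ∨ y = (p.1.1, p.2.2)) →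
      |a| ≤ h₀ * (|X.shiftSign k p.1.1 p.2.1| * Real.exp (-γ₀ * ‖X.bond u p.1.1 p.2.1‖)) →
      |a| * (‖χ' p.1‖ * ‖χ y‖) ≤ κ ^ 2 * h₀ * Real.exp (-2 * w k) *
        (|X.shiftSign k p.1.1 p.2.1| * Real.exp (-(γ₀ / 2) * ‖X.bond u p.1.1 p.2.1‖)) := by
    intro a p y hy ha
    by_cases h0 : X.shiftSign k p.1.1 p.2.1 = 0
    · have : |a| ≤ 0 := by simpa [h0] using ha
      rw [le_antisymm this (abs_nonneg _), h0]
      simp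
    have hr : 0 ≤ ‖X.bond u p.1.1 p.2.1‖ := norm_nonneg _
    -- Moving both weights to the atom k costs e^{2ηr} ≤ e^{γ₀r/2}. This is paid by half of the
    -- decay of the hopping; the other half remains for the summation.
    have hexp : Real.exp (-γ₀ * ‖X.bond u p.1.1 p.2.1‖) *
        (Real.exp (-w p.1.1) * Real.exp (-w y.1)) ≤
        Real.exp (-2 * w k) * Real.exp (-(γ₀ / 2) * ‖X.bond u p.1.1 p.2.1‖) := by
      rw [← Real.exp_add, ← Real.exp_add, ← Real.exp_add]
      refine Real.exp_le_exp.2 ?_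
      obtain ⟨h3, h4⟩ := X.weight_le_of_shiftSign_ne_zero hη hw h0
      have h5 := mul_le_mul_of_nonneg_right hηγ hr
      rcases hy with rfl | rfl
      · linarith
      · change _ + (_ + -w p.1.1) ≤ _
        linarith
    calc |a| * (‖χ' p.1‖ * ‖χ y‖) ≤
          h₀ * (|X.shiftSign k p.1.1 p.2.1| * Real.exp (-γ₀ * ‖X.bond u p.1.1 p.2.1‖)) *
          ((κ * Real.exp (-w p.1.1)) * (κ * Real.exp (-w y.1))) :=
          mul_le_mul ha (mul_le_mul (hχ' _) (hχ _) (norm_nonneg _) (by positivity))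
            (by positivity) (by positivity)
      _ = κ ^ 2 * h₀ * |X.shiftSign k p.1.1 p.2.1| * (Real.exp (-γ₀ * ‖X.bond u p.1.1 p.2.1‖) *
          (Real.exp (-w p.1.1) * Real.exp (-w y.1))) := by ring
      _ ≤ κ ^ 2 * h₀ * |X.shiftSign k p.1.1 p.2.1| *
          (Real.exp (-2 * w k) * Real.exp (-(γ₀ / 2) * ‖X.bond u p.1.1 p.2.1‖)) :=
          mul_le_mul_of_nonneg_left hexp (by positivity)
      _ = _ := by ring
  have h2 := tsum_of_norm_bounded
    ((hs.mul_left (2 * (κ ^ 2 * h₀ * Real.exp (-2 * w k)))).hasSum)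
    (f := fun p : X.Orb × X.Orb => (inner ℂ χ' (((α p : ℂ) • matrixUnit p.1 p.2 +
        (β p : ℂ) • matrixUnit p.1 (p.1.1, p.2.2)) χ) : ℂ)) (fun p => by
      rw [_root_.add_apply, _root_.smul_apply, _root_.smul_apply, inner_add_right,
        inner_smul_right, inner_smul_right]
      refine (norm_add_le _ _).trans ?_
      rw [norm_mul, norm_mul, hin, hin, Complex.norm_real, Complex.norm_real, Real.norm_eq_abs,
        Real.norm_eq_abs]
      have e1 := hterm _ p p.2 (Or.inl rfl) (hα p)
      have e2 := hterm _ p (p.1.1, p.2.2) (Or.inr rfl) (hβ p)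
      linarith)
  refine h2.trans ?_
  rw [tsum_mul_left]
  have h3 : 0 ≤ 2 * (κ ^ 2 * h₀ * Real.exp (-2 * w k)) := by positivity
  refine (mul_le_mul_of_nonneg_left hs' h3).trans (le_of_eq ?_)
  ring

end TBModel

/-! ### Cutoffs and flattened weights -/

theorem exists_cutoff {α E : Type*} [PseudoMetricSpace E] (Y : α → E) (B : Set α) {L : ℝ}
    (hL : 0 < L) : ∃ j : α → ℝ, (∀ x, 0 ≤ j x ∧ j x ≤ 1) ∧
      (∀ x y, |j x - j y| ≤ dist (Y x) (Y y) / L) ∧ (∀ b ∈ B, j b = 1) ∧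
      ∀ x, j x ≠ 0 → ∃ b ∈ B, dist (Y x) (Y b) < 2 * L := by
  -- `Metric.infDist` to the empty set is zero, so the formula used below would give the constant 1,
  -- where the cutoff 0 is required.
  rcases B.eq_empty_or_nonempty with rfl | hB
  · exact ⟨0, fun x => by simp, fun x y => by simp; positivity, fun b hb => hb.elim,
      fun x hx => (hx rfl).elim⟩
  have hlip : ∀ x y, Metric.infDist (Y x) (Y '' B) - Metric.infDist (Y y) (Y '' B) ≤
      dist (Y x) (Y y) := fun x y => by
    have := Metric.infDist_le_infDist_add_dist (s := Y '' B) (x := Y x) (y := Y y)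
    linarith
  refine ⟨fun x => max 0 (min 1 (2 - Metric.infDist (Y x) (Y '' B) / L)), fun x => ⟨le_max_left _ _,
    max_le zero_le_one (min_le_left _ _)⟩, fun x y => ?_, fun b hb => ?_, fun x hx => ?_⟩
  · refine (abs_max_sub_max_le_max _ _ _ _).trans (max_le ?_ ?_)
    · simp only [sub_self, abs_zero]; positivity
    · refine (abs_min_sub_min_le_max _ _ _ _).trans (max_le ?_ ?_)
      · simp only [sub_self, abs_zero]; positivity
      · rw [sub_sub_sub_cancel_left, ← sub_div, abs_div, abs_of_pos hL]
        refine div_le_div_of_nonneg_right (abs_le.2 ⟨?_, ?_⟩) hL.le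
        · linarith [hlip x y]
        · rw [dist_comm]; exact hlip y x
  · simp only [Metric.infDist_zero_of_mem (Set.mem_image_of_mem Y hb)]
    norm_num
  · have h1 : Metric.infDist (Y x) (Y '' B) < 2 * L := by
      by_contra! h2
      refine hx (max_eq_left ((min_le_right _ _).trans ?_))
      rw [sub_nonpos, le_div_iff₀ hL]
      exact h2
    obtain ⟨_, ⟨b, hb, rfl⟩, h2⟩ := (Metric.infDist_lt_iff (hB.image Y)).1 h1
    exact ⟨b, hb, h2⟩

/-- The identity of the real line, made constant on finitely many balls. -/
theorem exists_flattening (s : Finset ℝ) {a : ℝ} (ha : 0 ≤ a) : ∃ F : ℝ → ℝ, F 0 = 0 ∧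
    (∀ x y, x ≤ y → F x ≤ F y ∧ F y - F x ≤ y - x) ∧
    (∀ c ∈ s, ∀ x ∈ Metric.ball c a, ∀ y ∈ Metric.ball c a, F x = F y) ∧
    ∀ x, 0 ≤ x → x - 2 * a * s.card ≤ F x := by
  -- F is the primitive of the indicator of the complement of the balls. It is monotone with slope
  -- at most one, constant on each ball, and loses at most the total length of the balls.
  set U : Set ℝ := ⋃ c ∈ s, Metric.ball c a with hU
  have hUm : MeasurableSet U := Finset.measurableSet_biUnion _ fun _ _ => measurableSet_ball
  have hvol : MeasureTheory.volume U ≤ ENNReal.ofReal (2 * a * s.card) := by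
    refine (MeasureTheory.measure_biUnion_finset_le _ _).trans ?_
    simp only [Real.volume_ball, Finset.sum_const, nsmul_eq_mul]
    rw [mul_comm (2 * a), ENNReal.ofReal_mul (Nat.cast_nonneg _), ENNReal.ofReal_natCast]
  set f : ℝ → ℝ := Uᶜ.indicator 1 with hf
  have hf01 : ∀ x, 0 ≤ f x ∧ f x ≤ 1 := fun x => by
    by_cases hx : x ∈ U <;> simp [hf, hx]
  have hfi : ∀ x y, IntervalIntegrable f MeasureTheory.volume x y := fun x y =>
    (intervalIntegrable_const (c := (1 : ℝ))).mono_fun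
      ((measurable_one.indicator hUm.compl).aestronglyMeasurable)
      (Eventually.of_forall fun t => by
        simp only [Real.norm_of_nonneg (hf01 t).1, norm_one]; exact (hf01 t).2)
  have hsub : ∀ x y, (∫ t in (0 : ℝ)..y, f t) - ∫ t in (0 : ℝ)..x, f t = ∫ t in x..y, f t :=
    fun x y => intervalIntegral.integral_interval_sub_left (hfi _ _) (hfi _ _)
  refine ⟨fun x => ∫ t in (0 : ℝ)..x, f t, intervalIntegral.integral_same, fun x y hxy => ?_,
    fun c hc x hx y hy => ?_, fun x hx => ?_⟩
  · have h1 := intervalIntegral.integral_nonneg (f := f) (μ := MeasureTheory.volume) hxy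
      fun t _ => (hf01 t).1
    have h2 := intervalIntegral.integral_mono_on hxy (hfi x y)
      (intervalIntegrable_const (c := (1 : ℝ))) fun t _ => (hf01 t).2
    rw [intervalIntegral.integral_const, smul_eq_mul, mul_one] at h2
    refine ⟨?_, ?_⟩
    · have := hsub x y; simp only at this ⊢; linarith
    · have := hsub x y; simp only at this ⊢; linarith
  · have h3 : ∫ t in x..y, f t = 0 := by
      refine intervalIntegral.integral_zero_ae (Eventually.of_forall fun t ht => ?_)
      have hconv := (convex_ball c a).ordConnected.uIcc_subset hx hy
      have : t ∈ U := Set.mem_biUnion hc (hconv (Set.uIoc_subset_uIcc ht))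
      simp [hf, this]
    have := hsub x y; simp only at this ⊢; linarith
  · have h4 : ∫ t in (0 : ℝ)..x, (1 - f t) ≤ 2 * a * s.card := by
      have h5 : (fun t => 1 - f t) = U.indicator 1 := by
        funext t
        by_cases ht : t ∈ U <;> simp [hf, ht]
      rw [h5, intervalIntegral.integral_of_le hx, MeasureTheory.integral_indicator_one hUm]
      refine ENNReal.toReal_le_of_le_ofReal (by positivity) ?_
      exact (MeasureTheory.Measure.restrict_apply_le _ _).trans hvol
    rw [intervalIntegral.integral_sub (intervalIntegrable_const) (hfi _ _),
      intervalIntegral.integral_const, smul_eq_mul, mul_one] at h4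
    linarith

/-- Exponential weights that are constant near finitely many points. -/
theorem exists_weight {α E : Type*} [PseudoMetricSpace E] (Y : α → E) {B : Set α} (hB : B.Finite)
    {a η : ℝ} (ha : 0 ≤ a) (hη : 0 ≤ η) (ℓ k : α) : ∃ w : α → ℝ, w ℓ = 0 ∧
      (∀ x, |w x| ≤ η * dist (Y k) (Y ℓ)) ∧ (∀ x y, |w x - w y| ≤ η * dist (Y x) (Y y)) ∧
      (∀ b ∈ B, ∀ x y, dist (Y x) (Y b) < a → dist (Y y) (Y b) < a → w x = w y) ∧
      η * (dist (Y k) (Y ℓ) - 2 * a * B.ncard) ≤ w k := by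
  classical
  -- The distance to ℓ, truncated at its value at k: the truncation makes the weight bounded and
  -- costs nothing at k. As f is 1-Lipschitz, points within a of Y b go into the interval of radius
  -- a about f b, so flattening the line there flattens the weight.
  set f : α → ℝ := fun x => min (dist (Y x) (Y ℓ)) (dist (Y k) (Y ℓ)) with hf
  have hf0 : ∀ x, 0 ≤ f x := fun x => le_min dist_nonneg dist_nonneg
  have hfl : ∀ x y, |f x - f y| ≤ dist (Y x) (Y y) := fun x y => by
    refine (abs_min_sub_min_le_max _ _ _ _).trans (max_le ?_ ?_)
    · exact abs_dist_sub_le _ _ _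
    · simp
  obtain ⟨F, hF0, hF1, hF2, hF3⟩ := exists_flattening (hB.toFinset.image f) ha
  have hFl : ∀ x y, |F x - F y| ≤ |x - y| := by
    intro x y
    rcases le_total x y with h | h
    · obtain ⟨h1, h2⟩ := hF1 x y h
      rw [abs_sub_comm, abs_of_nonneg (sub_nonneg.2 h1), abs_sub_comm, abs_of_nonneg (by linarith)]
      exact h2
    · obtain ⟨h1, h2⟩ := hF1 y x h
      rw [abs_of_nonneg (sub_nonneg.2 h1), abs_of_nonneg (by linarith)]
      exact h2
  have hfℓ : f ℓ = 0 := by simp [hf]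
  have hlip : ∀ x y, |η * F (f x) - η * F (f y)| ≤ η * |f x - f y| := fun x y => by
    rw [← mul_sub, abs_mul, abs_of_nonneg hη]
    exact mul_le_mul_of_nonneg_left (hFl _ _) hη
  refine ⟨fun x => η * F (f x), by simp only [hfℓ, hF0, mul_zero], fun x => ?_, fun x y => ?_,
    fun b hb x y hx hy => ?_, ?_⟩
  · have h1 := hlip x ℓ
    rw [hfℓ, hF0, mul_zero, sub_zero, sub_zero, abs_of_nonneg (hf0 x)] at h1
    exact h1.trans (mul_le_mul_of_nonneg_left (min_le_right _ _) hη)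
  · exact (hlip x y).trans (mul_le_mul_of_nonneg_left (hfl x y) hη)
  · have h2 : f b ∈ hB.toFinset.image f := Finset.mem_image_of_mem _ (hB.mem_toFinset.2 hb)
    simp only
    rw [hF2 _ h2 (f x) ?_ (f y) ?_]
    · rw [Metric.mem_ball, Real.dist_eq]; exact (hfl x b).trans_lt hx
    · rw [Metric.mem_ball, Real.dist_eq]; exact (hfl y b).trans_lt hy
  · refine mul_le_mul_of_nonneg_left ?_ hη
    have h3 : f k = dist (Y k) (Y ℓ) := by simp [hf]
    refine le_trans ?_ (hF3 _ (hf0 k))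
    rw [h3]
    have h4 : ((hB.toFinset.image f).card : ℝ) ≤ B.ncard := by
      rw [Set.ncard_eq_toFinset_card _ hB]
      exact_mod_cast Finset.card_image_le
    have h5 := mul_le_mul_of_nonneg_left h4 (mul_nonneg zero_le_two ha)
    linarith

/-! ### The weighted commutator estimate of Combes and Thomas -/

section

variable {ι : Type*} [DecidableEq ι]

theorem mulOp_single {w : ι → ℝ} {C : ℝ} (hw : ∀ i, |w i| ≤ C) (i : ι) :
    mulOp w (lp.single 2 i (1 : ℂ)) = (w i : ℂ) • (lp.single 2 i (1 : ℂ) : EllTwo ι) := by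
  ext j
  rw [mulOp_apply hw, lp.coeFn_smul, Pi.smul_apply, smul_eq_mul]
  by_cases h : j = i
  · subst h; rfl
  · rw [lp.single_apply_ne _ _ _ h, mul_zero, mul_zero]

end

/-- The Combes-Thomas estimate for a localised and exponentially weighted resolvent vector. -/
theorem norm_localized_resolvent_le {κ : Type*} [DecidableEq κ] {n : ℕ}
    {A H : EllTwo (κ × Fin n) →L[ℂ] EllTwo (κ × Fin n)} {KA KH : κ × Fin n → κ × Fin n → ℂ}
    (hA : HasMatrix A KA) (hH : HasMatrix H KH) {j w : κ → ℝ} (hj : ∀ x, 0 ≤ j x ∧ j x ≤ 1) {W : ℝ}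
    (hw : ∀ x, |w x| ≤ W) {g : κ → κ → ℝ} {C : ℝ}
    (hK : ∀ x y, ‖KA x y * j y.1 - KH x y * (j x.1 * Real.exp (w x.1 - w y.1) : ℝ)‖ ≤ g x.1 y.1)
    (hg : ∀ x y, 0 ≤ g x y) (hsymm : ∀ x y, g x y = g y x) (hs : ∀ x, Summable (g x))
    (hC : ∀ x, ∑' y, g x y ≤ C) {χ : EllTwo (κ × Fin n)} {z : ℂ} {x₀ : κ × Fin n}
    (hχ : z • χ - H χ = lp.single 2 x₀ (1 : ℂ)) (hw0 : w x₀.1 = 0) :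
    ‖A (mulOp (fun x => j x.1) (mulOp (fun x => Real.exp (w x.1)) χ)) -
        z • mulOp (fun x => j x.1) (mulOp (fun x => Real.exp (w x.1)) χ)‖ ≤
      1 + n * C * ‖mulOp (fun x : κ × Fin n => Real.exp (w x.1)) χ‖ := by
  have b1 : ∀ x : κ × Fin n, |j x.1| ≤ 1 := fun x => by
    rw [abs_of_nonneg (hj _).1]; exact (hj _).2
  have b2 : ∀ x : κ × Fin n, |Real.exp (w x.1)| ≤ Real.exp W := fun x => by
    rw [abs_of_pos (Real.exp_pos _)]; exact Real.exp_le_exp.2 ((le_abs_self _).trans (hw _))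
  have b3 : ∀ x : κ × Fin n, |Real.exp (-w x.1)| ≤ Real.exp W := fun x => by
    rw [abs_of_pos (Real.exp_pos _)]; exact Real.exp_le_exp.2 ((neg_le_abs _).trans (hw _))
  have b4 : ∀ x : κ × Fin n, |j x.1 * Real.exp (w x.1)| ≤ 1 * Real.exp W := fun x => by
    rw [abs_mul]; exact mul_le_mul (b1 x) (b2 x) (abs_nonneg _) zero_le_one
  set J := mulOp fun x : κ × Fin n => j x.1 with hJ
  set V := mulOp fun x : κ × Fin n => Real.exp (w x.1) with hV
  set V' := mulOp fun x : κ × Fin n => Real.exp (-w x.1) with hV'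
  set G := mulOp fun x : κ × Fin n => j x.1 * Real.exp (w x.1) with hG
  -- With V = e^w and G = JV this operator is A J − G H V⁻¹, so on Vχ it equals A J V χ − J V H χ.
  -- By the resolvent equation (A − z) J V χ differs from it by the source term only, whose norm is
  -- j(x₀) ≤ 1 because w(x₀) = 0.
  have hT : HasMatrix (A ∘L J - G ∘L H ∘L V')
      fun x y => KA x y * j y.1 - KH x y * (j x.1 * Real.exp (w x.1 - w y.1) : ℝ) := by
    intro x y
    rw [_root_.sub_apply, lp.coeFn_sub, Pi.sub_apply, ContinuousLinearMap.comp_apply,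
      ContinuousLinearMap.comp_apply, ContinuousLinearMap.comp_apply, hJ, mulOp_single b1, hV',
      mulOp_single b3, map_smul, map_smul, hG, mulOp_apply b4, lp.coeFn_smul, lp.coeFn_smul,
      Pi.smul_apply, Pi.smul_apply, hA x y, hH x y, smul_eq_mul, smul_eq_mul]
    simp only [sub_eq_add_neg (w x.1), Real.exp_add]
    push_cast
    ring
  have hTle := hT.norm_apply_le_block hK hg hsymm hs hC (V χ)
  have h1 : V' (V χ) = χ := by
    ext x
    rw [hV', hV, mulOp_apply b3, mulOp_apply b2, ← mul_assoc, ← Complex.ofReal_mul, ← Real.exp_add,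
      neg_add_cancel, Real.exp_zero, Complex.ofReal_one, one_mul]
  have h2 : G χ = J (V χ) := by
    ext x
    rw [hG, hJ, hV, mulOp_apply b4, mulOp_apply b1, mulOp_apply b2, Complex.ofReal_mul, mul_assoc]
  have h3 : H χ = z • χ - lp.single 2 x₀ (1 : ℂ) := by rw [← hχ]; abel
  have h4 : A (J (V χ)) - z • J (V χ) = (A ∘L J - G ∘L H ∘L V') (V χ) -
      (j x₀.1 : ℂ) • lp.single 2 x₀ (1 : ℂ) := by
    rw [_root_.sub_apply, ContinuousLinearMap.comp_apply, ContinuousLinearMap.comp_apply,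
      ContinuousLinearMap.comp_apply, h1, h3, map_sub, map_smul, h2, hG, mulOp_single b4, hw0,
      Real.exp_zero, mul_one]
    abel
  rw [h4]
  refine (norm_sub_le _ _).trans ?_
  rw [norm_smul, EllTwo.norm_single_one, mul_one, Complex.norm_real, Real.norm_eq_abs, add_comm]
  exact add_le_add (b1 x₀) hTle

/-! ### Perturbation of the matrix entries by strain -/

theorem abs_one_sub_exp_le (x : ℝ) : |1 - Real.exp x| ≤ |x| * Real.exp |x| := by
  have h1 := Real.add_one_le_exp x
  have h2 := Real.add_one_le_exp (-x)
  rcases le_total 0 x with h | h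
  · rw [abs_of_nonneg h, abs_of_nonpos (by linarith)]
    have h3 := mul_le_mul_of_nonneg_right h2 (Real.exp_nonneg x)
    rw [← Real.exp_add, neg_add_cancel, Real.exp_zero] at h3
    linarith
  · have h4 : 1 ≤ Real.exp (-x) := by linarith
    have h5 : Real.exp x ≤ 1 := Real.exp_le_one_iff.2 h
    rw [abs_of_nonpos h, abs_of_nonneg (by linarith)]
    nlinarith

theorem abs_sub_le_of_gradient_decay {E : Type*} [NormedAddCommGroup E] [InnerProductSpace ℝ E]
    [CompleteSpace E] {f : E → ℝ} {h₀ γ : ℝ} (hh : 0 ≤ h₀) (hγ : 0 ≤ γ) (hf : ContDiff ℝ 1 f)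
    (hb : ∀ r, |f r| + ‖gradient f r‖ ≤ h₀ * Real.exp (-γ * ‖r‖)) (v a : E) :
    |f v - f (v + a)| ≤ h₀ * (Real.exp (γ * ‖a‖) * ‖a‖) * Real.exp (-γ * ‖v‖) := by
  have h1 := (convex_closedBall v ‖a‖).norm_image_sub_le_of_norm_fderiv_le (𝕜 := ℝ) (f := f)
    (C := h₀ * (Real.exp (γ * ‖a‖) * Real.exp (-γ * ‖v‖)))
    (fun x _ => (hf.differentiable one_ne_zero) x) (fun x hx => by
      rw [mem_closedBall_iff_norm'] at hx
      have h2 : ‖fderiv ℝ f x‖ = ‖gradient f x‖ := by simp [gradient]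
      rw [h2, ← Real.exp_add]
      refine (le_trans (le_add_of_nonneg_left (abs_nonneg _)) (hb x)).trans
        (mul_le_mul_of_nonneg_left (Real.exp_le_exp.2 ?_) hh)
      have h3 := norm_sub_norm_le v x
      nlinarith)
    (x := v + a) (y := v) (by simp) (by simp)
  rw [Real.norm_eq_abs, sub_add_cancel_left, norm_neg] at h1
  linarith

/-- The change of a decaying function under a perturbation that is small for short arguments. -/
theorem abs_sub_le_of_near_or_far {E : Type*} [NormedAddCommGroup E] [InnerProductSpace ℝ E]
    [CompleteSpace E] {f : E → ℝ} {h₀ γ : ℝ} (hh : 0 ≤ h₀) (hγ : 0 ≤ γ) (hf : ContDiff ℝ 1 f)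
    (hb : ∀ r, |f r| + ‖gradient f r‖ ≤ h₀ * Real.exp (-γ * ‖r‖)) {v a : E} {ω ρ s : ℝ}
    (hω : ω ≤ 1) (hω0 : 0 ≤ ω) (hnear : ‖a‖ ≤ ω ∨ ρ ≤ ‖v‖) (hfar : ‖a‖ ≤ ‖v‖ / 2 + s) (hs : 0 ≤ s) :
    |f v - f (v + a)| ≤ h₀ * (Real.exp γ * ω + 2 * Real.exp (γ * s) * Real.exp (-(γ / 4) * ρ)) *
      Real.exp (-(γ / 4) * ‖v‖) := by
  have hv := norm_nonneg v
  have ha := norm_nonneg a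
  rcases hnear with h | h
  · refine (abs_sub_le_of_gradient_decay hh hγ hf hb v a).trans ?_
    have h1 : Real.exp (γ * ‖a‖) * ‖a‖ ≤ Real.exp γ * ω :=
      mul_le_mul (Real.exp_le_exp.2 (mul_le_of_le_one_right hγ (h.trans hω))) h ha
        (Real.exp_nonneg _)
    have h2 : 0 ≤ 2 * Real.exp (γ * s) * Real.exp (-(γ / 4) * ρ) := by positivity
    refine mul_le_mul (mul_le_mul_of_nonneg_left (by linarith) hh) (Real.exp_le_exp.2 ?_)
      (Real.exp_nonneg _) (by positivity)
    nlinarith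
  · have hle : ∀ r, |f r| ≤ h₀ * Real.exp (-γ * ‖r‖) := fun r =>
      le_trans (le_add_of_nonneg_right (norm_nonneg _)) (hb r)
    have h1 : ‖v‖ - ‖a‖ ≤ ‖v + a‖ := by
      have := norm_sub_le (v + a) a
      rw [add_sub_cancel_right] at this
      linarith
    -- For a long bond both values are small and no cancellation is needed. Of the decay
    -- e^{-γ‖v‖/2}, one half becomes the small factor e^{-γρ/4} and the other half is kept for
    -- summation.
    have key : ∀ t : ℝ, ‖v‖ / 2 - s ≤ t → Real.exp (-γ * t) ≤
        Real.exp (γ * s) * Real.exp (-(γ / 4) * ρ) * Real.exp (-(γ / 4) * ‖v‖) := by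
      intro t ht
      rw [← Real.exp_add, ← Real.exp_add]
      refine Real.exp_le_exp.2 ?_
      have e1 := mul_le_mul_of_nonneg_left ht hγ
      have e2 := mul_le_mul_of_nonneg_left h hγ
      linarith
    have h3 := mul_le_mul_of_nonneg_left (key ‖v‖ (by linarith)) hh
    have h4 := mul_le_mul_of_nonneg_left (key ‖v + a‖ (by linarith)) hh
    have h5 := abs_sub (f v) (f (v + a))
    have h6 : 0 ≤ h₀ * (Real.exp γ * ω) * Real.exp (-(γ / 4) * ‖v‖) := by positivity
    have h7 := hle v
    have h8 := hle (v + a)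
    linarith

/-- Cutoff and weight multiply the hopping by at most a quadratic in γr times e^{γr/4}. With t =
γr/4 one has 4t + 16t² ≤ 36(1 + t + t²/2) ≤ 36 e^t, so half of the decay survives. -/
theorem quad_mul_exp_le {γ r : ℝ} (hγ : 0 ≤ γ) (hr : 0 ≤ r) :
    Real.exp (-γ * r) * ((γ * r + (γ * r) ^ 2) * Real.exp (γ / 4 * r)) ≤
      36 * Real.exp (-(γ / 2) * r) := by
  have h0 : 0 ≤ γ * r / 4 := by positivity
  have h1 := Real.quadratic_le_exp_of_nonneg h0
  have h2 : γ * r + (γ * r) ^ 2 ≤ 36 * Real.exp (γ / 4 * r) := by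
    rw [show γ / 4 * r = γ * r / 4 by ring]
    nlinarith
  have h3 : Real.exp (-γ * r) * Real.exp (γ / 4 * r) * Real.exp (γ / 4 * r) =
      Real.exp (-(γ / 2) * r) := by
    rw [← Real.exp_add, ← Real.exp_add]; congr 1; ring
  rw [← h3]
  have h4 := mul_le_mul_of_nonneg_left h2
    (mul_nonneg (Real.exp_nonneg (-γ * r)) (Real.exp_nonneg (γ / 4 * r)))
  linarith

namespace TBModel

variable {d M Nb : ℕ} {S : Type}

/-- The size of the perturbation of the Hamiltonian by a displacement whose bonds of length below
`ρ` are strained by at most `ω`. -/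
noncomputable def perturbation (γ ω ρ s : ℝ) : ℝ :=
  Real.exp γ * ω + 2 * Real.exp (γ * s) * Real.exp (-(γ / 4) * ρ)

/-- Weak strain is required only of bonds at the column site y: the hopping term is such a bond, and
the on-site sum occurs only if x and y share a site. A cutoff acting on columns can therefore remove
the strongly strained sites. -/
theorem abs_entry_sub_le (X : TBModel d M Nb S) {h₀ γ₀ C : ℝ} (hh₀ : 0 < h₀) (hγ₀ : 0 < γ₀)
    (hX : X.IsTB h₀ γ₀) {u : X.Site → EuclideanSpace ℝ (Fin d)} {C₀ C₁ : ℝ}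
    (hC₀ : X.ExpSumBound 0 γ₀ C₀) (hC₁ : X.ExpSumBound u γ₀ C₁)
    (hC : X.ExpSumBound 0 (γ₀ / 4) C) {ω ρ s : ℝ} (hω : ω ≤ 1) (hω0 : 0 ≤ ω) (hs : 0 ≤ s)
    (hfar : ∀ x y, ‖u x - u y‖ ≤ X.refDist x y / 2 + s) (x y : X.Orb)
    (hnear : ∀ n, ‖u n - u y.1‖ ≤ ω ∨ ρ ≤ X.refDist n y.1) :
    |X.entry 0 x y - X.entry u x y| ≤
      X.entryMajorant (h₀ * perturbation γ₀ ω ρ s) (γ₀ / 4) C 0 x.1 y.1 := by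
  have hp : 0 ≤ perturbation γ₀ ω ρ s := by rw [perturbation]; positivity
  have hrev : ∀ n n', X.refDist n n' = X.refDist n' n := fun n n' => norm_sub_rev (X.pos n) (X.pos n')
  rw [entry_eq, entry_eq, add_sub_add_comm, entryMajorant]
  refine (abs_add_le _ _).trans (add_le_add ?_ ?_)
  · rw [Multilattice.bond_eq _ u, Multilattice.bond_zero]
    obtain ⟨⟨h1, h2⟩, -⟩ := hX x.2 y.2 (X.species x.1.1) (X.species y.1.1)
    exact abs_sub_le_of_near_or_far hh₀.le hγ₀.le h1 h2 hω hω0 (hnear x.1) (hfar x.1 y.1) hs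
  · by_cases hxy : x.1 = y.1
    · rw [if_pos hxy.symm, onsite, onsite, if_pos hxy, if_pos hxy,
        ← (X.summable_onsite hX hC₀ x y).tsum_sub (X.summable_onsite hX hC₁ x y),
        ← Real.norm_eq_abs]
      refine (tsum_of_norm_bounded (((hC x.1).1.mul_left
        (h₀ * perturbation γ₀ ω ρ s)).hasSum) fun n => ?_).trans ?_
      · by_cases hn : n = x.1
        · rw [if_pos hn, if_pos hn, sub_zero, norm_zero]
          positivity
        · rw [if_neg hn, if_neg hn, Multilattice.bond_eq _ u, Multilattice.bond_zero,
            Real.norm_eq_abs]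
          obtain ⟨-, h1, h2⟩ := hX x.2 y.2 (X.species x.1.1) (X.species n.1)
          refine abs_sub_le_of_near_or_far hh₀.le hγ₀.le h1 h2 hω hω0 ?_ (hfar x.1 n) hs
          have h3 := hnear n
          rw [← hxy, norm_sub_rev, hrev] at h3
          exact h3
      · rw [tsum_mul_left]
        exact mul_le_mul_of_nonneg_left (hC x.1).2 (by positivity)
    · rw [if_neg (Ne.symm hxy), onsite, onsite, if_neg hxy, if_neg hxy, sub_zero, abs_zero]

/-- The commutator entry splits into (H(v) − H(u)) j(y) and H(u) (j(y) − j(x) e^{w(x)−w(y)}). The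
second part vanishes when x and y share a site, so on-site energies do not enter it and the decay of
the hopping suffices. -/
theorem norm_localized_le (X : TBModel d M Nb S) {h₀ γ₀ : ℝ} (hh₀ : 0 < h₀) (hγ₀ : 0 < γ₀)
    (hX : X.IsTB h₀ γ₀) {u v : X.Site → EuclideanSpace ℝ (Fin d)} {C : ℝ}
    (hC : X.ExpSumBound u (γ₀ / 2) C)
    (hHv : HasMatrix (X.hamiltonian v) fun x y => (X.entry v x y : ℂ))
    (hHu : HasMatrix (X.hamiltonian u) fun x y => (X.entry u x y : ℂ))
    {j w : X.Site → ℝ} (hj : ∀ x, 0 ≤ j x ∧ j x ≤ 1) {W : ℝ} (hw : ∀ x, |w x| ≤ W)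
    {g : X.Site → X.Site → ℝ} {c θ : ℝ} (hθ : 0 ≤ θ)
    (hg : ∀ x y, |X.entry v x y - X.entry u x y| * j y.1 ≤ g x.1 y.1)
    (hg0 : ∀ x y, 0 ≤ g x y) (hsymm : ∀ x y, g x y = g y x) (hs : ∀ x, Summable (g x))
    (hc : ∀ x, ∑' y, g x y ≤ c)
    (hτ : ∀ x y, |j y - j x * Real.exp (w x - w y)| ≤ θ *
      ((γ₀ * ‖X.bond u x y‖ + (γ₀ * ‖X.bond u x y‖) ^ 2) * Real.exp (γ₀ / 4 * ‖X.bond u x y‖)))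
    {χ : EllTwo X.Orb} {z : ℂ} {x₀ : X.Orb}
    (hχ : z • χ - X.hamiltonian u χ = lp.single 2 x₀ (1 : ℂ)) (hw0 : w x₀.1 = 0) :
    ‖X.hamiltonian v (mulOp (fun x => j x.1) (mulOp (fun x => Real.exp (w x.1)) χ)) -
        z • mulOp (fun x => j x.1) (mulOp (fun x => Real.exp (w x.1)) χ)‖ ≤
      1 + Nb * (c + 36 * h₀ * θ * C) * ‖mulOp (fun x : X.Orb => Real.exp (w x.1)) χ‖ := by
  have hR : ∀ x, Summable fun y => 36 * h₀ * θ * Real.exp (-(γ₀ / 2) * ‖X.bond u x y‖) := fun x =>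
    (hC x).1.mul_left _
  refine norm_localized_resolvent_le hHv hHu hj hw (g := fun x y =>
    g x y + 36 * h₀ * θ * Real.exp (-(γ₀ / 2) * ‖X.bond u x y‖)) (fun x y => ?_)
    (fun x y => add_nonneg (hg0 x y) (by positivity))
    (fun x y => by rw [hsymm, X.norm_bond_comm]) (fun x => (hs x).add (hR x)) (fun x => ?_) hχ hw0
  · have h1 : (X.entry v x y : ℂ) * j y.1 -
        X.entry u x y * (j x.1 * Real.exp (w x.1 - w y.1) : ℝ) =
        (((X.entry v x y - X.entry u x y) * j y.1 +
          X.entry u x y * (j y.1 - j x.1 * Real.exp (w x.1 - w y.1)) : ℝ) : ℂ) := by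
      push_cast; ring
    rw [h1, Complex.norm_real, Real.norm_eq_abs]
    refine (abs_add_le _ _).trans (add_le_add ?_ ?_)
    · rw [abs_mul, abs_of_nonneg (hj _).1]
      exact hg x y
    · by_cases hxy : x.1 = y.1
      · rw [hxy, sub_self, Real.exp_zero, mul_one, sub_self, mul_zero, abs_zero]
        positivity
      · have h2 : |X.entry u x y| ≤ h₀ * Real.exp (-γ₀ * ‖X.bond u x.1 y.1‖) := by
          rw [entry_eq, onsite, if_neg hxy, add_zero]
          exact hX.abs_h_le _ _ _ _ _
        rw [abs_mul]
        refine (mul_le_mul h2 (hτ x.1 y.1) (abs_nonneg _) (by positivity)).trans ?_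
        have h3 := mul_le_mul_of_nonneg_left
          (quad_mul_exp_le hγ₀.le (norm_nonneg (X.bond u x.1 y.1))) (mul_nonneg hh₀.le hθ)
        linarith
  · rw [(hs x).tsum_add (hR x), tsum_mul_left]
    exact add_le_add (hc x) (mul_le_mul_of_nonneg_left (hC x).2 (by positivity))

theorem norm_apply_le_of_weighted {κ : Type*} [DecidableEq κ] {n : ℕ} {w : κ → ℝ} {W K : ℝ}
    (hw : ∀ x, |w x| ≤ W) {χ : EllTwo (κ × Fin n)}
    (h : ‖mulOp (fun x : κ × Fin n => Real.exp (w x.1)) χ‖ ≤ K) (x : κ × Fin n) :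
    ‖χ x‖ ≤ K * Real.exp (-w x.1) := by
  have h1 := (lp.norm_apply_le_norm (by norm_num)
    (mulOp (fun x : κ × Fin n => Real.exp (w x.1)) χ) x).trans h
  rw [mulOp_apply (C := Real.exp W) fun x => by
    rw [abs_of_pos (Real.exp_pos _)]; exact Real.exp_le_exp.2 ((le_abs_self _).trans (hw _)),
    norm_mul, Complex.norm_real, Real.norm_eq_abs, abs_of_pos (Real.exp_pos _)] at h1
  rw [Real.exp_neg, ← div_eq_mul_inv, le_div_iff₀ (Real.exp_pos _), mul_comm]
  exact h1

end TBModel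

/-! ### Exponential decay of the resolvent -/

namespace TBModel

variable {d M Nb : ℕ} {S : Type}

/-- `τ` is the part of the commutator of a bond with cutoff and weight; the weight varies slowly. -/
theorem abs_cutoff_weight_le {j j' Δ a η γ r : ℝ} (hγ : 0 < γ) (hr : 0 ≤ r)
    (hj' : 0 ≤ j' ∧ j' ≤ 1) (hη : 0 ≤ η) (hηγ : 4 * η ≤ γ) (ha : |j - j'| ≤ a * r) (ha0 : 0 ≤ a)
    (hΔ : |Δ| ≤ η * r) : |j - j' * Real.exp Δ| ≤ ((a + η) / γ) *
      ((γ * r + (γ * r) ^ 2) * Real.exp (γ / 4 * r)) := by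
  have h1 : j - j' * Real.exp Δ = (j - j') + j' * (1 - Real.exp Δ) := by ring
  have h2 : η * r ≤ γ / 4 * r := mul_le_mul_of_nonneg_right (by linarith) hr
  have h3 : |1 - Real.exp Δ| ≤ η * r * Real.exp (γ / 4 * r) :=
    (abs_one_sub_exp_le Δ).trans (mul_le_mul hΔ (Real.exp_le_exp.2 (hΔ.trans h2))
      (Real.exp_nonneg _) (by positivity))
  have h4 : 1 ≤ Real.exp (γ / 4 * r) := Real.one_le_exp (by positivity)
  have h5 : |j' * (1 - Real.exp Δ)| ≤ 1 * (η * r * Real.exp (γ / 4 * r)) := by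
    rw [abs_mul, abs_of_nonneg hj'.1]
    exact mul_le_mul hj'.2 h3 (abs_nonneg _) zero_le_one
  have h6 : a * r ≤ a * r * Real.exp (γ / 4 * r) := le_mul_of_one_le_right (by positivity) h4
  have h7 : (a + η) * r * Real.exp (γ / 4 * r) ≤ ((a + η) / γ) *
      ((γ * r + (γ * r) ^ 2) * Real.exp (γ / 4 * r)) := by
    rw [div_mul_eq_mul_div (a + η) γ, le_div_iff₀ hγ]
    have : 0 ≤ (a + η) * (γ * r) ^ 2 * Real.exp (γ / 4 * r) := by positivity
    linarith
  rw [h1]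
  refine (abs_add_le _ _).trans ?_
  linarith

/-- The weight is constant on short bonds. -/
theorem abs_cutoff_weight_le' {j j' Δ η L γ r : ℝ} (hL : 0 < L) (hγ : 0 < γ) (hr : 0 ≤ r)
    (hj' : 0 ≤ j' ∧ j' ≤ 1) (hη : 0 ≤ η) (hηγ : 4 * η ≤ γ) (ha : |j - j'| ≤ r / L)
    (hΔ : |Δ| ≤ η * r) (h0 : j' ≠ 0 → Δ ≠ 0 → 2 * L ≤ r) :
    |j - j' * Real.exp Δ| ≤ (1 / (L * γ)) *
      ((γ * r + (γ * r) ^ 2) * Real.exp (γ / 4 * r)) := by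
  have h4 : 1 ≤ Real.exp (γ / 4 * r) := Real.one_le_exp (by positivity)
  have e1 : (1 / (L * γ)) * ((γ * r + (γ * r) ^ 2) * Real.exp (γ / 4 * r)) =
      (r / L + γ * r ^ 2 / L) * Real.exp (γ / 4 * r) := by field_simp
  rw [e1]
  have h6 : r / L ≤ r / L * Real.exp (γ / 4 * r) := le_mul_of_one_le_right (by positivity) h4
  have h7 : 0 ≤ γ * r ^ 2 / L * Real.exp (γ / 4 * r) := by positivity
  by_cases hc : j' ≠ 0 ∧ Δ ≠ 0
  · have hLr := h0 hc.1 hc.2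
    have h1 : j - j' * Real.exp Δ = (j - j') + j' * (1 - Real.exp Δ) := by ring
    have h2 : η * r ≤ γ / 4 * r := mul_le_mul_of_nonneg_right (by linarith) hr
    have h3 : |1 - Real.exp Δ| ≤ η * r * Real.exp (γ / 4 * r) :=
      (abs_one_sub_exp_le Δ).trans (mul_le_mul hΔ (Real.exp_le_exp.2 (hΔ.trans h2))
        (Real.exp_nonneg _) (by positivity))
    have h5 : |j' * (1 - Real.exp Δ)| ≤ 1 * (η * r * Real.exp (γ / 4 * r)) := by
      rw [abs_mul, abs_of_nonneg hj'.1]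
      exact mul_le_mul hj'.2 h3 (abs_nonneg _) zero_le_one
    -- Since r ≥ 2L, ηr ≤ γr/4 ≤ γr²/(8L). The error is thus O(1/L) however large the slope η ≤ γ/4
    -- is.
    have h8 : η * r ≤ γ * r ^ 2 / L := by
      rw [le_div_iff₀ hL]
      have e2 := mul_le_mul_of_nonneg_right hηγ (mul_nonneg hr hL.le)
      have e3 := mul_le_mul_of_nonneg_left hLr (mul_nonneg hγ.le hr)
      have e4 : 0 ≤ γ * r * L := by positivity
      nlinarith
    have h9 := mul_le_mul_of_nonneg_right h8 (Real.exp_nonneg (γ / 4 * r))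
    rw [h1]
    refine (abs_add_le _ _).trans ?_
    linarith
  · have h1 : j' * Real.exp Δ = j' := by
      rw [not_and_or, not_not, not_not] at hc
      rcases hc with hc | hc
      · rw [hc, zero_mul]
      · rw [hc, Real.exp_zero, mul_one]
    rw [h1]
    linarith

/-- Decay of the resolvent without strongly strained bonds. -/
theorem norm_resolvent_le_of_unstrained (X : TBModel d M Nb S) {h₀ γ₀ : ℝ} (hh₀ : 0 < h₀)
    (hγ₀ : 0 < γ₀) (hX : X.IsTB h₀ γ₀) {u : X.Site → EuclideanSpace ℝ (Fin d)}
    {C₀ C₁ C₂ C₄ : ℝ} (hC₀ : X.ExpSumBound 0 γ₀ C₀) (hC₁ : X.ExpSumBound u γ₀ C₁)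
    (hC₂ : X.ExpSumBound u (γ₀ / 2) C₂) (hC₄ : X.ExpSumBound 0 (γ₀ / 4) C₄) (hC₄0 : 0 < C₄)
    (hH : HasMatrix (X.hamiltonian 0) fun x y => (X.entry 0 x y : ℂ))
    (hHu : HasMatrix (X.hamiltonian u) fun x y => (X.entry u x y : ℂ))
    {ω ρ s : ℝ} (hω : ω ≤ 1) (hω0 : 0 ≤ ω) (hs : 0 ≤ s)
    (hfar : ∀ x y, ‖u x - u y‖ ≤ X.refDist x y / 2 + s)
    (hnear : ∀ x y, ‖u x - u y‖ ≤ ω ∨ ρ ≤ X.refDist x y)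
    {η : ℝ} (hη : 0 ≤ η) (hηγ : 4 * η ≤ γ₀) {w : X.Site → ℝ} {W : ℝ} (hw : ∀ x, |w x| ≤ W)
    (hwl : ∀ x y, |w x - w y| ≤ η * ‖X.bond u x y‖) {g : ℝ} (hg : 0 < g)
    (hsmall : Nb * (2 * (h₀ * perturbation γ₀ ω ρ s) * C₄ + 36 * h₀ * (η / γ₀) * C₂) ≤ g / 4)
    {χ : EllTwo X.Orb} {z : ℂ} (hgap : ∀ ψ, g / 2 * ‖ψ‖ ≤ ‖X.hamiltonian 0 ψ - z • ψ‖)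
    {x₀ : X.Orb} (hχ : z • χ - X.hamiltonian u χ = lp.single 2 x₀ (1 : ℂ)) (hw0 : w x₀.1 = 0)
    (x : X.Orb) : ‖χ x‖ ≤ 4 / g * Real.exp (-w x.1) := by
  refine norm_apply_le_of_weighted hw ?_ x
  have hp : 0 < h₀ * perturbation γ₀ ω ρ s := by rw [perturbation]; positivity
  obtain ⟨m1, m2, m3, m4⟩ := X.entryMajorant_spec hp hC₄0 hC₄
  have key := X.norm_localized_le hh₀ hγ₀ hX hC₂ hH hHu (j := fun _ => 1)
    (fun _ => ⟨zero_le_one, le_rfl⟩) hw (θ := (0 + η) / γ₀) (by positivity)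
    (fun x y => by
      rw [mul_one]
      exact X.abs_entry_sub_le hh₀ hγ₀ hX hC₀ hC₁ hC₄ hω hω0 hs hfar x y fun n => hnear n y.1)
    m1 m2 m3 m4 (fun x y => abs_cutoff_weight_le hγ₀ (norm_nonneg _)
      ⟨zero_le_one, le_rfl⟩ hη hηγ (by simp) le_rfl (hwl x y)) hχ hw0
  have hJ : mulOp (fun x : X.Orb => (fun _ => (1 : ℝ)) x.1)
      (mulOp (fun x : X.Orb => Real.exp (w x.1)) χ) = mulOp (fun x : X.Orb => Real.exp (w x.1)) χ := by
    ext x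
    rw [mulOp_apply (C := 1) fun x => by simp, Complex.ofReal_one, one_mul]
  rw [hJ, zero_add] at key
  -- The lower bound g/2 beats the commutator g/4, which leaves (g/4)‖Vχ‖ ≤ 1.
  have h1 := (hgap _).trans key
  have h2 := mul_le_mul_of_nonneg_right hsmall
    (norm_nonneg (mulOp (fun x : X.Orb => Real.exp (w x.1)) χ))
  rw [le_div_iff₀ hg]
  linarith

/-- Decay of the resolvent away from a set `B` of sites with strongly strained bonds. -/
theorem norm_resolvent_le_of_strained (X : TBModel d M Nb S) {h₀ γ₀ : ℝ} (hh₀ : 0 < h₀)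
    (hγ₀ : 0 < γ₀) (hX : X.IsTB h₀ γ₀) {u : X.Site → EuclideanSpace ℝ (Fin d)}
    {C₀ C₁ C₂ C₄ : ℝ} (hC₀ : X.ExpSumBound 0 γ₀ C₀) (hC₁ : X.ExpSumBound u γ₀ C₁)
    (hC₂ : X.ExpSumBound u (γ₀ / 2) C₂) (hC₄ : X.ExpSumBound 0 (γ₀ / 4) C₄) (hC₄0 : 0 < C₄)
    (hH : HasMatrix (X.hamiltonian 0) fun x y => (X.entry 0 x y : ℂ))
    (hHu : HasMatrix (X.hamiltonian u) fun x y => (X.entry u x y : ℂ))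
    {ω ρ s : ℝ} (hω : ω ≤ 1) (hω0 : 0 ≤ ω) (hs : 0 ≤ s)
    (hfar : ∀ x y, ‖u x - u y‖ ≤ X.refDist x y / 2 + s) {B : Set X.Site}
    (hnear : ∀ x, ∀ y ∉ B, ‖u x - u y‖ ≤ ω ∨ ρ ≤ X.refDist x y)
    {η L : ℝ} (hη : 0 ≤ η) (hηγ : 4 * η ≤ γ₀) (hL : 0 < L) {w : X.Site → ℝ} {W : ℝ}
    (hw : ∀ x, |w x| ≤ W) (hwl : ∀ x y, |w x - w y| ≤ η * ‖X.bond u x y‖)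
    (hwB : ∀ b ∈ B, ∀ x y, ‖X.bond u x b‖ < 4 * L → ‖X.bond u y b‖ < 4 * L → w x = w y)
    {g δ : ℝ} (hg : 0 < g) (hδ : 0 < δ)
    (hsmall : Nb * (2 * (h₀ * perturbation γ₀ ω ρ s) * C₄ +
      36 * h₀ * ((1 / L + η) / γ₀) * C₂) ≤ g / 4)
    (hsmall' : Nb * (0 + 36 * h₀ * (1 / (L * γ₀)) * C₂) ≤ δ / 4)
    {χ : EllTwo X.Orb} {z : ℂ} (hgap : ∀ ψ, g / 2 * ‖ψ‖ ≤ ‖X.hamiltonian 0 ψ - z • ψ‖)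
    (hgap' : ∀ ψ, δ * ‖ψ‖ ≤ ‖X.hamiltonian u ψ - z • ψ‖)
    {x₀ : X.Orb} (hχ : z • χ - X.hamiltonian u χ = lp.single 2 x₀ (1 : ℂ)) (hw0 : w x₀.1 = 0)
    (x : X.Orb) : ‖χ x‖ ≤ 4 * (2 / g + 1 / δ) * Real.exp (-w x.1) := by
  refine norm_apply_le_of_weighted hw ?_ x
  have hp : 0 < h₀ * perturbation γ₀ ω ρ s := by rw [perturbation]; positivity
  obtain ⟨m1, m2, m3, m4⟩ := X.entryMajorant_spec hp hC₄0 hC₄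
  obtain ⟨j, hj, hjl, hjB, hj0⟩ := exists_cutoff (fun x => X.pos x + u x) B hL
  have hdist : ∀ x y, dist (X.pos x + u x) (X.pos y + u y) = ‖X.bond u x y‖ := fun x y =>
    dist_eq_norm _ _
  simp only [hdist] at hjl hj0
  have hj' : ∀ x, 0 ≤ 1 - j x ∧ 1 - j x ≤ 1 := fun x => by
    have := hj x; constructor <;> linarith
  have hjl' : ∀ x y, |j y - j x| ≤ ‖X.bond u x y‖ / L := fun x y => by
    rw [abs_sub_comm]; exact hjl x y
  -- Outer part: H(u) is compared with H(0). Columns in B are annihilated because 1 − j vanishes on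
  -- B, and all other columns are weakly strained.
  have key0 := X.norm_localized_le hh₀ hγ₀ hX hC₂ hH hHu (j := fun x => 1 - j x)
    hj' hw (θ := (1 / L + η) / γ₀) (by positivity)
    (fun x y => by
      by_cases hy : y.1 ∈ B
      · rw [hjB _ hy, sub_self, mul_zero]
        exact m1 _ _
      · refine (mul_le_of_le_one_right (abs_nonneg _) (hj' _).2).trans ?_
        exact X.abs_entry_sub_le hh₀ hγ₀ hX hC₀ hC₁ hC₄ hω hω0 hs hfar x y fun n => hnear n _ hy)
    m1 m2 m3 m4 (fun x y => abs_cutoff_weight_le hγ₀ (norm_nonneg _)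
      (hj' x) hη hηγ (by
        rw [sub_sub_sub_cancel_left, one_div, inv_mul_eq_div]
        exact hjl x y) (by positivity) (hwl x y)) hχ hw0
  -- Inner part: H(u) is compared with itself and its own lower bound δ is used. The cutoff lives
  -- within 2L of B, so a bond shorter than 2L that starts there stays within 4L of a point of B,
  -- where w is constant. Hence the weight contributes only on longer bonds.
  have key1 := X.norm_localized_le hh₀ hγ₀ hX hC₂ hHu hHu hj hw (θ := 1 / (L * γ₀))
    (by positivity) (g := fun _ _ => 0) (c := 0)
    (fun x y => by rw [sub_self, abs_zero, zero_mul]) (fun _ _ => le_rfl) (fun _ _ => rfl)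
    (fun _ => summable_zero) (fun _ => by rw [tsum_zero])
    (fun x y => abs_cutoff_weight_le' hL hγ₀ (norm_nonneg _) (hj x) hη hηγ (hjl' x y) (hwl x y)
      fun h1 h2 => by
        by_contra! h3
        obtain ⟨b, hb, h4⟩ := hj0 x h1
        refine h2 (sub_eq_zero.2 (hwB b hb x y (by linarith) ?_))
        have h5 := dist_triangle (X.pos y + u y) (X.pos x + u x) (X.pos b + u b)
        rw [hdist, hdist, hdist, X.norm_bond_comm u y x] at h5
        linarith) hχ hw0
  have h0 := (hgap _).trans key0
  have h1 := (hgap' _).trans key1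
  set ψ := mulOp (fun x : X.Orb => Real.exp (w x.1)) χ
  have hsum : ψ = mulOp (fun x : X.Orb => (fun x => 1 - j x) x.1) ψ +
      mulOp (fun x : X.Orb => j x.1) ψ := by
    ext x
    have c1 : ∀ x : X.Orb, |(fun x => 1 - j x) x.1| ≤ 1 := fun x => by
      simp only [abs_of_nonneg (hj' _).1]; exact (hj' _).2
    have c2 : ∀ x : X.Orb, |j x.1| ≤ 1 := fun x => by
      rw [abs_of_nonneg (hj _).1]; exact (hj _).2
    rw [lp.coeFn_add, Pi.add_apply, mulOp_apply c1, mulOp_apply c2]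
    push_cast
    ring
  have h2 := norm_add_le (mulOp (fun x : X.Orb => (fun x => 1 - j x) x.1) ψ)
    (mulOp (fun x : X.Orb => j x.1) ψ)
  rw [← hsum] at h2
  have h3 := mul_le_mul_of_nonneg_right hsmall (norm_nonneg ψ)
  have h4 := mul_le_mul_of_nonneg_right hsmall' (norm_nonneg ψ)
  generalize ‖mulOp (fun x : X.Orb => (fun x => 1 - j x) x.1) ψ‖ = a at h0 h2
  generalize ‖mulOp (fun x : X.Orb => j x.1) ψ‖ = b at h1 h2
  -- The two parts absorb 1/2 and 1/4 of ‖ψ‖; the remaining quarter gives the factor 4 in the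
  -- conclusion.
  have ha : a ≤ 2 / g + ‖ψ‖ / 2 := by
    rw [← sub_le_iff_le_add, le_div_iff₀ hg]
    linarith
  have hb : b ≤ 1 / δ + ‖ψ‖ / 4 := by
    rw [← sub_le_iff_le_add, le_div_iff₀ hδ]
    linarith
  linarith

end TBModel

/-! ### The derivative of the density matrix through resolvent vectors -/

theorem circleIntegral_comp_continuousLinearMap {E F : Type*} [NormedAddCommGroup E]
    [NormedSpace ℂ E] [CompleteSpace E] [NormedAddCommGroup F] [NormedSpace ℂ F] [CompleteSpace F]
    (Φ : E →L[ℂ] F) {f : ℂ → E} {c : ℂ} {R : ℝ} (hf : CircleIntegrable f c R) :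
    (∮ z in C(c, R), Φ (f z)) = Φ (∮ z in C(c, R), f z) := by
  rw [circleIntegral, circleIntegral, ← Φ.intervalIntegral_comp_comm hf.out]
  simp only [map_smul]

section

variable {H : Type*} [NormedAddCommGroup H] [InnerProductSpace ℂ H] [CompleteSpace H]

/-- Matrix elements of the derivative of a spectral projection. -/
theorem norm_inner_circleIntegral_resolvent_le {T A' : H →L[ℂ] H} (hT : IsSelfAdjoint T) {c R : ℝ}
    (hR : 0 ≤ R) (hU : ∀ z ∈ Metric.sphere (c : ℂ) R, IsUnit (algebraMap ℂ (H →L[ℂ] H) z - T))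
    {e e' : H} {K : ℝ}
    (hK : ∀ χ χ' : H, (∃ z ∈ Metric.sphere (c : ℂ) R, z • χ - T χ = e) →
      (∃ z ∈ Metric.sphere (c : ℂ) R, z • χ' - T χ' = e') → ‖(inner ℂ χ' (A' χ) : ℂ)‖ ≤ K) :
    ‖(inner ℂ e' (((2 * Real.pi * Complex.I : ℂ)⁻¹ •
      ∮ z in C((c : ℂ), R), resolvent T z * A' * resolvent T z) e) : ℂ)‖ ≤ R * K := by
  have hcont : ContinuousOn (fun z => resolvent T z) (Metric.sphere (c : ℂ) R) := fun z hz =>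
    ((continuousAt_resolvent_prod (hU z hz)).comp (f := fun z : ℂ => (T, z))
      (by fun_prop)).continuousWithinAt
  have hint : CircleIntegrable (fun z => resolvent T z * A' * resolvent T z) (c : ℂ) R :=
    ((hcont.mul continuousOn_const).mul hcont).circleIntegrable hR
  let Φ : (H →L[ℂ] H) →L[ℂ] ℂ :=
    (innerSL ℂ e').comp (ContinuousLinearMap.apply ℂ H e)
  have h1 : (inner ℂ e' (((2 * Real.pi * Complex.I : ℂ)⁻¹ •
      ∮ z in C((c : ℂ), R), resolvent T z * A' * resolvent T z) e) : ℂ) =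
      (2 * Real.pi * Complex.I : ℂ)⁻¹ •
        ∮ z in C((c : ℂ), R), Φ (resolvent T z * A' * resolvent T z) := by
    rw [circleIntegral_comp_continuousLinearMap Φ hint, ← map_smul]
    rfl
  rw [h1]
  refine circleIntegral.norm_two_pi_i_inv_smul_integral_le_of_norm_le_const hR fun z hz => ?_
  have h2 : Φ (resolvent T z * A' * resolvent T z) =
      inner ℂ (star (resolvent T z) e') (A' (resolvent T z e)) := by
    rw [ContinuousLinearMap.star_eq_adjoint, ContinuousLinearMap.adjoint_inner_left]
    rfl
  have h3 : (algebraMap ℂ (H →L[ℂ] H) z - T) * resolvent T z = 1 :=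
    Ring.mul_inverse_cancel _ (hU z hz)
  have h4 : resolvent T z * (algebraMap ℂ (H →L[ℂ] H) z - T) = 1 :=
    Ring.inverse_mul_cancel _ (hU z hz)
  have h5 : (algebraMap ℂ (H →L[ℂ] H) (starRingEnd ℂ z) - T) * star (resolvent T z) = 1 := by
    have := congrArg star h4
    rwa [star_mul, star_sub, star_one, hT.star_eq, ← algebraMap_star_comm] at this
  rw [h2]
  -- The left factor is moved to the other side of the inner product as the resolvent at the
  -- conjugate point, which lies on the same circle since the centre is real.
  refine hK _ _ ⟨z, hz, ?_⟩ ⟨starRingEnd ℂ z, ?_, ?_⟩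
  · have := congrArg (fun S : H →L[ℂ] H => S e) h3
    simpa [Algebra.algebraMap_eq_smul_one] using this
  · rw [Metric.mem_sphere, dist_eq_norm] at hz ⊢
    rw [← hz, ← RCLike.norm_conj (z - c), map_sub, Complex.conj_ofReal]
  · have := congrArg (fun S : H →L[ℂ] H => S e') h5
    simpa [Algebra.algebraMap_eq_smul_one] using this

end

namespace TBModel

variable {d M Nb : ℕ} {S : Type}

/-- Differentiability of the density matrix and a bound for its derivative in terms of the decay
of the resolvent. -/
theorem exists_hasDerivAt_densityEntry (X : TBModel d M Nb S) {h₀ γ₀ m C C' C₂ : ℝ} (hh₀ : 0 < h₀)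
    (hγ₀ : 0 < γ₀) (hm : 0 < m) (hX : X.IsTB h₀ γ₀) {u : X.Site → EuclideanSpace ℝ (Fin d)}
    (hu : X.Separated m u) (hC : X.ExpSumBound u γ₀ C)
    (hC' : ∀ v : X.Site → EuclideanSpace ℝ (Fin d), X.Separated (m / 2) v →
      X.ExpSumBound v γ₀ C') (hC₂ : X.ExpSumBound u (γ₀ / 2) C₂) {εF E R : ℝ}
    (hE : Disjoint (Set.uIcc εF E) (realSpectrum (X.hamiltonian u)))
    (hR : ‖X.hamiltonian u‖ + |E| < 2 * R) (ℓ k : X.Site) (i : Fin d) (a b : Fin Nb)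
    {w : X.Site → ℝ} {η κ : ℝ} (hη : 0 ≤ η) (hηγ : 4 * η ≤ γ₀)
    (hw : ∀ x y, |w x - w y| ≤ η * ‖X.bond u x y‖) (hκ : 0 ≤ κ)
    (hdecay : ∀ z ∈ Metric.sphere ((E - R : ℝ) : ℂ) R, ∀ (c : Fin Nb) (χ : EllTwo X.Orb),
      z • χ - X.hamiltonian u χ = lp.single 2 (ℓ, c) (1 : ℂ) →
      ∀ x, ‖χ x‖ ≤ κ * Real.exp (-w x.1)) :
    ∃ ρ' : ℂ, HasDerivAt (fun s : ℝ => X.densityEntry εF (X.shiftCoord u k i s) ℓ ℓ a b) ρ' 0 ∧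
      ‖ρ'‖ ≤ R * (κ ^ 2 * (4 * h₀ * (Nb * (Nb * C₂))) * Real.exp (-2 * w k)) := by
  have hR0 : 0 < R := by linarith [norm_nonneg (X.hamiltonian u), abs_nonneg E]
  obtain ⟨H', α, β, hH', hsum, hα, hβ⟩ :=
    X.exists_hasDerivAt_hamiltonian hh₀ hγ₀ hm hX hu hC hC' k i
  have hsa : ∀ᶠ s in 𝓝 (0 : ℝ), IsSelfAdjoint (X.hamiltonian (X.shiftCoord u k i s)) := by
    filter_upwards [Metric.closedBall_mem_nhds (0 : ℝ) (half_pos hm)] with s hs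
    rw [Metric.mem_closedBall, Real.dist_eq, sub_zero] at hs
    exact (hamiltonian_spec X hγ₀ hX (half_pos hm) (X.separated_shiftCoord hu k i hs)).2
  have h1 := hasDerivAt_fermiProjection (ε := εF) (E := E) (R := R) hH' hsa
    (by rw [shiftCoord_zero]; exact hE) (by rw [shiftCoord_zero]; exact hR)
  rw [shiftCoord_zero] at h1
  set P := ((2 * Real.pi * Complex.I : ℂ)⁻¹ • ∮ z in C(((E - R : ℝ) : ℂ), R),
    resolvent (X.hamiltonian u) z * H' * resolvent (X.hamiltonian u) z) with hP
  have hsau := (hamiltonian_spec X hγ₀ hX hm hu).2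
  have hEs : E ∉ realSpectrum (X.hamiltonian u) := Set.disjoint_left.1 hE Set.right_mem_uIcc
  refine ⟨inner ℂ (lp.single 2 (ℓ, a) (1 : ℂ) : EllTwo X.Orb) (P (lp.single 2 (ℓ, b) (1 : ℂ))),
    ?_, ?_⟩
  · have h2 := (((innerSL ℂ (lp.single 2 (ℓ, a) (1 : ℂ) : EllTwo X.Orb)).comp
      (ContinuousLinearMap.apply ℂ (EllTwo X.Orb) (lp.single 2 (ℓ, b) (1 : ℂ) :
        EllTwo X.Orb))).restrictScalars ℝ).hasFDerivAt.comp_hasDerivAt (0 : ℝ) h1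
    refine h2.congr_of_eventuallyEq (Eventually.of_forall fun s => ?_)
    exact EllTwo.apply_eq_inner _ _
  · refine norm_inner_circleIntegral_resolvent_le hsau hR0.le
      (fun z hz => isUnit_on_sphere hsau hEs hR hz) ?_
    rintro χ χ' ⟨z, hz, hχ⟩ ⟨z', hz', hχ'⟩
    exact X.norm_inner_deriv_le hh₀ hC₂ hsum hα hβ hη hηγ hw hκ (hdecay z hz b χ hχ)
      (hdecay z' hz' a χ' hχ')

end TBModel

/-! ### Algebraic prefactors and the choice of the rate -/

/-- Cancelling g − 1 leaves c q! g^{-(q+1)} (1 + g + … + g^{q−1}), which is at least its first term.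
-/
theorem algPrefactor_ge {c g : ℝ} (hc : 0 ≤ c) (hg : 0 < g) {q : ℕ} (hq : 1 ≤ q) :
    c / g ^ (q + 1) ≤ algPrefactor c q g := by
  have hf : (1 : ℝ) ≤ q ! := by exact_mod_cast Nat.one_le_iff_ne_zero.2 (Nat.factorial_ne_zero q)
  have hcf : c ≤ c * q ! := le_mul_of_one_le_right hc hf
  rw [algPrefactor]
  split_ifs with h
  · rw [h, one_pow, div_one]
    exact hcf.trans (le_mul_of_one_le_right (by positivity) (by exact_mod_cast hq))
  · have h1 : (g ^ q - 1) / (g ^ (q + 1) * (g - 1)) =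
        (∑ j ∈ Finset.range q, g ^ j) / g ^ (q + 1) := by
      rw [geom_sum_eq h, div_div, mul_comm (g - 1)]
    have h2 : 1 ≤ ∑ j ∈ Finset.range q, g ^ j := by
      have := Finset.single_le_sum (f := fun j => g ^ j) (fun j _ => by positivity)
        (Finset.mem_range.2 hq : 0 ∈ Finset.range q)
      simpa using this
    rw [h1, ← mul_div_assoc]
    exact div_le_div_of_nonneg_right (hcf.trans (le_mul_of_one_le_right (by positivity) h2))
      (by positivity)

theorem algPrefactor_nonneg {c g : ℝ} (hc : 0 ≤ c) (hg : 0 < g) {q : ℕ} (hq : 1 ≤ q) :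
    0 ≤ algPrefactor c q g := le_trans (by positivity) (algPrefactor_ge hc hg hq)

theorem exp_neg_mul_le_inv_pow {η r : ℝ} (hη : 0 < η) (hr : 0 ≤ r) (n : ℕ) :
    Real.exp (-2 * η * r) ≤ Real.exp (2 * η) * n ! / (2 * η * (1 + r)) ^ n := by
  have h1 : 0 < 2 * η * (1 + r) := by positivity
  have h2 := Real.pow_div_factorial_le_exp _ h1.le n
  rw [div_le_iff₀ (by positivity)] at h2
  rw [le_div_iff₀ (by positivity)]
  have h3 : Real.exp (-2 * η * r) * Real.exp (2 * η * (1 + r)) = Real.exp (2 * η) := by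
    rw [← Real.exp_add]; congr 1; ring
  calc _ ≤ Real.exp (-2 * η * r) * (Real.exp (2 * η * (1 + r)) * n !) :=
        mul_le_mul_of_nonneg_left h2 (Real.exp_nonneg _)
    _ = _ := by rw [← mul_assoc, h3]

/-- Half of the exponential decay pays for the algebraic prefactor. -/
theorem exp_decay_le_algPrefactor {K γ c₁ g η r : ℝ} (hK : 0 ≤ K) (hc₁ : 0 < c₁) (hg : 0 < g)
    (hη : c₁ * g ≤ η) (hηγ : 2 * η ≤ γ) (hr : 0 ≤ r) {q : ℕ} (hq : 1 ≤ q) :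
    K / g ^ 2 * Real.exp (-4 * η * r) ≤
      (algPrefactor (K * (Real.exp γ * (2 * q)! / (2 * c₁) ^ (2 * q)) + 1) q g /
        (1 + r) ^ q) ^ 2 * Real.exp (-2 * η * r) := by
  have hη0 : 0 < η := lt_of_lt_of_le (by positivity) hη
  set c := K * (Real.exp γ * (2 * q)! / (2 * c₁) ^ (2 * q)) with hc
  have hc0 : 0 ≤ c := by positivity
  have h1 : Real.exp (-4 * η * r) = Real.exp (-2 * η * r) * Real.exp (-2 * η * r) := by
    rw [← Real.exp_add]; congr 1; ring
  rw [h1, ← mul_assoc]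
  refine mul_le_mul_of_nonneg_right ?_ (Real.exp_nonneg _)
  have h2 : Real.exp (-2 * η * r) ≤
      Real.exp γ * (2 * q)! / (2 * c₁) ^ (2 * q) / (g ^ (2 * q) * (1 + r) ^ (2 * q)) := by
    refine (exp_neg_mul_le_inv_pow hη0 hr (2 * q)).trans ?_
    rw [div_div, ← mul_pow, ← mul_pow]
    refine div_le_div₀ (by positivity) ?_ (by positivity) ?_
    · exact mul_le_mul_of_nonneg_right (Real.exp_le_exp.2 hηγ) (by positivity)
    · refine pow_le_pow_left₀ (by positivity) ?_ _
      have := mul_le_mul_of_nonneg_right hη (by positivity : 0 ≤ 2 * (1 + r))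
      linarith
  -- The power 2q is chosen so that g^{-2} (g(1+r))^{-2q} is exactly the square of g^{-(q+1)}
  -- (1+r)^{-q}.
  have h3 : K / g ^ 2 * Real.exp (-2 * η * r) ≤ c / (g ^ (q + 1) * (1 + r) ^ q) ^ 2 := by
    refine (mul_le_mul_of_nonneg_left h2 (by positivity)).trans (le_of_eq ?_)
    rw [hc]
    field_simp
    ring
  have h4 : c ≤ (c + 1) ^ 2 := by nlinarith
  have h5 := algPrefactor_ge (c := c + 1) (by linarith) hg hq
  refine h3.trans ?_
  calc c / (g ^ (q + 1) * (1 + r) ^ q) ^ 2 ≤ (c + 1) ^ 2 / (g ^ (q + 1) * (1 + r) ^ q) ^ 2 :=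
        div_le_div_of_nonneg_right h4 (by positivity)
    _ = ((c + 1) / g ^ (q + 1) / (1 + r) ^ q) ^ 2 := by rw [div_div, div_pow]
    _ ≤ _ := pow_le_pow_left₀ (by positivity)
        (div_le_div_of_nonneg_right h5 (by positivity)) 2

theorem exp_decay_le_sq {P A B η r : ℝ} (hA : 0 ≤ A) (hB : √P ≤ B) (hP : 0 ≤ P) (hη : 0 ≤ η)
    (hr : 0 ≤ r) :
    P * Real.exp (-4 * η * r) ≤ (A + B) ^ 2 * Real.exp (-2 * η * r) := by
  have h1 : P ≤ (A + B) ^ 2 := by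
    rw [← Real.sq_sqrt hP]
    exact pow_le_pow_left₀ (Real.sqrt_nonneg _) (by linarith) 2
  refine mul_le_mul h1 (Real.exp_le_exp.2 ?_) (Real.exp_nonneg _) (by positivity)
  have := mul_nonneg hη hr
  linarith

/-- The decay rate is a small multiple of the gap. -/
theorem exists_rate {d : ℕ} {h₀ γ₀ Q T : ℝ} (hh₀ : 0 < h₀) (hγ₀ : 0 < γ₀) (hQ : 0 ≤ Q)
    (hT : 0 < T) : ∃ c₀ : ℝ, 0 < c₀ ∧ ∃ c₁ : ℝ, 0 < c₁ ∧ ∀ g : ℝ, 0 < g → g ≤ T →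
      c₁ * g ≤ etaMinus d c₀ h₀ γ₀ g ∧ 16 * etaMinus d c₀ h₀ γ₀ g ≤ γ₀ ∧
      Q * (4 * etaMinus d c₀ h₀ γ₀ g) ≤ g / 12 := by
  -- The first summand enforces 16η ≤ γ₀ through η ≤ c₀h₀, the second 48Qη ≤ g through η ≤ c₀γ₀^d g.
  set c₀ : ℝ := 1 / (16 * h₀ / γ₀ + 48 * Q * γ₀ ^ d) with hc₀
  have hden : 0 < 16 * h₀ / γ₀ + 48 * Q * γ₀ ^ d := by positivity
  have hc : 0 < c₀ := by positivity
  have hc1 : c₀ * (16 * h₀ / γ₀ + 48 * Q * γ₀ ^ d) = 1 := by rw [hc₀]; field_simp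
  have e1 : c₀ * (16 * h₀ / γ₀) ≤ 1 := by
    have : 0 ≤ c₀ * (48 * Q * γ₀ ^ d) := by positivity
    linarith
  have e2 : c₀ * (48 * Q * γ₀ ^ d) ≤ 1 := by
    have : 0 ≤ c₀ * (16 * h₀ / γ₀) := by positivity
    linarith
  -- As g ≤ T, one has h₀ ≥ (h₀/T) g; so the rate is bounded below by a multiple of g in both cases
  -- of the minimum.
  refine ⟨c₀, hc, c₀ * min (h₀ / T) (γ₀ ^ d), by positivity, fun g hg hgT => ⟨?_, ?_, ?_⟩⟩
  · rw [etaMinus, mul_assoc]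
    refine mul_le_mul_of_nonneg_left (le_min ?_ ?_) hc.le
    · calc min (h₀ / T) (γ₀ ^ d) * g ≤ h₀ / T * g :=
            mul_le_mul_of_nonneg_right (min_le_left _ _) hg.le
        _ ≤ h₀ / T * T := mul_le_mul_of_nonneg_left hgT (by positivity)
        _ = h₀ := by field_simp
    · exact mul_le_mul_of_nonneg_right (min_le_right _ _) hg.le
  · have h1 : etaMinus d c₀ h₀ γ₀ g ≤ c₀ * h₀ :=
      mul_le_mul_of_nonneg_left (min_le_left _ _) hc.le
    have h2 : c₀ * (16 * h₀ / γ₀) = 16 * (c₀ * h₀) / γ₀ := by ring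
    rw [h2, div_le_one hγ₀] at e1
    linarith
  · have h1 : etaMinus d c₀ h₀ γ₀ g ≤ c₀ * (γ₀ ^ d * g) :=
      mul_le_mul_of_nonneg_left (min_le_right _ _) hc.le
    have h2 := mul_le_mul_of_nonneg_left h1 (mul_nonneg hQ zero_le_four)
    have h3 := mul_le_mul_of_nonneg_right e2 hg.le
    linarith

theorem realSpectrum_nonempty {H : Type*} [NormedAddCommGroup H] [InnerProductSpace ℂ H]
    [CompleteSpace H] [Nontrivial H] {T : H →L[ℂ] H} (hT : IsSelfAdjoint T) :
    (realSpectrum T).Nonempty := ContinuousFunctionalCalculus.spectrum_nonempty T hT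

theorem isClosed_realSpectrum {H : Type*} [NormedAddCommGroup H] [InnerProductSpace ℂ H]
    [CompleteSpace H] (T : H →L[ℂ] H) : IsClosed (realSpectrum T) := spectrum.isClosed T

/-! ### Locality for weak and for general strains -/

namespace TBModel

variable {d M Nb : ℕ} {S : Type}

theorem exists_perturbation_le {γ p : ℝ} (hγ : 0 < γ) (hp : 0 < p) (s : ℝ) :
    ∃ ω ρ : ℝ, 0 < ω ∧ ω ≤ 1 ∧ perturbation γ ω ρ s ≤ p := by
  -- Each of the two terms of `perturbation` becomes at most p/2; for the second, e^{-x} ≤ 1/x.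
  refine ⟨min 1 (p / (2 * Real.exp γ)), 4 / γ * (4 * Real.exp (γ * s) / p), by positivity,
    min_le_left _ _, ?_⟩
  have h1 : Real.exp γ * min 1 (p / (2 * Real.exp γ)) ≤ p / 2 := by
    refine (mul_le_mul_of_nonneg_left (min_le_right _ _) (Real.exp_nonneg _)).trans (le_of_eq ?_)
    field_simp
  have h2 : -(γ / 4) * (4 / γ * (4 * Real.exp (γ * s) / p)) = -(4 * Real.exp (γ * s) / p) := by
    field_simp
  set x := 4 * Real.exp (γ * s) / p with hx
  have hx0 : 0 < x := by positivity
  have h3 : Real.exp (-x) ≤ 1 / x := by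
    rw [Real.exp_neg, ← one_div]
    exact one_div_le_one_div_of_le hx0 (by linarith [Real.add_one_le_exp x])
  have h4 : 2 * Real.exp (γ * s) * (1 / x) = p / 2 := by
    rw [hx]; field_simp; norm_num
  have h5 := mul_le_mul_of_nonneg_left h3 (by positivity : 0 ≤ 2 * Real.exp (γ * s))
  rw [perturbation, h2]
  linarith

/-- The data that determine the constants in the locality estimates. -/
structure Bounds (X : TBModel d M Nb S) (m h₀ γ₀ A₁ A₁' A₂ A₄ : ℝ) (N₀ : ℕ) : Prop where
  m_pos : 0 < m
  h_pos : 0 < h₀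
  γ_pos : 0 < γ₀
  A₁_pos : 0 < A₁
  A₂_pos : 0 < A₂
  A₄_pos : 0 < A₄
  tb : X.IsTB h₀ γ₀
  bound₁ : ∀ v, X.Separated m v → X.ExpSumBound v γ₀ A₁
  bound₁' : ∀ v, X.Separated (m / 2) v → X.ExpSumBound v γ₀ A₁'
  bound₂ : ∀ v, X.Separated m v → X.ExpSumBound v (γ₀ / 2) A₂
  bound₄ : ∀ v, X.Separated m v → X.ExpSumBound v (γ₀ / 4) A₄
  separated : X.Separated m 0
  gap_pos : 0 < X.gapMinus N₀
  midGap_le : |X.midGap N₀| ≤ Nb * (2 * h₀ * A₁)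
  gap_le : ∀ ψ : EllTwo X.Orb, X.gapMinus N₀ / 2 * ‖ψ‖ ≤
    ‖X.hamiltonian 0 ψ - (X.midGap N₀ : ℂ) • ψ‖

theorem refDist_half_sub_le (X : TBModel d M Nb S) {u : X.Site → EuclideanSpace ℝ (Fin d)} {s : ℝ}
    (hfar : ∀ x y, ‖u x - u y‖ ≤ X.refDist x y / 2 + s) (x y : X.Site) :
    X.refDist x y / 2 - s ≤ ‖X.bond u x y‖ := by
  have h1 := norm_sub_le (X.bond u x y) (u x - u y)
  have h2 : X.bond u x y - (u x - u y) = X.pos x - X.pos y := by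
    rw [Multilattice.bond_eq]; abel
  rw [h2] at h1
  have h3 := hfar x y
  have h4 : X.refDist x y = ‖X.pos x - X.pos y‖ := rfl
  linarith

namespace Bounds

variable {X : TBModel d M Nb S} {m h₀ γ₀ A₁ A₁' A₂ A₄ : ℝ} {N₀ : ℕ}

theorem norm_add_abs_le (b : Bounds X m h₀ γ₀ A₁ A₁' A₂ A₄ N₀)
    {u : X.Site → EuclideanSpace ℝ (Fin d)} (hu : X.Separated m u) :
    ‖X.hamiltonian u‖ + |X.midGap N₀| ≤ 2 * (Nb * (2 * h₀ * A₁)) := by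
  have h1 := X.norm_hamiltonian_le b.h_pos b.A₁_pos b.tb (b.bound₁ u hu)
    (hamiltonian_spec X b.γ_pos b.tb b.m_pos hu).1
  linarith [b.midGap_le]

theorem norm_sub_le_of_mem_sphere (b : Bounds X m h₀ γ₀ A₁ A₁' A₂ A₄ N₀)
    {u : X.Site → EuclideanSpace ℝ (Fin d)} (hu : X.Separated m u) {R : ℝ}
    (hR : 2 * (Nb * (2 * h₀ * A₁)) + 1 = R) {z : ℂ}
    (hz : z ∈ Metric.sphere ((X.midGap N₀ - R : ℝ) : ℂ) R) (ψ : EllTwo X.Orb) :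
    ‖X.hamiltonian u ψ - (X.midGap N₀ : ℂ) • ψ‖ ≤ ‖X.hamiltonian u ψ - z • ψ‖ := by
  have h1 := b.norm_add_abs_le hu
  have h2 := norm_nonneg (X.hamiltonian u)
  have h3 := abs_nonneg (X.midGap N₀)
  refine norm_sub_smul_le_of_mem_sphere (hamiltonian_spec X b.γ_pos b.tb b.m_pos hu).2
    (by linarith) ?_ hz
  refine (norm_sub_le _ _).trans ?_
  rw [norm_smul, Complex.norm_real, Real.norm_eq_abs]
  have h4 := (X.hamiltonian u).le_opNorm ψ
  have h5 := mul_le_mul_of_nonneg_right (h1.trans (by linarith : _ ≤ R)) (norm_nonneg ψ)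
  linarith

/-- Distances may be halved by the deformation, so slope 4η leaves w(k) ≈ 2ηr in the reference
metric, and the two resolvents together give e^{-4ηr}. The offset s and the flattening loss n go
into the prefactor. -/
theorem exp_weight_le {η s r R n wk : ℝ} (hη : 0 ≤ η) (hw : 4 * η * (R - n) ≤ wk)
    (hr : r / 2 - s ≤ R) :
    Real.exp (-2 * wk) ≤ Real.exp (8 * η * (s + n)) * Real.exp (-4 * η * r) := by
  rw [← Real.exp_add]
  refine Real.exp_le_exp.2 ?_
  have := mul_le_mul_of_nonneg_left hr hη
  linarith

/-- Differentiability and decay for weakly strained configurations. -/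
theorem exists_hasDerivAt_of_unstrained (b : Bounds X m h₀ γ₀ A₁ A₁' A₂ A₄ N₀)
    {u : X.Site → EuclideanSpace ℝ (Fin d)} (hu : X.Separated m u) {R η ω ρ s εF : ℝ}
    (hR : 2 * (Nb * (2 * h₀ * A₁)) + 1 = R)
    (hE : Disjoint (Set.uIcc εF (X.midGap N₀)) (realSpectrum (X.hamiltonian u)))
    (hη : 0 ≤ η) (hηγ : 16 * η ≤ γ₀)
    (hηg : Nb * (36 * h₀ * A₂ / γ₀) * (4 * η) ≤ X.gapMinus N₀ / 12)
    (hω : ω ≤ 1) (hω0 : 0 ≤ ω) (hs : 0 ≤ s)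
    (hp : Nb * (2 * h₀ * A₄) * perturbation γ₀ ω ρ s ≤ X.gapMinus N₀ / 12)
    (hfar : ∀ x y, ‖u x - u y‖ ≤ X.refDist x y / 2 + s)
    (hnear : ∀ x y, ‖u x - u y‖ ≤ ω ∨ ρ ≤ X.refDist x y)
    (ℓ k : X.Site) (i : Fin d) (a a' : Fin Nb) :
    ∃ ρ' : ℂ, HasDerivAt (fun s : ℝ => X.densityEntry εF (X.shiftCoord u k i s) ℓ ℓ a a') ρ' 0 ∧
      ‖ρ'‖ ≤ R * (4 / X.gapMinus N₀) ^ 2 * (4 * h₀ * (Nb * (Nb * A₂))) *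
        Real.exp (8 * η * s) * Real.exp (-4 * η * X.refDist ℓ k) := by
  have hg := b.gap_pos
  have hA₂ := b.A₂_pos
  have hh := b.h_pos
  have hR1 := b.norm_add_abs_le hu
  have hR0 : 0 < R := by linarith [norm_nonneg (X.hamiltonian u), abs_nonneg (X.midGap N₀)]
  have hη4 : 4 * (4 * η) ≤ γ₀ := by linarith
  obtain ⟨w, hwℓ, hwb, hwl, -, hwk⟩ := exists_weight (fun x => X.pos x + u x)
    (Set.finite_empty (α := X.Site)) le_rfl (by linarith : 0 ≤ 4 * η) ℓ k
  have hdist : ∀ x y, dist (X.pos x + u x) (X.pos y + u y) = ‖X.bond u x y‖ := fun x y =>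
    dist_eq_norm _ _
  simp only [hdist] at hwl hwk
  obtain ⟨ρ', h1, h2⟩ := X.exists_hasDerivAt_densityEntry b.h_pos b.γ_pos b.m_pos b.tb hu
    (b.bound₁ u hu) b.bound₁' (b.bound₂ u hu) (R := R) hE (by linarith) ℓ k i a a'
    (by linarith : 0 ≤ 4 * η) hη4 hwl (κ := 4 / X.gapMinus N₀) (by positivity)
    (fun z hz c χ hχ => X.norm_resolvent_le_of_unstrained b.h_pos b.γ_pos b.tb
      (b.bound₁ 0 b.separated) (b.bound₁ u hu) (b.bound₂ u hu) (b.bound₄ 0 b.separated) b.A₄_pos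
      (hamiltonian_spec X b.γ_pos b.tb b.m_pos b.separated).1
      (hamiltonian_spec X b.γ_pos b.tb b.m_pos hu).1 hω hω0 hs hfar hnear
      (by linarith : 0 ≤ 4 * η) hη4 hwb hwl hg (by
        have : (Nb : ℝ) * (2 * (h₀ * perturbation γ₀ ω ρ s) * A₄ +
            36 * h₀ * (4 * η / γ₀) * A₂) = Nb * (2 * h₀ * A₄) * perturbation γ₀ ω ρ s +
            Nb * (36 * h₀ * A₂ / γ₀) * (4 * η) := by ring
        rw [this]; linarith)
      (fun ψ => (b.gap_le ψ).trans (b.norm_sub_le_of_mem_sphere b.separated hR hz ψ)) hχ hwℓ)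
  refine ⟨ρ', h1, h2.trans ?_⟩
  have hr : X.refDist ℓ k / 2 - s ≤ ‖X.bond u k ℓ‖ := by
    rw [X.norm_bond_comm]; exact X.refDist_half_sub_le hfar ℓ k
  have h3 := exp_weight_le hη hwk hr
  rw [Set.ncard_empty, Nat.cast_zero, mul_zero, add_zero] at h3
  have h4 := mul_le_mul_of_nonneg_left h3
    (by positivity : 0 ≤ R * (4 / X.gapMinus N₀) ^ 2 * (4 * h₀ * (Nb * (Nb * A₂))))
  linarith

/-- Differentiability and decay for configurations with finitely many strongly strained sites. -/
theorem exists_hasDerivAt_of_strained (b : Bounds X m h₀ γ₀ A₁ A₁' A₂ A₄ N₀)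
    {u : X.Site → EuclideanSpace ℝ (Fin d)} (hu : X.Separated m u) {R η ω ρ s εF L δ n : ℝ}
    (hR : 2 * (Nb * (2 * h₀ * A₁)) + 1 = R)
    (hE : Disjoint (Set.uIcc εF (X.midGap N₀)) (realSpectrum (X.hamiltonian u)))
    (hη : 0 ≤ η) (hηγ : 16 * η ≤ γ₀)
    (hηg : Nb * (36 * h₀ * A₂ / γ₀) * (4 * η) ≤ X.gapMinus N₀ / 12)
    (hω : ω ≤ 1) (hω0 : 0 ≤ ω) (hs : 0 ≤ s)
    (hp : Nb * (2 * h₀ * A₄) * perturbation γ₀ ω ρ s ≤ X.gapMinus N₀ / 12)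
    (hfar : ∀ x y, ‖u x - u y‖ ≤ X.refDist x y / 2 + s) (hδ : X.specDist N₀ u = δ) (hδ0 : 0 < δ)
    (hL : 0 < L) (hLg : Nb * (36 * h₀ * A₂ / γ₀) / L ≤ X.gapMinus N₀ / 12)
    (hLδ : Nb * (36 * h₀ * A₂ / γ₀) / L ≤ δ / 4)
    (hfin : (X.strained u ρ ω).Finite) (hn : ((X.strained u ρ ω).ncard : ℝ) ≤ n)
    (ℓ k : X.Site) (i : Fin d) (a a' : Fin Nb) :
    ∃ ρ' : ℂ, HasDerivAt (fun s : ℝ => X.densityEntry εF (X.shiftCoord u k i s) ℓ ℓ a a') ρ' 0 ∧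
      ‖ρ'‖ ≤ R * (4 * (2 / X.gapMinus N₀ + 1 / δ)) ^ 2 * (4 * h₀ * (Nb * (Nb * A₂))) *
        Real.exp (8 * η * (s + 2 * (4 * L) * n)) * Real.exp (-4 * η * X.refDist ℓ k) := by
  have hg := b.gap_pos
  have hA₂ := b.A₂_pos
  have hh := b.h_pos
  have hγ := b.γ_pos
  have hR1 := b.norm_add_abs_le hu
  have hR0 : 0 < R := by linarith [norm_nonneg (X.hamiltonian u), abs_nonneg (X.midGap N₀)]
  have hη4 : 4 * (4 * η) ≤ γ₀ := by linarith
  obtain ⟨w, hwℓ, hwb, hwl, hwB, hwk⟩ := exists_weight (fun x => X.pos x + u x)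
    hfin (by linarith : 0 ≤ 4 * L) (by linarith : 0 ≤ 4 * η) ℓ k
  have hdist : ∀ x y, dist (X.pos x + u x) (X.pos y + u y) = ‖X.bond u x y‖ := fun x y =>
    dist_eq_norm _ _
  simp only [hdist] at hwl hwk hwB
  have hspec := (hamiltonian_spec X b.γ_pos b.tb b.m_pos hu)
  have hEs : X.midGap N₀ ∉ realSpectrum (X.hamiltonian u) :=
    Set.disjoint_left.1 hE Set.right_mem_uIcc
  obtain ⟨ρ', h1, h2⟩ := X.exists_hasDerivAt_densityEntry b.h_pos b.γ_pos b.m_pos b.tb hu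
    (b.bound₁ u hu) b.bound₁' (b.bound₂ u hu) (R := R) hE (by linarith) ℓ k i a a'
    (by linarith : 0 ≤ 4 * η) hη4 hwl (κ := 4 * (2 / X.gapMinus N₀ + 1 / δ)) (by positivity)
    (fun z hz c χ hχ => X.norm_resolvent_le_of_strained b.h_pos b.γ_pos b.tb
      (b.bound₁ 0 b.separated) (b.bound₁ u hu) (b.bound₂ u hu) (b.bound₄ 0 b.separated) b.A₄_pos
      (hamiltonian_spec X b.γ_pos b.tb b.m_pos b.separated).1 hspec.1 hω hω0 hs hfar
      (B := X.strained u ρ ω) (fun x y hy => by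
        by_contra! h
        exact hy ⟨x, h.2.le, h.1⟩)
      (by linarith : 0 ≤ 4 * η) hη4 hL hwb hwl hwB hg hδ0 (by
        have : (Nb : ℝ) * (2 * (h₀ * perturbation γ₀ ω ρ s) * A₄ +
            36 * h₀ * ((1 / L + 4 * η) / γ₀) * A₂) = Nb * (2 * h₀ * A₄) * perturbation γ₀ ω ρ s +
            Nb * (36 * h₀ * A₂ / γ₀) * (4 * η) + Nb * (36 * h₀ * A₂ / γ₀) / L := by ring
        rw [this]; linarith)
      (by
        have : (Nb : ℝ) * (0 + 36 * h₀ * (1 / (L * γ₀)) * A₂) =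
            Nb * (36 * h₀ * A₂ / γ₀) / L := by field_simp; ring
        rw [this]; exact hLδ)
      (fun ψ => (b.gap_le ψ).trans (b.norm_sub_le_of_mem_sphere b.separated hR hz ψ))
      (fun ψ => by
        rw [← hδ]
        exact (infDist_realSpectrum_mul_norm_le hspec.2 hEs ψ).trans
          (b.norm_sub_le_of_mem_sphere hu hR hz ψ)) hχ hwℓ)
  refine ⟨ρ', h1, h2.trans ?_⟩
  have hr : X.refDist ℓ k / 2 - s ≤ ‖X.bond u k ℓ‖ := by
    rw [X.norm_bond_comm]; exact X.refDist_half_sub_le hfar ℓ k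
  have h3 := exp_weight_le hη hwk hr
  have h5 : Real.exp (8 * η * (s + 2 * (4 * L) * (X.strained u ρ ω).ncard)) ≤
      Real.exp (8 * η * (s + 2 * (4 * L) * n)) := by
    refine Real.exp_le_exp.2 ?_
    have := mul_le_mul_of_nonneg_left hn (by positivity : 0 ≤ 8 * η * (2 * (4 * L)))
    linarith
  have h6 := h3.trans (mul_le_mul_of_nonneg_right h5 (Real.exp_nonneg _))
  have h4 := mul_le_mul_of_nonneg_left h6
    (by positivity : 0 ≤ R * (4 * (2 / X.gapMinus N₀ + 1 / δ)) ^ 2 *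
      (4 * h₀ * (Nb * (Nb * A₂))))
  linarith

/-- A site with an orbital makes the space nontrivial, hence the spectrum nonempty; the distance to
an empty spectrum would be zero. -/
theorem specDist_pos (b : Bounds X m h₀ γ₀ A₁ A₁' A₂ A₄ N₀)
    {u : X.Site → EuclideanSpace ℝ (Fin d)} (hu : X.Separated m u) (ℓ : X.Site) (a : Fin Nb)
    (hE : X.midGap N₀ ∉ realSpectrum (X.hamiltonian u)) : 0 < X.specDist N₀ u := by
  have hsa := (hamiltonian_spec X b.γ_pos b.tb b.m_pos hu).2
  have hnt : Nontrivial (EllTwo X.Orb) := by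
    refine ⟨lp.single 2 (ℓ, a) (1 : ℂ), 0, fun h => ?_⟩
    have := EllTwo.norm_single_one ((ℓ, a) : X.Orb)
    rw [h, norm_zero] at this
    exact zero_ne_one this
  exact ((isClosed_realSpectrum _).notMem_iff_infDist_pos (realSpectrum_nonempty hsa)).1 hE

end Bounds

end TBModel

namespace TBModel.Bounds

variable {d M Nb : ℕ} {S : Type} {X : TBModel d M Nb S} {m h₀ γ₀ A₁ A₁' A₂ A₄ : ℝ} {N₀ : ℕ}

/-- Locality for all sufficiently small strains, with model independent constants. -/
theorem exists_locality_small (b : Bounds X m h₀ γ₀ A₁ A₁' A₂ A₄ N₀) {Υ R η εF : ℝ} (hΥ : 0 < Υ)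
    (hR : 2 * (Nb * (2 * h₀ * A₁)) + 1 = R) (hη : 0 ≤ η) (hηγ : 16 * η ≤ γ₀)
    (hηg : Nb * (36 * h₀ * A₂ / γ₀) * (4 * η) ≤ X.gapMinus N₀ / 12) :
    ∃ D₀ : ℝ, 0 < D₀ ∧ ∀ u ∈ X.Adm Υ, X.Separated m u →
      Disjoint (Set.uIcc εF (X.midGap N₀)) (realSpectrum (X.hamiltonian u)) →
      X.strainNorm Υ u < D₀ → ∀ (ℓ k : X.Site) (i : Fin d) (a a' : Fin Nb), ∃ ρ' : ℂ,
      HasDerivAt (fun s : ℝ => X.densityEntry εF (X.shiftCoord u k i s) ℓ ℓ a a') ρ' 0 ∧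
      ‖ρ'‖ ≤ 16 * R * (4 * h₀ * (Nb * (Nb * A₂))) * Real.exp γ₀ / X.gapMinus N₀ ^ 2 *
        Real.exp (-4 * η * X.refDist ℓ k) := by
  have hg := b.gap_pos
  have hA₂ := b.A₂_pos
  have hA₄ := b.A₄_pos
  have hA₁ := b.A₁_pos
  have hh := b.h_pos
  have hR0 : 0 < R := by rw [← hR]; positivity
  obtain ⟨K, hK, hgrow⟩ := X.exists_norm_sub_le Υ hΥ
  have hp0 : 0 < X.gapMinus N₀ / 12 / (Nb * (2 * h₀ * A₄) + 1) := by positivity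
  obtain ⟨ω, ρ, hω0, hω1, hp⟩ := exists_perturbation_le b.γ_pos hp0 1
  -- The first two thresholds make the offset of the sublinear growth at most 1; the third keeps
  -- every bond of length at most ρ strained by at most ω. They depend on the model, but the
  -- prefactor below does not, since the offset is the fixed number 1.
  refine ⟨min 1 (min (1 / (4 * (K + 1))) (ω * Real.exp (-(Υ * ρ)))), by positivity, ?_⟩
  intro u hu hsep hE hD ℓ k i a a'
  have hD0 : 0 ≤ X.strainNorm Υ u := Real.sqrt_nonneg _
  obtain ⟨hD1, hD2, hD3⟩ := by simpa only [lt_min_iff] using hD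
  have hfar : ∀ x y, ‖u x - u y‖ ≤ X.refDist x y / 2 + 1 := by
    intro x y
    have h1 := hgrow u hu.1 x y
    rw [lt_div_iff₀ (by positivity)] at hD2
    have h2 : K * (X.strainNorm Υ u + X.strainNorm Υ u ^ 2) ≤ 1 / 2 := by
      have h3 : X.strainNorm Υ u ^ 2 ≤ X.strainNorm Υ u := by nlinarith
      have h4 := mul_le_mul_of_nonneg_left h3 hK
      nlinarith
    linarith
  have hnear : ∀ x y, ‖u x - u y‖ ≤ ω ∨ ρ ≤ X.refDist x y := by
    intro x y
    rcases le_total ρ (X.refDist x y) with h | h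
    · exact Or.inr h
    · left
      have h1 := Multilattice.norm_sub_le_strainNorm hu.1 x y
      have h2 : Real.exp (Υ * X.refDist x y) ≤ Real.exp (Υ * ρ) :=
        Real.exp_le_exp.2 (mul_le_mul_of_nonneg_left h hΥ.le)
      refine h1.trans ((mul_le_mul hD3.le h2 (Real.exp_nonneg _) (by positivity)).trans ?_)
      rw [mul_assoc, ← Real.exp_add, neg_add_cancel, Real.exp_zero, mul_one]
  obtain ⟨ρ', h1, h2⟩ := b.exists_hasDerivAt_of_unstrained hsep hR hE hη hηγ hηg hω1 hω0.le
    zero_le_one (by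
      refine (mul_le_mul_of_nonneg_left hp (by positivity)).trans ?_
      rw [← mul_div_assoc, div_le_iff₀ (by positivity)]
      nlinarith) hfar hnear ℓ k i a a'
  refine ⟨ρ', h1, h2.trans (mul_le_mul_of_nonneg_right ?_ (Real.exp_nonneg _))⟩
  have h3 : Real.exp (8 * η * 1) ≤ Real.exp γ₀ := Real.exp_le_exp.2 (by linarith)
  calc _ ≤ R * (4 / X.gapMinus N₀) ^ 2 * (4 * h₀ * (Nb * (Nb * A₂))) * Real.exp γ₀ :=
        mul_le_mul_of_nonneg_left h3 (by positivity)
    _ = _ := by rw [div_pow]; ring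

/-- Locality for all strains. -/
theorem exists_locality (b : Bounds X m h₀ γ₀ A₁ A₁' A₂ A₄ N₀) {Υ R η εF : ℝ} (hΥ : 0 < Υ)
    (hR : 2 * (Nb * (2 * h₀ * A₁)) + 1 = R) (hη : 0 ≤ η) (hηγ : 16 * η ≤ γ₀)
    (hηg : Nb * (36 * h₀ * A₂ / γ₀) * (4 * η) ≤ X.gapMinus N₀ / 12) :
    ∃ P : ℝ → ℝ → ℝ, (∀ D δ, 0 ≤ P D δ) ∧ ∀ u ∈ X.Adm Υ, X.Separated m u →
      Disjoint (Set.uIcc εF (X.midGap N₀)) (realSpectrum (X.hamiltonian u)) →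
      ∀ (ℓ k : X.Site) (i : Fin d) (a a' : Fin Nb), ∃ ρ' : ℂ,
      HasDerivAt (fun s : ℝ => X.densityEntry εF (X.shiftCoord u k i s) ℓ ℓ a a') ρ' 0 ∧
      ‖ρ'‖ ≤ P (X.strainNorm Υ u) (X.specDist N₀ u) *
        Real.exp (-4 * η * X.refDist ℓ k) := by
  have hg := b.gap_pos
  have hA₂ := b.A₂_pos
  have hA₄ := b.A₄_pos
  have hA₁ := b.A₁_pos
  have hh := b.h_pos
  have hγ := b.γ_pos
  have hR0 : 0 < R := by rw [← hR]; positivity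
  obtain ⟨K, hK, hgrow⟩ := X.exists_norm_sub_le Υ hΥ
  have hp0 : 0 < X.gapMinus N₀ / 12 / (Nb * (2 * h₀ * A₄) + 1) := by positivity
  choose ω ρ hω0 hω1 hp using fun s => exists_perturbation_le b.γ_pos hp0 s
  -- As functions of D = ‖Du‖ and δ = 𝔡(u): s is the offset in the sublinear growth, n bounds the
  -- number of strongly strained sites, and L is wide enough that the cutoff error is below both
  -- gap/12 and δ/4.
  obtain ⟨s, hs⟩ : ∃ s : ℝ → ℝ, ∀ D, s D = 1 / 2 + K * (D + D ^ 2) := ⟨_, fun _ => rfl⟩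
  obtain ⟨n, hn⟩ : ∃ n : ℝ → ℝ, ∀ D, n D = D ^ 2 * Real.exp (2 * Υ * ρ (s D)) / ω (s D) ^ 2 :=
    ⟨_, fun _ => rfl⟩
  obtain ⟨Q, hQ⟩ : ∃ Q : ℝ, Q = Nb * (36 * h₀ * A₂ / γ₀) := ⟨_, rfl⟩
  have hQ0 : 0 ≤ Q := by rw [hQ]; positivity
  obtain ⟨L, hL⟩ : ∃ L : ℝ → ℝ, ∀ δ, L δ = Q * (12 / X.gapMinus N₀ + 4 / δ) + 1 :=
    ⟨_, fun _ => rfl⟩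
  refine ⟨fun D δ => R * (4 * (2 / X.gapMinus N₀ + 1 / δ)) ^ 2 * (4 * h₀ * (Nb * (Nb * A₂))) *
    Real.exp (8 * η * (s D + 2 * (4 * L δ) * n D)), fun D δ => by positivity, ?_⟩
  intro u hu hsep hE ℓ k i a a'
  have hD0 : 0 ≤ X.strainNorm Υ u := Real.sqrt_nonneg _
  have hδ : 0 < X.specDist N₀ u :=
    b.specDist_pos hsep ℓ a (Set.disjoint_left.1 hE Set.right_mem_uIcc)
  have hL0 : 0 < L (X.specDist N₀ u) := by rw [hL]; positivity
  obtain ⟨hf1, hf2⟩ := Multilattice.finite_strained hΥ hu.1 (r := ρ (s (X.strainNorm Υ u)))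
    (hω0 (s (X.strainNorm Υ u)))
  refine b.exists_hasDerivAt_of_strained hsep hR hE hη hηγ hηg (hω1 _) (hω0 _).le ?_ ?_ ?_ rfl hδ
    hL0 ?_ ?_ hf1 (hf2.trans_eq (hn _).symm) ℓ k i a a'
  · rw [hs]; positivity
  · refine (mul_le_mul_of_nonneg_left (hp _) (by positivity)).trans ?_
    rw [← mul_div_assoc, div_le_iff₀ (by positivity)]
    nlinarith
  · intro x y
    have h1 := hgrow u hu.1 x y
    rw [hs]
    linarith
  · rw [← hQ, div_le_iff₀ hL0, hL]
    have e1 : X.gapMinus N₀ / 12 * (Q * (12 / X.gapMinus N₀ + 4 / X.specDist N₀ u) + 1) =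
      Q + X.gapMinus N₀ / 12 * (Q * (4 / X.specDist N₀ u) + 1) := by field_simp; ring
    rw [e1]
    exact le_add_of_nonneg_right (by positivity)
  · rw [← hQ, div_le_iff₀ hL0, hL]
    have e1 : X.specDist N₀ u / 4 * (Q * (12 / X.gapMinus N₀ + 4 / X.specDist N₀ u) + 1) =
      Q + X.specDist N₀ u / 4 * (Q * (12 / X.gapMinus N₀) + 1) := by field_simp; ring
    rw [e1]
    exact le_add_of_nonneg_right (by positivity)

end TBModel.Bounds

/-! ### The choice of the constants -/

theorem mainTheorem3 (d Nb : ℕ) (m h₀ γ₀ : ℝ) (hm : 0 < m) (hh₀ : 0 < h₀) (hγ₀ : 0 < γ₀) :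
    ∃ c₀ : ℝ, 0 < c₀ ∧ ∀ M : ℕ, ∃ (c : ℝ) (c' : ℕ → ℝ), 0 < c ∧ (∀ q, 0 < c' q) ∧
      ∀ (S : Type) (X : TBModel d M Nb S) (Υ : ℝ) (N₀ : ℕ) (εF : ℝ),
        X.IsTB h₀ γ₀ → 0 < Υ → X.IsFermiLevel N₀ εF →
        ∃ C C' : ℝ → ℝ → ℝ,
          (∀ D δ, 0 < C D δ) ∧
          (∀ D δ, 0 ≤ C' D δ) ∧
          (∀ δ, 0 < δ → Tendsto (fun D => C' D δ) (𝓝[≥] 0) (𝓝 0)) ∧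
          ∀ u ∈ X.Adm Υ, X.Separated m u →
            Disjoint (Set.uIcc εF (X.midGap N₀)) (realSpectrum (X.hamiltonian u)) →
            ∀ (ℓ k : X.Site) (i : Fin d) (a b : Fin Nb), ℓ ≠ k →
              ∃ ρ' : ℂ,
                HasDerivAt (fun s : ℝ => X.densityEntry εF (X.shiftCoord u k i s) ℓ ℓ a b) ρ' 0 ∧
                ∀ q : ℕ, 1 ≤ q →
                  ‖ρ'‖ ≤ (algPrefactor c q (X.gapMinus N₀) / (1 + X.refDist ℓ k) ^ q +
                        C (X.strainNorm Υ u) (X.specDist N₀ u)) ^ 2 *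
                      Real.exp (-2 * etaMinus d c₀ h₀ γ₀ (X.gapMinus N₀) * X.refDist ℓ k) ∧
                  ‖ρ'‖ ≤ (algPrefactor (c' q) q (X.gapMinus N₀) / (1 + X.refDist ℓ k) ^ q +
                        C' (X.strainNorm Υ u) (X.specDist N₀ u)) ^ 2 *
                      Real.exp (-2 * etaMinus d c₀ h₀ γ₀ (X.gapMinus N₀) * X.refDist ℓ k) := by
  obtain ⟨A₁, hA₁, b₁⟩ := TBModel.exists_expSumBound d hm hγ₀
  obtain ⟨A₁', -, b₁'⟩ := TBModel.exists_expSumBound d (half_pos hm) hγ₀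
  obtain ⟨A₂, hA₂, b₂⟩ := TBModel.exists_expSumBound d hm (half_pos hγ₀)
  obtain ⟨A₄, hA₄, b₄⟩ := TBModel.exists_expSumBound d hm (by linarith : 0 < γ₀ / 4)
  obtain ⟨R, hR⟩ : ∃ R : ℝ, 2 * (Nb * (2 * h₀ * A₁)) + 1 = R := ⟨_, rfl⟩
  have hR0 : 0 < R := by rw [← hR]; positivity
  -- The rate constants are fixed before M and the model appear; R serves as the a priori bound for
  -- the gap.
  obtain ⟨c₀, hc₀, c₁, hc₁, hrate⟩ := exists_rate (d := d) hh₀ hγ₀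
    (by positivity : 0 ≤ Nb * (36 * h₀ * A₂ / γ₀)) hR0
  obtain ⟨K, hKdef⟩ : ∃ K : ℝ, K = 16 * R * (4 * h₀ * (Nb * (Nb * A₂))) * Real.exp γ₀ := ⟨_, rfl⟩
  have hK : 0 ≤ K := by rw [hKdef]; positivity
  -- In the first estimate C(u) alone dominates, so any positive c will do. The factor growing with
  -- q is needed only in c'_q, where the algebraic term must carry the bound for small strains.
  refine ⟨c₀, hc₀, fun M => ⟨1, fun q => K * (Real.exp γ₀ * (2 * q)! / (2 * c₁) ^ (2 * q)) + 1,
    one_pos, fun q => by positivity, fun S X Υ N₀ εF hX hΥ hF => ?_⟩⟩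
  -- If the reference crystal is not m-separated, then by `Multilattice.separated_zero` no
  -- admissible u is, and nothing remains to be shown.
  by_cases hsep : X.Separated m 0
  swap
  · exact ⟨fun _ _ => 1, fun _ _ => 0, fun _ _ => one_pos, fun _ _ => le_rfl,
      fun _ _ => tendsto_const_nhds, fun u hu hs =>
        absurd (Multilattice.separated_zero hΥ hu.1 hs) hsep⟩
  obtain ⟨hg, hg2, hmid, hgap⟩ := TBModel.reference_gap hh₀ hA₁ hX (b₁ X hsep)
    (TBModel.hamiltonian_spec X hγ₀ hX hm hsep).1 hF
  have b : TBModel.Bounds X m h₀ γ₀ A₁ A₁' A₂ A₄ N₀ :=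
    ⟨hm, hh₀, hγ₀, hA₁, hA₂, hA₄, hX, fun _ => b₁ X, fun _ => b₁' X, fun _ => b₂ X, fun _ => b₄ X,
      hsep, hg, hmid, hgap⟩
  obtain ⟨r₁, r₂, r₃⟩ := hrate _ hg (by linarith)
  have hη : 0 ≤ etaMinus d c₀ h₀ γ₀ (X.gapMinus N₀) := le_trans (by positivity) r₁
  obtain ⟨D₀, hD₀, hsmall⟩ := b.exists_locality_small (εF := εF) hΥ hR hη r₂ r₃
  obtain ⟨P, hP, hlarge⟩ := b.exists_locality (εF := εF) hΥ hR hη r₂ r₃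
  have hK2 : 0 ≤ K / X.gapMinus N₀ ^ 2 := by positivity
  -- C' vanishes below the threshold D₀, so its limit at zero strain is trivial. In C the summand 1
  -- only ensures strict positivity.
  refine ⟨fun D δ => if D < D₀ then √(K / X.gapMinus N₀ ^ 2) + 1 else √(P D δ) + 1,
    fun D δ => if D < D₀ then 0 else √(P D δ), fun D δ => by beta_reduce; split_ifs <;> positivity,
    fun D δ => by beta_reduce; split_ifs <;> positivity, fun δ _ => ?_, ?_⟩
  · refine tendsto_const_nhds.congr' ?_
    filter_upwards [nhdsWithin_le_nhds (Iio_mem_nhds hD₀)] with D hD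
    rw [if_pos (Set.mem_Iio.1 hD)]
  intro u hu hs hE ℓ k i a a' _
  have hr : 0 ≤ X.refDist ℓ k := norm_nonneg _
  have hpre : ∀ {c : ℝ} (q : ℕ), 0 ≤ c → 1 ≤ q →
      0 ≤ algPrefactor c q (X.gapMinus N₀) / (1 + X.refDist ℓ k) ^ q := fun q hc hq =>
    div_nonneg (algPrefactor_nonneg hc hg hq) (by positivity)
  by_cases hD : X.strainNorm Υ u < D₀
  · obtain ⟨ρ', h1, h2⟩ := hsmall u hu hs hE hD ℓ k i a a'
    rw [← hKdef] at h2
    refine ⟨ρ', h1, fun q hq => ⟨h2.trans ?_, h2.trans ?_⟩⟩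
    · beta_reduce
      rw [if_pos hD]
      exact exp_decay_le_sq (hpre q zero_le_one hq) (by linarith) hK2 hη hr
    · beta_reduce
      rw [if_pos hD, add_zero]
      exact exp_decay_le_algPrefactor hK hc₁ hg r₁ (by linarith) hr hq
  · obtain ⟨ρ', h1, h2⟩ := hlarge u hu hs hE ℓ k i a a'
    refine ⟨ρ', h1, fun q hq => ⟨h2.trans ?_, h2.trans ?_⟩⟩
    · beta_reduce
      rw [if_neg hD]
      exact exp_decay_le_sq (hpre q zero_le_one hq) (by linarith) (hP _ _) hη hr
    · beta_reduce
      rw [if_neg hD]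
      exact exp_decay_le_sq (hpre q (by positivity) hq) le_rfl (hP _ _) hη hr
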